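/- Let $\Omega\subset\mathbb R^3$ be a bounded, connected domain with $C^\infty$ boundary $\Gamma$, let $\nu$ be the Euclidean unit inner normal to $\Gamma$, and let $\varepsilon,\mu\in C^\infty(\overline\Omega)$ be real-valued and strictly positive. Write $\langle a,b\rangle=a_1b_1+a_2b_2+a_3b_3$, let $\|\cdot\|$ and $\|\cdot\|_0$ be the norms of $L^2(\Omega)$ and $L^2(\Gamma)$ (scalar- or $\mathbb C^3$-valued), and let $\|F\|_{\mathcal H_1}=\big(\|F\|_0^2+\sum_{j=1}^3\|h\nabla_\Gamma F_j\|_0^2\big)^{1/2}$ be the semiclassical norm of $H^1(\Gamma;\mathbb C^3)$. Put $\|U\|^2=\|U_1\|^2+\|U_2\|^2$ and $\|\mathrm{div}\,U\|^2=\|\mathrm{div}\,U_1\|^2+\|\mathrm{div}\,U_2\|^2$. For $h>0$ and $z\in\mathbb C$ consider $$h\nabla\times E=iz\mu H+U_1\ \text{ in }\Omega,\qquad h\nabla\times H=-iz\varepsilon E+U_2\ \text{ in }\Omega,\qquad \nu\times E=\widetilde f\ \text{ on }\Gamma.\tag{1}$$ Here $E,H\in L^2(\Omega;\mathbb C^3)$,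 the first two equations hold in the sense of distributions, and $E,H$ have traces $f=E|_\Gamma$, $g=H|_\Gamma$ in $L^2(\Gamma;\mathbb C^3)$; the trace operator is the closure of the restriction $F\mapsto F|_\Gamma$ from $C^\infty(\overline\Omega;\mathbb C^3)$ with the norm $\|F\|+\|\nabla\times F\|+\|\mathrm{div}\,F\|$ to $L^2(\Gamma;\mathbb C^3)$. There are constants $C,h_0>0$, depending only on $\Omega,\varepsilon,\mu$, such that the following holds for all $0<h\le h_0$ and all $z$ with $\max(|\mathrm{Re}\,z|,|\mathrm{Im}\,z|)=1$ and $\theta:=|\mathrm{Im}\,z|>0$. (a) If $\widetilde f\in H^1(\Gamma;\mathbb C^3)$, $\langle\nu,\widetilde f\rangle=0$, and $(E,H)$ satisfies (1) with $U_1=U_2=0$, then $$\|f\|_0+\|g\|_0\le C\,\theta^{-1}\|\widetilde f\|_{\mathcal H_1}.$$ (b) If $U_1,U_2\in L^2(\Omega;\mathbb C^3)$, $\mathrm{div}\,U_1,\mathrm{div}\,U_2\in L^2(\Omega)$, the normal trace $u_1=\langle\nu,U_1|_\Gamma\rangle$ (in the sense of Green's formula) is in $L^2(\Gamma)$, and $(E,H)$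 satisfies (1) with $\widetilde f=0$, then $$\|f\|_0+\|g\|_0\le C\big(\|u_1\|_0+h^{-1/2}\theta^{-1}\|U\|+h^{1/2}\|\mathrm{div}\,U\|\big).$$ -/

import Mathlib

open MeasureTheory Filter Topology
open scoped ContDiff

noncomputable section

namespace Maxwell

/-- Physical space `ℝ³` with the Euclidean norm. -/
abbrev R3 : Type := EuclideanSpace ℝ (Fin 3)

/-- Values of the fields: `ℂ³` with the Hermitian norm. -/
abbrev C3 : Type := EuclideanSpace ℂ (Fin 3)

/-! ### Vector algebra and classical differential operators -/

/-- A real vector regarded as a complex one. -/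
def cvec (v : R3) : C3 := WithLp.toLp 2 fun i => (v i : ℂ)

/-- The bilinear (not sesquilinear) product `⟨a, b⟩ = a₁b₁ + a₂b₂ + a₃b₃`. -/
def dot (a b : C3) : ℂ := ∑ i, a i * b i

/-- The vector product `a × b`. -/
def cross (a b : C3) : C3 := WithLp.toLp 2 (crossProduct (WithLp.ofLp a) (WithLp.ofLp b))

/-- The partial derivative `∂u/∂xᵢ` of a complex-valued function on `ℝ³`. -/
def pd (i : Fin 3) (u : R3 → ℂ) (x : R3) : ℂ := fderiv ℝ u x (EuclideanSpace.single i 1)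

/-- The gradient `∇u`. -/
def grad (u : R3 → ℂ) (x : R3) : C3 := WithLp.toLp 2 fun i => pd i u x

/-- The divergence `⟨∇, F⟩`. -/
def dvg (F : R3 → C3) (x : R3) : ℂ := ∑ i, pd i (fun y => F y i) x

/-- The curl `∇ × F`. -/
def curl (F : R3 → C3) (x : R3) : C3 :=
  WithLp.toLp 2
    ![pd 1 (fun y => F y 2) x - pd 2 (fun y => F y 1) x,
      pd 2 (fun y => F y 0) x - pd 0 (fun y => F y 2) x,
      pd 0 (fun y => F y 1) x - pd 1 (fun y => F y 0) x]

/-! ### The domain, its boundary, and `L²` norms -/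

/-- Near `p`, the set `Ω` is `{ρ > 0}` for a smooth `ρ` with non-vanishing gradient at `p`. -/
def IsDefiningFunctionAt (Ω : Set R3) (p : R3) (ρ : R3 → ℝ) : Prop :=
  ContDiff ℝ ∞ ρ ∧ gradient ρ p ≠ 0 ∧ ∀ᶠ x in 𝓝 p, (x ∈ Ω ↔ 0 < ρ x)

/-- `Ω` has a `C^∞` boundary and lies locally on one side of it. -/
def HasSmoothBoundary (Ω : Set R3) : Prop :=
  ∀ p ∈ frontier Ω, ∃ ρ, IsDefiningFunctionAt Ω p ρ

/-- On `∂Ω`, `ν` is the unit normal that points into `Ω`. -/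
def IsInnerUnitNormal (Ω : Set R3) (ν : R3 → R3) : Prop :=
  ∀ p ∈ frontier Ω, ∃ ρ, IsDefiningFunctionAt Ω p ρ ∧ ν p = ‖gradient ρ p‖⁻¹ • gradient ρ p

/-- Lebesgue measure on `Ω`. -/
def vol (Ω : Set R3) : Measure R3 := volume.restrict Ω

/-- The surface measure of `Γ = ∂Ω`: two-dimensional Hausdorff measure, normalized so that it is
Lebesgue measure on planes. -/
def surf (Ω : Set R3) : Measure R3 :=
  (Measure.euclideanHausdorffMeasure 2 : Measure R3).restrict (frontier Ω)

/-- The `L²` norm; it is only used for functions that are in `L²`. -/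
def L2norm {F : Type*} [NormedAddCommGroup F] (m : Measure R3) (u : R3 → F) : ℝ :=
  (eLpNorm u 2 m).toReal

/-! ### Weak derivatives and traces -/

/-- `∇ × F = G` in `Ω` in the sense of distributions. -/
def IsWeakCurl (Ω : Set R3) (F G : R3 → C3) : Prop :=
  ∀ Φ : R3 → C3, ContDiff ℝ ∞ Φ → HasCompactSupport Φ → tsupport Φ ⊆ Ω →
    ∫ x in Ω, dot (F x) (curl Φ x) = ∫ x in Ω, dot (G x) (Φ x)

/-- `div F = D` in `Ω` in the sense of distributions. -/
def IsWeakDiv (Ω : Set R3) (F : R3 → C3) (D : R3 → ℂ) : Prop :=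
  ∀ φ : R3 → ℂ, ContDiff ℝ ∞ φ → HasCompactSupport φ → tsupport φ ⊆ Ω →
    ∫ x in Ω, dot (F x) (grad φ x) = -∫ x in Ω, D x * φ x

/-- `u = ⟨ν, F|_Γ⟩` is the normal trace of a field `F` with `div F = D`, in the sense of Green's
formula (`ν` is the inner normal, whence the sign). -/
def IsNormalTrace (Ω : Set R3) (F : R3 → C3) (D u : R3 → ℂ) : Prop :=
  ∀ φ : R3 → ℂ, ContDiff ℝ ∞ φ → HasCompactSupport φ →
    ∫ x in Ω, (dot (F x) (grad φ x) + D x * φ x) = -∫ x, u x * φ x ∂(surf Ω)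

/-- `f = F|_Γ` in `L²(Γ; ℂ³)`: the graph of the trace operator on fields with curl and divergence
in `L²(Ω)`, that is, the closure of the graph of the restriction `F ↦ F|_Γ` on `C^∞(closure Ω)`,
for the norms `‖F‖ + ‖curl F‖ + ‖div F‖` in `L²(Ω)` and `‖f‖` in `L²(Γ)`. The limits `C`, `D`
are then the weak curl and the weak divergence of `F`. -/
def HasTrace (Ω : Set R3) (F f : R3 → C3) : Prop :=
  MemLp F 2 (vol Ω) ∧ MemLp f 2 (surf Ω) ∧
  ∃ (C : R3 → C3) (D : R3 → ℂ), MemLp C 2 (vol Ω) ∧ MemLp D 2 (vol Ω) ∧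
    ∃ S : ℕ → R3 → C3, (∀ n, ContDiff ℝ ∞ (S n)) ∧
      Tendsto (fun n => eLpNorm (S n - F) 2 (vol Ω)) atTop (𝓝 0) ∧
      Tendsto (fun n => eLpNorm (curl (S n) - C) 2 (vol Ω)) atTop (𝓝 0) ∧
      Tendsto (fun n => eLpNorm (dvg (S n) - D) 2 (vol Ω)) atTop (𝓝 0) ∧
      Tendsto (fun n => eLpNorm (S n - f) 2 (surf Ω)) atTop (𝓝 0)

/-! ### The Sobolev space `H¹(Γ)` -/

/-- The surface divergence `div_Γ Φ = div Φ - ⟨ν, (DΦ) ν⟩` of a smooth field `Φ` tangent to `Γ`. -/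
def surfDiv (ν Φ : R3 → R3) (x : R3) : ℝ :=
  (∑ i, fderiv ℝ Φ x (EuclideanSpace.single i 1) i) - inner ℝ (ν x) (fderiv ℝ Φ x (ν x))

/-- `u ∈ H¹(Γ)`, with tangential gradient `∇_Γ u = G` in the weak sense. -/
def IsTangentialGradient (Ω : Set R3) (ν : R3 → R3) (u : R3 → ℂ) (G : R3 → C3) : Prop :=
  MemLp u 2 (surf Ω) ∧ MemLp G 2 (surf Ω) ∧
  (∀ᵐ x ∂(surf Ω), dot (cvec (ν x)) (G x) = 0) ∧
  ∀ Φ : R3 → R3, ContDiff ℝ ∞ Φ → (∀ x ∈ frontier Ω, inner ℝ (ν x) (Φ x) = 0) →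
    ∫ x, u x * (surfDiv ν Φ x : ℂ) ∂(surf Ω) = -∫ x, dot (G x) (cvec (Φ x)) ∂(surf Ω)

/-- The semiclassical norm of `H¹(Γ; ℂ³)`, `‖F‖² + ∑ⱼ ‖h ∇_Γ Fⱼ‖²` under the root, of a field `F`
whose components `Fⱼ` have tangential gradients `G j`. -/
def H1norm (Ω : Set R3) (h : ℝ) (F : R3 → C3) (G : Fin 3 → R3 → C3) : ℝ :=
  √(L2norm (surf Ω) F ^ 2 + h ^ 2 * ∑ j, L2norm (surf Ω) (G j) ^ 2)

/-! ### The semiclassical Maxwell system -/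

/-- `E`, `H` in `L²(Ω; ℂ³)` solve
`h ∇ × E = i z μ H + U₁`, `h ∇ × H = -i z ε E + U₂` in `Ω` (weakly), have the traces
`E|_Γ = f`, `H|_Γ = g`, and satisfy `ν × E = ftilde` on `Γ`. -/
structure IsSolution (Ω : Set R3) (ν : R3 → R3) (eps mu : R3 → ℝ) (h : ℝ) (z : ℂ)
    (U₁ U₂ ftilde E H f g : R3 → C3) : Prop where
  curl_E : IsWeakCurl Ω (fun x => (h : ℂ) • E x)
    (fun x => (Complex.I * z * (mu x : ℂ)) • H x + U₁ x)
  curl_H : IsWeakCurl Ω (fun x => (h : ℂ) • H x)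
    (fun x => -((Complex.I * z * (eps x : ℂ)) • E x) + U₂ x)
  trace_E : HasTrace Ω E f
  trace_H : HasTrace Ω H g
  boundary : ∀ᵐ x ∂(surf Ω), cross (cvec (ν x)) (f x) = ftilde x

end Maxwell

end

/-! The argument is a Rellich (multiplier) identity combined with the energy identity. Let `N` be a
smooth extension of the normal. In `div(|S|² N - ⟨N, S̄⟩ S - ⟨N, S⟩ S̄)` the first derivatives of
`S` occur only through `div S` and `curl S`, and on Γ the normal component of this field is `|S|² -
2|⟨ν, S⟩|²`. Integration gives `rellich`: `‖f‖² - 2‖⟨ν, f⟩‖²` is bounded in absolute value by a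
constant times `‖F‖ (‖F‖ + ‖div F‖ + ‖curl F‖)`. Since `|f|² = |ν × f|² + |⟨ν, f⟩|²`, the two signs
of this bound serve the two fields differently: `‖f‖² ≤ 2‖ν × f‖² + R_E` for `E`, whose tangential
trace is prescribed, and `‖g‖² ≤ 2‖⟨ν, g⟩‖² + R_H` for `H`.

The normal trace of `H` is read off the first Maxwell equation: `i z μ ⟨ν, H⟩` is, up to sign, `h
div_Γ (ν × E) + u₁`. In (a) this costs one tangential derivative of the data, weighted by `h`; in
(b) it is `u₁` alone (`L2norm_normal_trace_le`, `exists_surface_divergence`).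

The remainders are controlled by the equations. They give `h curl` directly, and, after taking the
divergence, `div E` and `div H` in terms of the fields and `div U`; hence `h R` is at most a
constant times `‖E‖² + ‖H‖² + ‖U‖² + h²‖div U‖²`. The real part of the energy identity
(`energy_estimate`) bounds `θ(‖E‖² + ‖H‖²)` by source terms and the boundary term `h‖ν × f‖‖g‖`. The
factor `h` there cancels the `h⁻¹` lost in `R`, so what remains, `θ⁻¹‖ν × f‖‖g‖`, is absorbed by
Young's inequality (`trace_absorb`).

All identities are proved for smooth fields and pass to the limit in the graph closure that defines
the trace. They rest on the divergence theorem for Hausdorff surface measure, `integral_fderiv`: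
Fubini along lines transversal to Γ, the fact that projecting Γ along a unit vector `v` multiplies
area by `⟨ν, v⟩`, and a partition of unity. -/

noncomputable section

namespace Maxwell

/-! ### Locally comparable measures -/

theorem ennreal_le_of_forall_one_lt_mul {a b : ENNReal}
    (h : ∀ c : NNReal, 1 < c → a ≤ (c : ENNReal) * b) : a ≤ b := by
  have h1 : Tendsto (fun c : NNReal => (c : ENNReal) * b) (𝓝[>] 1) (𝓝 ((1 : NNReal) * b)) := by
    refine ENNReal.Tendsto.mul_const ?_ (Or.inl (by simp))
    exact (ENNReal.continuous_coe.tendsto 1).mono_left nhdsWithin_le_nhds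
  have h2 := ge_of_tendsto h1 (by filter_upwards [self_mem_nhdsWithin] with c hc using h c hc)
  simpa using h2

/-- Countably many of the neighbourhoods already cover the space; making them disjoint cuts any
measurable set into measurable pieces, each inside a single neighbourhood. -/
theorem measure_le_of_locally_le {X : Type*} [TopologicalSpace X] [SecondCountableTopology X]
    [MeasurableSpace X] [OpensMeasurableSpace X] {m₁ m₂ : Measure X}
    (h : ∀ x, ∃ U ∈ 𝓝 x, ∀ B ⊆ U, MeasurableSet B → m₁ B ≤ m₂ B) : m₁ ≤ m₂ := by
  choose U hU hUB using h
  obtain ⟨s, hs, hcov⟩ := TopologicalSpace.countable_cover_nhds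
    (f := fun x => interior (U x)) (fun x => interior_mem_nhds.2 (hU x))
  rcases s.eq_empty_or_nonempty with rfl | hne
  · have : IsEmpty X := by
      rw [← Set.univ_eq_empty_iff, ← hcov]; simp
    refine Measure.le_iff.2 fun B _ => ?_
    rw [Set.eq_empty_of_isEmpty B]; simp
  obtain ⟨e, rfl⟩ := hs.exists_eq_range hne
  have hcov' : ⋃ n, interior (U (e n)) = Set.univ := by simpa using hcov
  have hm : ∀ n, MeasurableSet (disjointed (fun n => interior (U (e n))) n) :=
    fun n => MeasurableSet.disjointed (fun i => isOpen_interior.measurableSet) n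
  refine Measure.le_iff.2 fun B hB => ?_
  have hdec : B = ⋃ n, B ∩ disjointed (fun n => interior (U (e n))) n := by
    rw [← Set.inter_iUnion, iUnion_disjointed, hcov', Set.inter_univ]
  have hdis : Pairwise (Function.onFun Disjoint
      fun n => B ∩ disjointed (fun n => interior (U (e n))) n) := fun i j hij =>
    ((disjoint_disjointed _) hij).mono Set.inter_subset_right Set.inter_subset_right
  rw [hdec, measure_iUnion hdis (fun n => hB.inter (hm n)),
    measure_iUnion hdis (fun n => hB.inter (hm n))]
  refine ENNReal.tsum_le_tsum fun n => hUB (e n) _ ?_ (hB.inter (hm n))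
  exact Set.inter_subset_right.trans ((disjointed_subset _ _).trans interior_subset)

/-- Continuity of `w` allows the frozen value `w x` to be replaced by the varying `w y` at the price
of a second factor `c`. The resulting bounds globalize, and `c → 1` gives equality. -/
theorem eq_withDensity_of_locally_comparable {X : Type*} [TopologicalSpace X]
    [SecondCountableTopology X] [MeasurableSpace X] [OpensMeasurableSpace X] {m σ : Measure X}
    {w : X → NNReal} (hw : Continuous w) (hw0 : ∀ x, 0 < w x)
    (h : ∀ x, ∀ c : NNReal, 1 < c → ∃ U ∈ 𝓝 x, ∀ B ⊆ U,
      m B ≤ c * w x * σ B ∧ w x * σ B ≤ c * m B) :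
    m = σ.withDensity fun x => (w x : ENNReal) := by
  have key : ∀ x, ∀ c : NNReal, 1 < c → ∃ U ∈ 𝓝 x, ∀ B ⊆ U, MeasurableSet B →
      m B ≤ (c * c : NNReal) * σ.withDensity (fun x => (w x : ENNReal)) B ∧
      σ.withDensity (fun x => (w x : ENNReal)) B ≤ (c * c : NNReal) * m B := by
    intro x c hc
    obtain ⟨U, hU, hB⟩ := h x c hc
    have hc0 : 0 < c := zero_lt_one.trans hc
    have h1 : ∀ᶠ y in 𝓝 x, w x < c * w y := by
      have : Tendsto (fun y => c * w y) (𝓝 x) (𝓝 (c * w x)) :=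
        ((continuous_const.mul hw).tendsto x)
      exact this.eventually (lt_mem_nhds (lt_mul_of_one_lt_left (hw0 x) hc))
    have h2 : ∀ᶠ y in 𝓝 x, w y < c * w x :=
      (hw.tendsto x).eventually (gt_mem_nhds (lt_mul_of_one_lt_left (hw0 x) hc))
    refine ⟨U ∩ {y | w x < c * w y ∧ w y < c * w x}, inter_mem hU (h1.and h2), ?_⟩
    intro B hBU hBm
    obtain ⟨hB1, hB2⟩ := hB B (hBU.trans Set.inter_subset_left)
    rw [withDensity_apply _ hBm]
    constructor
    · have : (w x : ENNReal) * σ B ≤ c * ∫⁻ y in B, (w y : ENNReal) ∂σ := by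
        rw [← lintegral_const_mul _ (by fun_prop), ← setLIntegral_const]
        refine setLIntegral_mono (by fun_prop) fun y hy => ?_
        exact_mod_cast (hBU hy).2.1.le
      calc m B ≤ c * w x * σ B := hB1
        _ = c * (w x * σ B) := by ring
        _ ≤ c * (c * ∫⁻ y in B, (w y : ENNReal) ∂σ) := by gcongr
        _ = _ := by push_cast; ring
    · have : ∫⁻ y in B, (w y : ENNReal) ∂σ ≤ c * w x * σ B := by
        rw [← setLIntegral_const]
        refine setLIntegral_mono (by fun_prop) fun y hy => ?_
        exact_mod_cast (hBU hy).2.2.le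
      calc _ ≤ c * w x * σ B := this
        _ = c * (w x * σ B) := by ring
        _ ≤ c * (c * m B) := by gcongr
        _ = _ := by push_cast; ring
  have hsq : ∀ c : NNReal, 1 < c → ∃ d : NNReal, 1 < d ∧ d * d ≤ c := by
    intro c hc
    refine ⟨NNReal.sqrt c, ?_, (NNReal.mul_self_sqrt c).le⟩
    simpa using NNReal.sqrt_lt_sqrt.2 hc
  have main : ∀ m₁ m₂ : Measure X, (∀ x, ∀ c : NNReal, 1 < c → ∃ U ∈ 𝓝 x, ∀ B ⊆ U,
      MeasurableSet B → m₁ B ≤ (c * c : NNReal) * m₂ B) → m₁ ≤ m₂ := by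
    intro m₁ m₂ hm
    refine Measure.le_iff.2 fun B hB => ennreal_le_of_forall_one_lt_mul fun c hc => ?_
    obtain ⟨d, hd, hdc⟩ := hsq c hc
    have : m₁ ≤ ((d * d : NNReal) : ENNReal) • m₂ := by
      refine measure_le_of_locally_le fun x => ?_
      obtain ⟨U, hU, h⟩ := hm x d hd
      exact ⟨U, hU, fun B hBU hB => by simpa using h B hBU hB⟩
    refine (Measure.le_iff.1 this B hB).trans ?_
    simp only [Measure.smul_apply, smul_eq_mul]
    gcongr
  refine le_antisymm (main _ _ fun x c hc => ?_) (main _ _ fun x c hc => ?_)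
  · obtain ⟨U, hU, h⟩ := key x c hc
    exact ⟨U, hU, fun B hB hBm => (h B hB hBm).1⟩
  · obtain ⟨U, hU, h⟩ := key x c hc
    exact ⟨U, hU, fun B hB hBm => (h B hB hBm).2⟩

/-! ### Projection along a basis vector -/

/-- The Euclidean plane. -/
abbrev R2 : Type := EuclideanSpace ℝ (Fin 2)

/-- The first two coordinates with respect to an orthonormal basis. -/
def proj (b : OrthonormalBasis (Fin 3) ℝ R3) : R3 →L[ℝ] R2 :=
  LinearMap.toContinuousLinearMap
    { toFun := fun x => !₂[inner ℝ (b 0) x, inner ℝ (b 1) x]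
      map_add' := fun x y => by ext i; fin_cases i <;> simp [inner_add_right]
      map_smul' := fun c x => by ext i; fin_cases i <;> simp [inner_smul_right] }

/-- The embedding of the plane spanned by the first two basis vectors. -/
def incl (b : OrthonormalBasis (Fin 3) ℝ R3) : R2 →L[ℝ] R3 :=
  LinearMap.toContinuousLinearMap
    { toFun := fun y => y 0 • b 0 + y 1 • b 1
      map_add' := fun x y => by simp only [PiLp.add_apply]; module
      map_smul' := fun c x => by simp only [PiLp.smul_apply, RingHom.id_apply, smul_eq_mul]; module }

theorem proj_apply (b : OrthonormalBasis (Fin 3) ℝ R3) (x : R3) :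
    proj b x = !₂[inner ℝ (b 0) x, inner ℝ (b 1) x] := rfl

theorem incl_apply (b : OrthonormalBasis (Fin 3) ℝ R3) (y : R2) :
    incl b y = y 0 • b 0 + y 1 • b 1 := rfl

theorem incl_proj_add (b : OrthonormalBasis (Fin 3) ℝ R3) (x : R3) :
    incl b (proj b x) + inner ℝ (b 2) x • b 2 = x := by
  conv_rhs => rw [← b.sum_repr' x]
  simp [incl_apply, proj_apply, Fin.sum_univ_three]

theorem norm_sq_proj_add (b : OrthonormalBasis (Fin 3) ℝ R3) (x : R3) :
    ‖proj b x‖ ^ 2 + inner ℝ (b 2) x ^ 2 = ‖x‖ ^ 2 := by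
  rw [← b.sum_sq_inner_right x, EuclideanSpace.norm_sq_eq]
  simp [proj_apply, Fin.sum_univ_two, Fin.sum_univ_three]

theorem proj_incl (b : OrthonormalBasis (Fin 3) ℝ R3) (y : R2) : proj b (incl b y) = y := by
  have h := orthonormal_iff_ite.1 b.orthonormal
  ext i
  fin_cases i <;> simp [incl_apply, proj_apply, inner_add_right, inner_smul_right, h]

theorem proj_self (b : OrthonormalBasis (Fin 3) ℝ R3) : proj b (b 2) = 0 := by
  have h := orthonormal_iff_ite.1 b.orthonormal
  ext i
  fin_cases i <;> simp [proj_apply, h]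

/-- The determinant is a 2×2 minor of the orthogonal change-of-basis matrix. The adjugate of an
orthogonal matrix is `±` its transpose, so each minor equals, up to sign, the complementary entry.
This is the cosine by which projection shrinks area. -/
theorem abs_det_proj_comp_incl (b b' : OrthonormalBasis (Fin 3) ℝ R3) :
    |LinearMap.det ((proj b ∘L incl b' : R2 →L[ℝ] R2) : R2 →ₗ[ℝ] R2)| = |inner ℝ (b 2) (b' 2)| := by
  classical
  set O : Matrix (Fin 3) (Fin 3) ℝ := b.toBasis.toMatrix ⇑b' with hO
  have hOa : ∀ i j, O i j = inner ℝ (b i) (b' j) := fun i j => by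
    simp [hO, Module.Basis.toMatrix_apply, b.repr_apply_apply]
  have hu : O ∈ Matrix.unitaryGroup (Fin 3) ℝ := b.toMatrix_orthonormalBasis_mem_unitary b'
  have hOO : O * O.transpose = 1 := by
    have := Matrix.mem_unitaryGroup_iff.1 hu
    simpa [Matrix.star_eq_conjTranspose, Matrix.conjTranspose_eq_transpose_of_trivial] using this
  have hadj : O.adjugate = O.det • O.transpose := by
    calc O.adjugate = O.adjugate * (O * O.transpose) := by rw [hOO, mul_one]
      _ = (O.adjugate * O) * O.transpose := by rw [mul_assoc]
      _ = _ := by rw [Matrix.adjugate_mul]; simp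
  have hdet : |O.det| = 1 := by
    have : O.det * O.det = 1 := by
      have := congrArg Matrix.det hOO
      simpa using this
    rcases mul_self_eq_one_iff.1 this with h | h <;> simp [h]
  have h22 := congrFun (congrFun hadj 2) 2
  rw [Matrix.adjugate_fin_three] at h22
  simp only [Matrix.smul_apply, Matrix.transpose_apply, smul_eq_mul, Matrix.of_apply,
    Matrix.cons_val] at h22
  have hL : LinearMap.det ((proj b ∘L incl b' : R2 →L[ℝ] R2) : R2 →ₗ[ℝ] R2)
      = O 0 0 * O 1 1 - O 0 1 * O 1 0 := by
    rw [← LinearMap.det_toMatrix (EuclideanSpace.basisFun (Fin 2) ℝ).toBasis, Matrix.det_fin_two]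
    simp [LinearMap.toMatrix_apply, hOa, incl_apply, proj_apply]
  rw [hL, h22, abs_mul, hdet, one_mul, hOa]

/-- Coordinates `(y, t)` with respect to an orthonormal basis. -/
theorem measurePreserving_incl_add (b : OrthonormalBasis (Fin 3) ℝ R3) :
    MeasurePreserving (fun q : R2 × ℝ => incl b q.1 + q.2 • b 2) (volume.prod volume) volume := by
  have h1 : MeasurePreserving (fun q : R2 × ℝ => (q.2, WithLp.ofLp q.1))
      (volume.prod volume) (volume.prod volume) :=
    (MeasurePreserving.prod (.id volume)
      (EuclideanSpace.volume_preserving_symm_measurableEquiv_toLp (Fin 2))).comp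
      Measure.measurePreserving_swap
  have h2 := (volume_preserving_piFinSuccAbove (fun _ : Fin 3 => ℝ) 2).symm
  have h3 := ((EuclideanSpace.volume_preserving_symm_measurableEquiv_toLp (Fin 3)).symm)
  have h4 := b.measurePreserving_repr_symm.comp (h3.comp (h2.comp h1))
  convert h4 using 1
  ext1 q
  simp only [Function.comp]
  rw [← b.sum_repr_symm]
  simp only [MeasurableEquiv.symm_symm, Fin.sum_univ_three, incl_apply]
  rfl

/-! ### Comparison of surface measure with its projection -/

theorem _root_.LipschitzOnWith.euclideanHausdorffMeasure_image_le {X Y : Type*} [EMetricSpace X]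
    [EMetricSpace Y] [MeasurableSpace X] [BorelSpace X] [MeasurableSpace Y] [BorelSpace Y]
    {K : NNReal} {f : X → Y} {s : Set X} (h : LipschitzOnWith K f s) (d : ℕ) :
    Measure.euclideanHausdorffMeasure d (f '' s)
      ≤ (K : ENNReal) ^ d * Measure.euclideanHausdorffMeasure d s := by
  simp_rw [Measure.euclideanHausdorffMeasure_def, Measure.smul_apply, ENNReal.smul_def, smul_eq_mul]
  have := h.hausdorffMeasure_image_le (d := (d : ℝ)) (by positivity)
  rw [ENNReal.rpow_natCast] at this
  calc _ ≤ _ * ((K : ENNReal) ^ d * Measure.hausdorffMeasure (d : ℝ) s) := by gcongr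
    _ = _ := by ring

/-- `K` has the tangent plane `n^⊥` at `q`, in the strict sense. -/
def IsFlatAt (K : Set R3) (n q : R3) : Prop :=
  ∀ δ : ℝ, 0 < δ → ∃ U ∈ 𝓝 q, ∀ x ∈ U ∩ K, ∀ y ∈ U ∩ K, |inner ℝ n (x - y)| ≤ δ * ‖x - y‖

theorem exists_orthonormalBasis_apply_two_eq {n : R3} (hn : ‖n‖ = 1) :
    ∃ b : OrthonormalBasis (Fin 3) ℝ R3, b 2 = n := by
  have h : Orthonormal ℝ (({2} : Set (Fin 3)).domRestrict (fun _ => n)) := by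
    rw [orthonormal_iff_ite]
    rintro ⟨i, hi⟩ ⟨j, hj⟩
    obtain rfl : i = 2 := hi
    obtain rfl : j = 2 := hj
    simp [hn]
  obtain ⟨b, hb⟩ := h.exists_orthonormalBasis_extension_of_card_eq (by simp)
  exact ⟨b, hb 2 rfl⟩

/-- The map `κ` sends a point to the tangent plane `n^⊥` along the direction `b 2`. Differences of
nearby points of `K` are almost tangential, and `κ` preserves tangential vectors, so on small pieces
of `K` it is bi-Lipschitz with constants close to 1. Then `proj b` is `κ` followed by the linear map
`L` of the plane, which multiplies area by exactly `w`. -/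
theorem IsFlatAt.comparable {K : Set R3} {n q : R3} (hK : IsFlatAt K n q) (hn : ‖n‖ = 1)
    (b : OrthonormalBasis (Fin 3) ℝ R3) {w : NNReal} (hw : |inner ℝ (b 2) n| = w) (hw0 : 0 < w)
    {c : NNReal} (hc : 1 < c) :
    ∃ U ∈ 𝓝 q, ∀ B ⊆ U ∩ K,
      volume (proj b '' B) ≤ c * w * Measure.euclideanHausdorffMeasure 2 B ∧
      w * Measure.euclideanHausdorffMeasure 2 B ≤ c * volume (proj b '' B) := by
  obtain ⟨b', hb'⟩ := exists_orthonormalBasis_apply_two_eq hn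
  set L : R2 →L[ℝ] R2 := proj b ∘L incl b' with hL
  have hdet : |LinearMap.det (L : R2 →ₗ[ℝ] R2)| = w := by
    rw [hL, abs_det_proj_comp_incl, hb', hw]
  have hdet0 : LinearMap.det (L : R2 →ₗ[ℝ] R2) ≠ 0 := by
    intro h
    rw [h, abs_zero] at hdet
    exact hw0.ne' (by exact_mod_cast hdet.symm)
  set e : R2 ≃ₗ[ℝ] R2 := LinearEquiv.ofIsUnitDet (f := (L : R2 →ₗ[ℝ] R2))
    (v := Module.finBasis ℝ R2) (v' := Module.finBasis ℝ R2)
    (by rw [LinearMap.det_toMatrix]; exact isUnit_iff_ne_zero.2 hdet0) with he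
  have heL : ∀ y, e y = L y := fun y => rfl
  set κ : R3 →ₗ[ℝ] R2 := e.symm.toLinearMap ∘ₗ (proj b : R3 →ₗ[ℝ] R2) with hκ
  have hLκ : ∀ x, L (κ x) = proj b x := fun x => by
    rw [← heL, hκ]; simp
  have hκd : ∀ d, κ d = proj b' d + inner ℝ n d • κ n := fun d => by
    have h1 : d = incl b' (proj b' d) + inner ℝ n d • n := by
      conv_lhs => rw [← incl_proj_add b' d, hb']
    have h2 : ∀ y, κ (incl b' y) = y := fun y => by
      have : proj b (incl b' y) = e y := rfl
      simp [hκ, this]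
    conv_lhs => rw [h1, map_add, map_smul, h2]
  -- Lipschitz constants enter two-dimensional measure squared, hence the square root of `c`.
  obtain ⟨c', hc'1, hc'⟩ : ∃ d : NNReal, 1 < d ∧ d ^ 2 = c :=
    ⟨NNReal.sqrt c, by simpa using NNReal.sqrt_lt_sqrt.2 hc, NNReal.sq_sqrt c⟩
  have hc'1' : (1 : ℝ) < c' := by exact_mod_cast hc'1
  set M : ℝ := ‖κ n‖
  have hM : 0 ≤ M := norm_nonneg _
  -- `δ (1 + M) ≤ 1 - 1 / c'`
  set δ : ℝ := (1 - 1 / c') / (1 + M) with hδ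
  have h1c : 0 < 1 - 1 / (c' : ℝ) := by
    have : 1 / (c' : ℝ) < 1 := by rw [div_lt_one (by linarith)]; exact hc'1'
    linarith
  have hδ0 : 0 < δ := by positivity
  have hδM : δ * (1 + M) = 1 - 1 / c' := by rw [hδ]; field_simp
  obtain ⟨U, hU, hUK⟩ := hK δ hδ0
  have hnorm : ∀ x ∈ U ∩ K, ∀ y ∈ U ∩ K,
      ‖κ (x - y)‖ ≤ c' * ‖x - y‖ ∧ ‖x - y‖ ≤ c' * ‖κ (x - y)‖ := by
    intro x hx y hy
    set d := x - y
    have h1 : |inner ℝ n d| ≤ δ * ‖d‖ := hUK x hx y hy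
    have h2 := norm_sq_proj_add b' d
    rw [hb'] at h2
    have h3 : ‖proj b' d‖ ≤ ‖d‖ := by
      refine le_of_sq_le_sq (α := ℝ) ?_ (norm_nonneg _)
      nlinarith [sq_nonneg (inner ℝ n d)]
    have h4 : ‖d‖ ≤ ‖proj b' d‖ + |inner ℝ n d| := by
      refine le_of_sq_le_sq (α := ℝ) ?_ (by positivity)
      nlinarith [sq_abs (inner ℝ n d), mul_nonneg (norm_nonneg (proj b' d))
        (abs_nonneg (inner ℝ n d))]
    have h5 : ‖inner ℝ n d • κ n‖ = |inner ℝ n d| * M := by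
      rw [norm_smul, Real.norm_eq_abs]
    have h6 : ‖κ d‖ ≤ ‖proj b' d‖ + |inner ℝ n d| * M := by
      rw [hκd d, ← h5]; exact norm_add_le _ _
    have h7 : ‖proj b' d‖ ≤ ‖κ d‖ + |inner ℝ n d| * M := by
      rw [← h5]
      have : proj b' d = κ d - inner ℝ n d • κ n := by rw [hκd d]; abel
      rw [this]; exact norm_sub_le _ _
    have h8 : |inner ℝ n d| * (1 + M) ≤ (1 - 1 / c') * ‖d‖ := by
      rw [← hδM]; nlinarith
    have h9 : |inner ℝ n d| * M ≤ (1 - 1 / c') * ‖d‖ := by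
      nlinarith [abs_nonneg (inner ℝ n d)]
    have h10 : 1 - 1 / (c' : ℝ) ≤ c' - 1 := by
      have : 1 - 1 / (c' : ℝ) = (c' - 1) / c' := by field_simp
      rw [this]
      exact div_le_self (by linarith) hc'1'.le
    constructor
    · nlinarith [norm_nonneg d]
    · have h11 : ‖d‖ * (1 / c') ≤ ‖κ d‖ := by nlinarith
      have h12 : ‖d‖ = c' * (‖d‖ * (1 / c')) := by field_simp
      rw [h12]; gcongr
  refine ⟨U, hU, fun B hB => ?_⟩
  have hlip1 : LipschitzOnWith c' κ B := by
    refine LipschitzOnWith.of_dist_le_mul fun x hx y hy => ?_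
    rw [dist_eq_norm, dist_eq_norm, ← map_sub]
    exact (hnorm x (hB hx) y (hB hy)).1
  have hinj : Set.InjOn κ B := fun x hx y hy hxy => by
    have := (hnorm x (hB hx) y (hB hy)).2
    rw [map_sub, hxy, sub_self, norm_zero, mul_zero] at this
    exact sub_eq_zero.1 (norm_le_zero_iff.1 this)
  -- The lower bound on `κ` makes it injective on `B` with Lipschitz inverse; the inverse yields the
  -- opposite inequality between measures.
  have hlip2 : LipschitzOnWith c' (Function.invFunOn κ B) (κ '' B) := by
    refine LipschitzOnWith.of_dist_le_mul ?_
    rintro _ ⟨x, hx, rfl⟩ _ ⟨y, hy, rfl⟩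
    rw [hinj.leftInvOn_invFunOn hx, hinj.leftInvOn_invFunOn hy, dist_eq_norm, dist_eq_norm,
      ← map_sub]
    exact (hnorm x (hB hx) y (hB hy)).2
  have himg : Function.invFunOn κ B '' (κ '' B) = B := hinj.leftInvOn_invFunOn.image_image
  have hproj : volume (proj b '' B) = w * volume (κ '' B) := by
    have : proj b '' B = L '' (κ '' B) := by
      rw [Set.image_image]; exact Set.image_congr fun x _ => (hLκ x).symm
    rw [this, Measure.addHaar_image_continuousLinearMap]
    change ENNReal.ofReal |LinearMap.det (L : R2 →ₗ[ℝ] R2)| * _ = _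
    rw [hdet, ENNReal.ofReal_coe_nnreal]
  have hb1 := hlip1.euclideanHausdorffMeasure_image_le 2
  have hb2 := hlip2.euclideanHausdorffMeasure_image_le 2
  rw [himg] at hb2
  rw [EuclideanSpace.euclideanHausdorffMeasure_eq_volume] at hb1 hb2
  have hcc : (c : ENNReal) = (c' : ENNReal) ^ 2 := by rw [← hc']; push_cast; rfl
  rw [hproj, hcc]
  constructor
  · calc (w : ENNReal) * volume (κ '' B) ≤ w * (c' ^ 2 * _) := by gcongr
      _ = _ := by ring
  · calc (w : ENNReal) * _ ≤ w * (c' ^ 2 * volume (κ '' B)) := by gcongr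
      _ = _ := by ring

/-- Level sets are flat at regular points. -/
theorem isFlatAt_of_contDiff {ρ : R3 → ℝ} (hρ : ContDiff ℝ ∞ ρ) {q : R3} (hq : gradient ρ q ≠ 0)
    {K : Set R3} (hK : ∀ x ∈ K, ρ x = 0) :
    IsFlatAt K (‖gradient ρ q‖⁻¹ • gradient ρ q) q := by
  intro δ hδ
  -- Strict differentiability is needed because both points vary. As `ρ` vanishes at both, the
  -- linear part alone is small compared with their distance.
  have hs : HasStrictFDerivAt ρ (fderiv ℝ ρ q) q :=
    hρ.contDiffAt.hasStrictFDerivAt (by simp)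
  have hg0 : 0 < ‖gradient ρ q‖ := norm_pos_iff.2 hq
  have := (hs.isLittleO.bound (c := δ * ‖gradient ρ q‖) (by positivity))
  rw [nhds_prod_eq] at this
  obtain ⟨U, hU, h⟩ := (Filter.eventually_prod_self_iff'.1 this)
  refine ⟨U, hU, fun x hx y hy => ?_⟩
  have h1 := h x hx.1 y hy.1
  simp only at h1
  rw [hK x hx.2, hK y hy.2, sub_self, zero_sub, norm_neg, Real.norm_eq_abs] at h1
  have h2 : fderiv ℝ ρ q (x - y) = inner ℝ (gradient ρ q) (x - y) := by
    rw [gradient, InnerProductSpace.toDual_symm_apply]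
  rw [inner_smul_left, ← h2, abs_mul]
  simp only [map_inv₀, conj_trivial, abs_inv, abs_norm]
  rw [inv_mul_le_iff₀ hg0]
  linarith

/-! ### Defining functions and normals -/

theorem eventually_pos_along {ρ : R3 → ℝ} (hρ : ContDiff ℝ ∞ ρ) {p v : R3} (h0 : ρ p = 0)
    (hv : 0 < inner ℝ (gradient ρ p) v) : ∀ᶠ t : ℝ in 𝓝[>] 0, 0 < ρ (p + t • v) := by
  have hd : HasDerivAt (fun t : ℝ => ρ (p + t • v)) (inner ℝ (gradient ρ p) v) 0 := by
    have h1 : HasFDerivAt ρ (fderiv ℝ ρ p) (p + (0 : ℝ) • v) := by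
      rw [zero_smul, add_zero]; exact (hρ.differentiable (by simp)).differentiableAt.hasFDerivAt
    have h2 : HasDerivAt (fun t : ℝ => p + t • v) v 0 := by
      simpa using ((hasDerivAt_id (0 : ℝ)).smul_const v).const_add p
    have := h1.comp_hasDerivAt 0 h2
    rwa [gradient, InnerProductSpace.toDual_symm_apply]
  have := (hasDerivAt_iff_tendsto_slope.1 hd).eventually (lt_mem_nhds hv)
  have h3 := this.filter_mono (nhdsWithin_mono 0 (fun t (ht : 0 < t) => ht.ne'))
  filter_upwards [h3, self_mem_nhdsWithin] with t ht ht0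
  have ht0 : 0 < t := ht0
  rw [slope_def_field] at ht
  simp only [zero_smul, add_zero, h0, sub_zero] at ht
  exact (div_pos_iff_of_pos_right ht0).1 ht

theorem tendsto_add_smul (p v : R3) : Tendsto (fun t : ℝ => p + t • v) (𝓝[>] 0) (𝓝 p) := by
  have : Continuous fun t : ℝ => p + t • v := by fun_prop
  have h := this.tendsto 0
  simp only [zero_smul, add_zero] at h
  exact h.mono_left nhdsWithin_le_nhds

namespace IsDefiningFunctionAt

variable {Ω : Set R3} {p : R3} {ρ : R3 → ℝ}

theorem eq_zero (h : IsDefiningFunctionAt Ω p ρ) (hΩ : IsOpen Ω) (hp : p ∈ frontier Ω) :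
    ρ p = 0 := by
  rw [hΩ.frontier_eq] at hp
  refine le_antisymm ?_ ?_
  · exact not_lt.1 fun hlt => hp.2 (h.2.2.self_of_nhds.2 hlt)
  · by_contra! hlt
    have h1 := h.1.continuous.continuousAt.eventually (gt_mem_nhds hlt)
    obtain ⟨x, hx, h2, h3⟩ := ((mem_closure_iff_frequently.1 hp.1).and_eventually
      (h.2.2.and h1)).exists
    exact absurd (h2.1 hx) (not_lt.2 h3.le)

theorem eventually (h : IsDefiningFunctionAt Ω p ρ) :
    ∀ᶠ q in 𝓝 p, IsDefiningFunctionAt Ω q ρ := by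
  have hc : Continuous (gradient ρ) := by
    unfold gradient
    exact (LinearIsometryEquiv.continuous _).comp (h.1.continuous_fderiv (by simp))
  filter_upwards [hc.continuousAt.eventually_ne h.2.1, h.2.2.eventually_nhds] with q h1 h2
  exact ⟨h.1, h1, h2⟩

theorem mem_frontier (h : IsDefiningFunctionAt Ω p ρ) (hΩ : IsOpen Ω) (h0 : ρ p = 0) :
    p ∈ frontier Ω := by
  rw [hΩ.frontier_eq]
  refine ⟨?_, fun hp => (h.2.2.self_of_nhds.1 hp).ne' h0⟩
  have h1 := eventually_pos_along h.1 h0 (v := gradient ρ p)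
    (by rw [real_inner_self_eq_norm_sq]; exact pow_pos (norm_pos_iff.2 h.2.1) 2)
  have h2 := (tendsto_add_smul p (gradient ρ p)).eventually h.2.2
  refine mem_closure_of_tendsto (tendsto_add_smul p (gradient ρ p)) ?_
  filter_upwards [h1, h2] with t a b using b.2 a

/-- If the unit normals `a` and `b` differed, then `⟨a, b⟩ < 1`, so moving from `p` in the direction
`a - b` would increase `ρ` and decrease `ρ'`: the same points would lie inside and outside `Ω`.
Hence `ν` may be computed from any defining function. -/
theorem normal_unique {ρ' : R3 → ℝ} (h : IsDefiningFunctionAt Ω p ρ)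
    (h' : IsDefiningFunctionAt Ω p ρ') (hΩ : IsOpen Ω) (hp : p ∈ frontier Ω) :
    ‖gradient ρ p‖⁻¹ • gradient ρ p = ‖gradient ρ' p‖⁻¹ • gradient ρ' p := by
  have hg := norm_pos_iff.2 h.2.1
  have hg' := norm_pos_iff.2 h'.2.1
  set a := ‖gradient ρ p‖⁻¹ • gradient ρ p with ha
  set b := ‖gradient ρ' p‖⁻¹ • gradient ρ' p with hb
  have ha1 : ‖a‖ = 1 := by rw [ha, norm_smul, norm_inv, norm_norm, inv_mul_cancel₀ hg.ne']
  have hb1 : ‖b‖ = 1 := by rw [hb, norm_smul, norm_inv, norm_norm, inv_mul_cancel₀ hg'.ne']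
  have hga : gradient ρ p = ‖gradient ρ p‖ • a := by rw [ha, smul_inv_smul₀ hg.ne']
  have hgb : gradient ρ' p = ‖gradient ρ' p‖ • b := by rw [hb, smul_inv_smul₀ hg'.ne']
  by_contra hne
  have hab : inner ℝ a b < 1 := (inner_lt_one_iff_real_of_norm_eq_one ha1 hb1).2 hne
  have h1 := eventually_pos_along h.1 (h.eq_zero hΩ hp) (v := a - b) (by
    rw [hga, inner_smul_left, inner_sub_right, real_inner_self_eq_norm_sq, ha1]
    simp only [conj_trivial]
    exact mul_pos hg (by linarith))
  have h2 := eventually_pos_along (ρ := -ρ') h'.1.neg (p := p) (by simp [h'.eq_zero hΩ hp])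
    (v := a - b) (by
    have : gradient (-ρ') p = -gradient ρ' p := by
      unfold gradient; rw [fderiv_neg, map_neg]
    rw [this, hgb, inner_neg_left, inner_smul_left, inner_sub_right, real_inner_self_eq_norm_sq,
      hb1, real_inner_comm a b]
    simp only [conj_trivial]
    nlinarith)
  have h3 := (tendsto_add_smul p (a - b)).eventually h.2.2
  have h4 := (tendsto_add_smul p (a - b)).eventually h'.2.2
  obtain ⟨t, h1, h2, h3, h4⟩ := (h1.and (h2.and (h3.and h4))).exists
  have := h4.1 (h3.2 h1)
  simp only [Pi.neg_apply] at h2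
  linarith

end IsDefiningFunctionAt

theorem IsInnerUnitNormal.eq {Ω : Set R3} {ν : R3 → R3} (hν : IsInnerUnitNormal Ω ν)
    (hΩ : IsOpen Ω) {p : R3} (hp : p ∈ frontier Ω) {ρ : R3 → ℝ} (h : IsDefiningFunctionAt Ω p ρ) :
    ν p = ‖gradient ρ p‖⁻¹ • gradient ρ p := by
  obtain ⟨ρ', h', e⟩ := hν p hp
  rw [e, h'.normal_unique h hΩ hp]

theorem IsInnerUnitNormal.norm_eq {Ω : Set R3} {ν : R3 → R3} (hν : IsInnerUnitNormal Ω ν)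
    {p : R3} (hp : p ∈ frontier Ω) : ‖ν p‖ = 1 := by
  obtain ⟨ρ', h', e⟩ := hν p hp
  rw [e, norm_smul, norm_inv, norm_norm, inv_mul_cancel₀ (norm_pos_iff.2 h'.2.1).ne']

/-! ### The divergence theorem in a transversal direction -/

/-- This is the fundamental theorem of calculus on one transversal line. On `I`, which contains the
support of `φ`, the set `A` is the part after the zero of `r`; without a zero, the intermediate
value theorem makes it all of `I` or nothing. -/
theorem integral_slice {φ : ℝ → ℂ} (hφ : ContDiff ℝ 1 φ) (hc : HasCompactSupport φ)
    {r : ℝ → ℝ} {A I : Set ℝ} (hI : Convex ℝ I) (hsupp : tsupport φ ⊆ I)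
    (hmono : StrictMonoOn r I) (hcont : ContinuousOn r I) (hA : ∀ t ∈ I, t ∈ A ↔ 0 < r t) :
    (∀ t₀ ∈ I, r t₀ = 0 → ∫ t, A.indicator (deriv φ) t = -φ t₀) ∧
    ((∀ t ∈ I, r t ≠ 0) → ∫ t, A.indicator (deriv φ) t = 0) := by
  have hz : ∀ t, t ∉ I → deriv φ t = 0 := fun t ht => by
    by_contra h
    exact ht (hsupp (support_deriv_subset (Function.mem_support.2 h)))
  constructor
  · intro t₀ ht₀ h0
    have : A.indicator (deriv φ) = (Set.Ioi t₀).indicator (deriv φ) := by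
      ext t
      by_cases ht : t ∈ I
      · have : t ∈ A ↔ t ∈ Set.Ioi t₀ := by
          rw [hA t ht, ← h0, hmono.lt_iff_lt ht₀ ht, Set.mem_Ioi]
        by_cases htA : t ∈ A
        · rw [Set.indicator_of_mem htA, Set.indicator_of_mem (this.1 htA)]
        · rw [Set.indicator_of_notMem htA, Set.indicator_of_notMem (fun h => htA (this.2 h))]
      · simp [Set.indicator, hz t ht]
    rw [this, integral_indicator measurableSet_Ioi, hc.integral_Ioi_deriv_eq hφ]
  · intro hne
    have hfull : ∫ t, deriv φ t = 0 := by
      have hi : Integrable (deriv φ) :=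
        (hφ.continuous_deriv le_rfl).integrable_of_hasCompactSupport hc.deriv
      rw [← integral_add_compl (measurableSet_Iic (a := (0 : ℝ))) hi, Set.compl_Iic,
        hc.integral_Ioi_deriv_eq hφ, hc.integral_Iic_deriv_eq hφ]
      simp
    by_cases hpos : ∀ t ∈ I, 0 < r t
    · have : A.indicator (deriv φ) = deriv φ := by
        ext t
        by_cases ht : t ∈ I
        · simp [Set.indicator, (hA t ht).2 (hpos t ht)]
        · simp [Set.indicator, hz t ht]
      rw [this, hfull]
    · push Not at hpos
      obtain ⟨s, hs, hs0⟩ := hpos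
      have hneg : ∀ t ∈ I, ¬ 0 < r t := by
        intro t ht hlt
        obtain ⟨x, hx, hx0⟩ := hI.isPreconnected.intermediate_value hs ht hcont ⟨hs0, hlt.le⟩
        exact hne x hx hx0
      have : A.indicator (deriv φ) = 0 := by
        ext t
        by_cases ht : t ∈ I
        · simp [Set.indicator, hA t ht, hneg t ht]
        · simp [Set.indicator, hz t ht]
      simp [this]

theorem fderiv_eq_inner_gradient (ρ : R3 → ℝ) (x v : R3) :
    fderiv ℝ ρ x v = inner ℝ (gradient ρ x) v := by
  rw [gradient, InnerProductSpace.toDual_symm_apply]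

theorem continuous_gradient {ρ : R3 → ℝ} (h : ContDiff ℝ ∞ ρ) : Continuous (gradient ρ) := by
  unfold gradient
  exact (LinearIsometryEquiv.continuous _).comp (h.continuous_fderiv (by simp))

/-- A ball around a boundary point in which the boundary is a graph over the plane orthogonal to
the transversal direction `v`. -/
theorem exists_ball_transversal {Ω : Set R3} {p v : R3} {ρ : R3 → ℝ}
    (hρ : IsDefiningFunctionAt Ω p ρ) (hv : 0 < inner ℝ (gradient ρ p) v) :
    ∃ r > 0, ∀ x ∈ Metric.ball p r, IsDefiningFunctionAt Ω x ρ ∧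
      0 < inner ℝ (gradient ρ x) v := by
  have h2 : ∀ᶠ x in 𝓝 p, 0 < inner ℝ (gradient ρ x) v :=
    ((continuous_gradient hρ.1).inner continuous_const).continuousAt.eventually (lt_mem_nhds hv)
  obtain ⟨r, hr, h⟩ := Metric.eventually_nhds_iff_ball.1 (hρ.eventually.and h2)
  exact ⟨r, hr, h⟩

section Local

variable {Ω : Set R3} {ν : R3 → R3} {p : R3} {ρ : R3 → ℝ} {r : ℝ}
  {b : OrthonormalBasis (Fin 3) ℝ R3}

theorem convex_slice (p a v : R3) (r : ℝ) : Convex ℝ {t : ℝ | a + t • v ∈ Metric.ball p r} := by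
  intro s hs t ht α β hα hβ hαβ
  have := convex_ball p r hs ht hα hβ hαβ
  simp only [Set.mem_ofPred_eq]
  convert this using 1
  obtain rfl : α = 1 - β := by linarith
  simp only [smul_eq_mul]
  module

theorem strictMonoOn_slice (hρ : ContDiff ℝ ∞ ρ) {v : R3}
    (hr : ∀ x ∈ Metric.ball p r, 0 < inner ℝ (gradient ρ x) v) (a : R3) :
    StrictMonoOn (fun t : ℝ => ρ (a + t • v)) {t : ℝ | a + t • v ∈ Metric.ball p r} := by
  refine strictMonoOn_of_deriv_pos (convex_slice p a v r) ?_ fun t ht => ?_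
  · exact (hρ.continuous.comp (by fun_prop)).continuousOn
  · have h1 : HasFDerivAt ρ (fderiv ℝ ρ (a + t • v)) (a + t • v) :=
      (hρ.differentiable (by simp)).differentiableAt.hasFDerivAt
    have h2 : HasDerivAt (fun t : ℝ => a + t • v) v t := by
      simpa using ((hasDerivAt_id t).smul_const v).const_add a
    have h3 := h1.comp_hasDerivAt t h2
    have h4 : deriv (fun t : ℝ => ρ (a + t • v)) t = inner ℝ (gradient ρ (a + t • v)) v := by
      rw [← fderiv_eq_inner_gradient]; exact h3.deriv
    rw [h4]
    have ht' : t ∈ {t : ℝ | a + t • v ∈ Metric.ball p r} := interior_subset ht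
    rw [Set.mem_ofPred_eq] at ht'
    exact hr _ ht'

/-- The projection along a transversal direction, on a patch of the boundary. -/
def patchProj (b : OrthonormalBasis (Fin 3) ℝ R3) (K : Set R3) (x : K) : R2 := proj b x

/-- A line in direction `b 2` meets the patch at most once, since `ρ` is strictly increasing along
it inside the ball. An injective measurable map from a standard Borel space to the plane is a
measurable embedding. -/
theorem patchProj_measurableEmbedding (hΩ : IsOpen Ω)
    (hr : ∀ x ∈ Metric.ball p r, IsDefiningFunctionAt Ω x ρ ∧ 0 < inner ℝ (gradient ρ x) (b 2)) :
    MeasurableEmbedding (patchProj b (frontier Ω ∩ Metric.ball p r)) := by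
  have hKm : MeasurableSet (frontier Ω ∩ Metric.ball p r) :=
    isClosed_frontier.measurableSet.inter Metric.isOpen_ball.measurableSet
  have := hKm.standardBorel
  refine Measurable.measurableEmbedding
    (((proj b).continuous.measurable).comp measurable_subtype_coe) ?_
  rintro ⟨x, hx⟩ ⟨y, hy⟩ hxy
  have hxy : proj b x = proj b y := hxy
  have hxe := incl_proj_add b x
  have hye := incl_proj_add b y
  rw [hxy] at hxe
  have hm := strictMonoOn_slice (v := b 2) (hr p (Metric.mem_ball_self
    (Metric.pos_of_mem_ball hx.2))).1.1 (fun x hx => (hr x hx).2) (incl b (proj b y))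
  have h0 : ∀ z ∈ frontier Ω ∩ Metric.ball p r, ρ z = 0 := fun z hz =>
    (hr z hz.2).1.eq_zero hΩ hz.1
  have hxI : inner ℝ (b 2) x ∈ {t : ℝ | incl b (proj b y) + t • b 2 ∈ Metric.ball p r} := by
    rw [Set.mem_ofPred_eq, hxe]; exact hx.2
  have hyI : inner ℝ (b 2) y ∈ {t : ℝ | incl b (proj b y) + t • b 2 ∈ Metric.ball p r} := by
    rw [Set.mem_ofPred_eq, hye]; exact hy.2
  have := hm.injOn hxI hyI (by simp only [hxe, hye, h0 x hx, h0 y hy])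
  rw [Subtype.mk.injEq, ← hxe, this, hye]

theorem isFlatAt_patch (hΩ : IsOpen Ω) (hν : IsInnerUnitNormal Ω ν)
    (hr : ∀ x ∈ Metric.ball p r, IsDefiningFunctionAt Ω x ρ ∧ 0 < inner ℝ (gradient ρ x) (b 2))
    {q : R3} (hq : q ∈ frontier Ω ∩ Metric.ball p r) :
    IsFlatAt (frontier Ω ∩ Metric.ball p r) (ν q) q := by
  rw [hν.eq hΩ hq.1 (hr q hq.2).1]
  exact isFlatAt_of_contDiff (hr q hq.2).1.1 (hr q hq.2).1.2.1
    fun x hx => (hr x hx.2).1.eq_zero hΩ hx.1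

theorem inner_normal_pos (hΩ : IsOpen Ω) (hν : IsInnerUnitNormal Ω ν)
    (hr : ∀ x ∈ Metric.ball p r, IsDefiningFunctionAt Ω x ρ ∧ 0 < inner ℝ (gradient ρ x) (b 2))
    {q : R3} (hq : q ∈ frontier Ω ∩ Metric.ball p r) : 0 < inner ℝ (ν q) (b 2) := by
  rw [hν.eq hΩ hq.1 (hr q hq.2).1, inner_smul_left]
  exact mul_pos (inv_pos.2 (norm_pos_iff.2 (hr q hq.2).1.2.1)) (hr q hq.2).2

/-- A crude comparison, with `c = 2`, suffices: a small piece of Γ has at most a fixed multiple of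
the area of its bounded projection. -/
theorem isFiniteMeasureAt_surf (hΩ : IsOpen Ω) (hν : IsInnerUnitNormal Ω ν)
    (hp : p ∈ frontier Ω) (hr0 : 0 < r)
    (hr : ∀ x ∈ Metric.ball p r, IsDefiningFunctionAt Ω x ρ ∧ 0 < inner ℝ (gradient ρ x) (b 2)) :
    (surf Ω).FiniteAtFilter (𝓝 p) := by
  have hpK : p ∈ frontier Ω ∩ Metric.ball p r := ⟨hp, Metric.mem_ball_self hr0⟩
  have hpos := inner_normal_pos hΩ hν hr hpK
  have hw0 : 0 < (inner ℝ (ν p) (b 2)).toNNReal := Real.toNNReal_pos.2 hpos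
  obtain ⟨U, hU, h⟩ := (isFlatAt_patch hΩ hν hr hpK).comparable (hν.norm_eq hp) b
    (w := (inner ℝ (ν p) (b 2)).toNNReal)
    (by rw [Real.coe_toNNReal _ hpos.le, real_inner_comm, abs_of_pos hpos])
    hw0 (c := 2) one_lt_two
  refine ⟨U ∩ Metric.ball p r, inter_mem hU (Metric.ball_mem_nhds p hr0), ?_⟩
  have hle := (h (U ∩ Metric.ball p r ∩ frontier Ω)
    (fun x hx => ⟨hx.1.1, hx.2, hx.1.2⟩)).2
  rw [surf, Measure.restrict_apply' isClosed_frontier.measurableSet]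
  have hbdd : volume (proj b '' (U ∩ Metric.ball p r ∩ frontier Ω)) < ⊤ := by
    refine Bornology.IsBounded.measure_lt_top ?_
    exact (proj b).lipschitz.isBounded_image
      (Metric.isBounded_ball.subset (fun x hx => hx.1.2))
  have hfin : ((inner ℝ (ν p) (b 2)).toNNReal : ENNReal) *
      Measure.euclideanHausdorffMeasure 2 (U ∩ Metric.ball p r ∩ frontier Ω) < ⊤ :=
    hle.trans_lt (ENNReal.mul_lt_top (by simp) hbdd)
  by_contra htop
  rw [not_lt_top_iff] at htop
  rw [htop, ENNReal.mul_top (by exact_mod_cast hw0.ne')] at hfin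
  exact lt_irrefl _ hfin

theorem continuous_inner_normal (hΩ : IsOpen Ω) (hν : IsInnerUnitNormal Ω ν)
    (hr : ∀ x ∈ Metric.ball p r, IsDefiningFunctionAt Ω x ρ ∧ 0 < inner ℝ (gradient ρ x) (b 2)) :
    Continuous fun x : ↑(frontier Ω ∩ Metric.ball p r) => inner ℝ (ν x) (b 2) := by
  have h1 : ∀ x : ↑(frontier Ω ∩ Metric.ball p r),
      ν x = ‖gradient ρ x‖⁻¹ • gradient ρ x := fun x => hν.eq hΩ x.2.1 (hr x x.2.2).1
  simp_rw [h1]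
  rcases isEmpty_or_nonempty ↑(frontier Ω ∩ Metric.ball p r) with he | ⟨⟨x₀, hx₀⟩⟩
  · exact continuous_of_const fun x => (he.false x).elim
  have hc : Continuous fun x : ↑(frontier Ω ∩ Metric.ball p r) => gradient ρ (x : R3) :=
    (continuous_gradient (hr x₀ hx₀.2).1.1).comp continuous_subtype_val
  have hn : Continuous fun x : ↑(frontier Ω ∩ Metric.ball p r) => ‖gradient ρ (x : R3)‖⁻¹ :=
    hc.norm.inv₀ fun x => (norm_pos_iff.2 (hr x x.2.2).1.2.1).ne'
  exact (hn.smul hc).inner continuous_const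

/-- The projection of the patch, as a measure on the patch, has density `⟨ν, v⟩` with respect to
surface measure. -/
theorem comap_patchProj_volume (hΩ : IsOpen Ω) (hν : IsInnerUnitNormal Ω ν)
    (hr : ∀ x ∈ Metric.ball p r, IsDefiningFunctionAt Ω x ρ ∧ 0 < inner ℝ (gradient ρ x) (b 2)) :
    Measure.comap (patchProj b (frontier Ω ∩ Metric.ball p r)) volume =
      (Measure.comap (Subtype.val : ↑(frontier Ω ∩ Metric.ball p r) → R3)
        (Measure.euclideanHausdorffMeasure 2)).withDensity
        fun x => ((inner ℝ (ν x) (b 2)).toNNReal : ENNReal) := by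
  have hKm : MeasurableSet (frontier Ω ∩ Metric.ball p r) :=
    isClosed_frontier.measurableSet.inter Metric.isOpen_ball.measurableSet
  refine eq_withDensity_of_locally_comparable ?_ ?_ ?_
  · exact continuous_real_toNNReal.comp (continuous_inner_normal hΩ hν hr)
  · exact fun x => Real.toNNReal_pos.2 (inner_normal_pos hΩ hν hr x.2)
  · intro x c hc
    have hpos := inner_normal_pos hΩ hν hr x.2
    obtain ⟨U, hU, h⟩ := (isFlatAt_patch hΩ hν hr x.2).comparable (hν.norm_eq x.2.1) b
      (w := (inner ℝ (ν x) (b 2)).toNNReal)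
      (by rw [Real.coe_toNNReal _ hpos.le, real_inner_comm, abs_of_pos hpos])
      (Real.toNNReal_pos.2 hpos) hc
    refine ⟨Subtype.val ⁻¹' U, continuous_subtype_val.continuousAt.preimage_mem_nhds hU,
      fun B hB => ?_⟩
    rw [(patchProj_measurableEmbedding hΩ hr).comap_apply,
      (MeasurableEmbedding.subtype_coe hKm).comap_apply]
    have himg : patchProj b (frontier Ω ∩ Metric.ball p r) '' B
        = proj b '' (Subtype.val '' B) := by
      rw [Set.image_image]; rfl
    rw [himg]
    refine h _ ?_
    rintro _ ⟨y, hy, rfl⟩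
    exact ⟨hB hy, y.2⟩

/-- By Fubini the volume integral is an integral over the lines parallel to `b 2`. Each line
contributes minus the value of `u` at its boundary point in the patch, or zero if there is none;
passing from plane area to surface measure produces the weight `⟨ν, b 2⟩`. -/
theorem integral_fderiv_transversal (hΩ : IsOpen Ω) (hν : IsInnerUnitNormal Ω ν)
    (hr : ∀ x ∈ Metric.ball p r, IsDefiningFunctionAt Ω x ρ ∧ 0 < inner ℝ (gradient ρ x) (b 2))
    {u : R3 → ℂ} (hu : ContDiff ℝ 1 u) (hsupp : tsupport u ⊆ Metric.ball p r) :
    ∫ x in Ω, fderiv ℝ u x (b 2) = -∫ x, inner ℝ (ν x) (b 2) • u x ∂(surf Ω) := by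
  set K := frontier Ω ∩ Metric.ball p r with hK
  have hKm : MeasurableSet K :=
    isClosed_frontier.measurableSet.inter Metric.isOpen_ball.measurableSet
  have hcpt : HasCompactSupport u :=
    Metric.isCompact_of_isClosed_isBounded (isClosed_tsupport u) (Metric.isBounded_ball.subset hsupp)
  have hu0 : ∀ x ∉ Metric.ball p r, u x = 0 := fun x hx =>
    image_eq_zero_of_notMem_tsupport fun h => hx (hsupp h)
  have hf := patchProj_measurableEmbedding hΩ hr
  set f := patchProj b K
  -- integration over the lines in direction `b 2`
  have hg : Continuous fun x => fderiv ℝ u x (b 2) :=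
    (hu.continuous_fderiv (by simp)).clm_apply continuous_const
  have hgc : HasCompactSupport fun x => fderiv ℝ u x (b 2) := hcpt.fderiv_apply ℝ (b 2)
  have hgi : Integrable (Ω.indicator fun x => fderiv ℝ u x (b 2)) :=
    (hg.integrable_of_hasCompactSupport hgc).indicator hΩ.measurableSet
  have hΨ := measurePreserving_incl_add b
  -- The function `Function.extend f _ 0` on the plane takes at `y` the value of `u` at the patch
  -- point above `y`, and 0 when the line above `y` misses the patch.
  have hslice : ∀ y : R2, ∫ t : ℝ, Ω.indicator (fun x => fderiv ℝ u x (b 2)) (incl b y + t • b 2)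
      = -Function.extend f (fun k : K => u k) 0 y := by
    intro y
    set φ : ℝ → ℂ := fun t => u (incl b y + t • b 2) with hφ
    have hφd : ContDiff ℝ 1 φ := hu.comp (by fun_prop)
    have hder : ∀ t, deriv φ t = fderiv ℝ u (incl b y + t • b 2) (b 2) := fun t => by
      have h1 : HasFDerivAt u (fderiv ℝ u (incl b y + t • b 2)) (incl b y + t • b 2) :=
        (hu.differentiable (by simp)).differentiableAt.hasFDerivAt
      have h2 : HasDerivAt (fun t : ℝ => incl b y + t • b 2) (b 2) t := by
        simpa using ((hasDerivAt_id t).smul_const (b 2)).const_add (incl b y)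
      exact (h1.comp_hasDerivAt t h2).deriv
    have hiso : ∀ t s : ℝ, dist (incl b y + t • b 2) (incl b y + s • b 2) = dist t s := by
      intro t s
      rw [dist_add_left, dist_eq_norm, ← sub_smul, norm_smul, b.norm_eq_one, mul_one, dist_eq_norm]
    have hφc : HasCompactSupport φ :=
      hcpt.comp_isClosedEmbedding (Isometry.of_dist_eq hiso).isClosedEmbedding
    have hφs : tsupport φ ⊆ {t : ℝ | incl b y + t • b 2 ∈ Metric.ball p r} := by
      refine (tsupport_comp_subset_preimage u (f := fun t : ℝ => incl b y + t • b 2)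
        (by fun_prop)).trans ?_
      intro t ht
      exact hsupp ht
    have hind : (fun t : ℝ => Ω.indicator (fun x => fderiv ℝ u x (b 2)) (incl b y + t • b 2))
        = {t : ℝ | incl b y + t • b 2 ∈ Ω}.indicator (deriv φ) := by
      ext t
      by_cases h : incl b y + t • b 2 ∈ Ω
      · rw [Set.indicator_of_mem h, Set.indicator_of_mem (by exact h), hder]
      · rw [Set.indicator_of_notMem h, Set.indicator_of_notMem (by exact h)]
    rw [hind]
    by_cases hex : ∃ t : ℝ, incl b y + t • b 2 ∈ Metric.ball p r
    swap
    · have hφ0 : deriv φ = 0 := by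
        ext t
        by_contra h
        exact hex ⟨t, hφs (support_deriv_subset (Function.mem_support.2 h))⟩
      rw [Function.extend_apply', hφ0]
      · simp
      · rintro ⟨⟨x, hx⟩, rfl⟩
        refine hex ⟨inner ℝ (b 2) x, ?_⟩
        have : incl b (f ⟨x, hx⟩) + inner ℝ (b 2) x • b 2 = x := incl_proj_add b x
        rw [this]; exact hx.2
    obtain ⟨t₁, ht₁⟩ := hex
    have hρ := (hr _ ht₁).1.1
    obtain ⟨h1, h2⟩ := integral_slice hφd hφc (convex_slice p (incl b y) (b 2) r) hφs
      (A := {t : ℝ | incl b y + t • b 2 ∈ Ω})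
      (strictMonoOn_slice hρ (fun x hx => (hr x hx).2) (incl b y))
      (hρ.continuous.comp (by fun_prop)).continuousOn
      (fun t ht => (hr _ ht).1.2.2.self_of_nhds)
    by_cases hz : ∃ t₀ ∈ {t : ℝ | incl b y + t • b 2 ∈ Metric.ball p r},
      ρ (incl b y + t₀ • b 2) = 0
    · obtain ⟨t₀, ht₀, hz⟩ := hz
      rw [h1 t₀ ht₀ hz]
      have hmem : incl b y + t₀ • b 2 ∈ K := ⟨(hr _ ht₀).1.mem_frontier hΩ hz, ht₀⟩
      have hfy : f ⟨_, hmem⟩ = y := by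
        change proj b (incl b y + t₀ • b 2) = y
        rw [map_add, map_smul, proj_self, proj_incl, smul_zero, add_zero]
      have := hf.injective.extend_apply (fun k : K => u k) 0 ⟨_, hmem⟩
      rw [hfy] at this
      rw [this]
    · push Not at hz
      rw [h2 hz, Function.extend_apply']
      · simp
      · rintro ⟨⟨x, hx⟩, rfl⟩
        have hxe : incl b (f ⟨x, hx⟩) + inner ℝ (b 2) x • b 2 = x := incl_proj_add b x
        refine hz (inner ℝ (b 2) x) ?_ ?_
        · rw [Set.mem_ofPred_eq, hxe]; exact hx.2
        · rw [hxe]; exact (hr x hx.2).1.eq_zero hΩ hx.1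
  have hLHS : ∫ x in Ω, fderiv ℝ u x (b 2) = -∫ y, Function.extend f (fun k : K => u k) 0 y := by
    rw [← integral_indicator hΩ.measurableSet]
    have hi2 := hΨ.integrable_comp_of_integrable hgi
    rw [← hΨ.map_eq, integral_map hΨ.aemeasurable (by rw [hΨ.map_eq]; exact hgi.1)]
    refine (integral_prod _ hi2).trans ?_
    simp only [Function.comp]
    simp only [hslice]
    rw [integral_neg]
  have hRHS : ∫ y, Function.extend f (fun k : K => u k) 0 y
      = ∫ x, inner ℝ (ν x) (b 2) • u x ∂(surf Ω) := by
    have hext : ∀ y ∉ Set.range f, Function.extend f (fun k : K => u k) 0 y = 0 :=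
      fun y hy => Function.extend_apply' _ _ _ hy
    rw [← setIntegral_eq_integral_of_forall_compl_eq_zero hext, ← hf.map_comap, hf.integral_map]
    simp only [hf.injective.extend_apply]
    rw [comap_patchProj_volume hΩ hν hr, integral_withDensity_eq_integral_toReal_smul₀]
    · have h1 : ∀ k : K, ((inner ℝ (ν k) (b 2)).toNNReal : ENNReal).toReal • u k
          = inner ℝ (ν k) (b 2) • u k := fun k => by
        rw [ENNReal.coe_toReal, Real.coe_toNNReal _ (inner_normal_pos hΩ hν hr k.2).le]
      simp_rw [h1]
      rw [integral_subtype_comap hKm (fun x => inner ℝ (ν x) (b 2) • u x), surf]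
      refine (setIntegral_eq_of_subset_of_forall_sdiff_eq_zero isClosed_frontier.measurableSet
        Set.inter_subset_left fun x hx => ?_).symm
      rw [hu0 x fun h => hx.2 ⟨hx.1, h⟩, smul_zero]
    · exact (continuous_real_toNNReal.comp
        (continuous_inner_normal hΩ hν hr)).measurable.coe_nnreal_ennreal.aemeasurable
    · simp
  rw [hLHS, hRHS]

end Local

/-! ### Smooth extension of the normal, finiteness of surface measure, and the divergence theorem on
all of `Ω` -/

open scoped Manifold in
/-- The unit normal extends to a smooth field on the whole space. -/
theorem IsInnerUnitNormal.exists_smooth_extension {Ω : Set R3} {ν : R3 → R3}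
    (hν : IsInnerUnitNormal Ω ν) (hΩ : IsOpen Ω) :
    ∃ N : R3 → R3, ContDiff ℝ ∞ N ∧ ∀ x ∈ frontier Ω, N x = ν x := by
  -- The constraint is a single point on Γ and void elsewhere. Both are convex, so local extensions
  -- can be glued by a partition of unity without changing the values on Γ.
  have hconv : ∀ x : R3, Convex ℝ {y : R3 | x ∈ frontier Ω → y = ν x} := by
    intro x
    by_cases hx : x ∈ frontier Ω
    · simp [hx]
    · simpa [hx] using convex_univ
  have hloc : ∀ x : R3, ∃ U ∈ 𝓝 x, ∃ g : R3 → R3, ContMDiffOn 𝓘(ℝ, R3) 𝓘(ℝ, R3) ∞ g U ∧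
      ∀ y ∈ U, g y ∈ {z : R3 | y ∈ frontier Ω → z = ν y} := by
    intro x
    by_cases hx : x ∈ frontier Ω
    · obtain ⟨ρ, hρ, -⟩ := hν x hx
      refine ⟨{y | IsDefiningFunctionAt Ω y ρ}, hρ.eventually,
        fun y => ‖gradient ρ y‖⁻¹ • gradient ρ y, ?_, fun y hy hyf => (hν.eq hΩ hyf hy).symm⟩
      rw [contMDiffOn_iff_contDiffOn]
      have hg : ContDiff ℝ ∞ (gradient ρ) := by
        unfold gradient
        exact (LinearIsometryEquiv.contDiff _).comp (hρ.1.fderiv_right (by simp))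
      intro y hy
      have hy0 : gradient ρ y ≠ 0 := hy.2.1
      have h1 : ContDiffAt ℝ ∞ (fun y => ‖gradient ρ y‖⁻¹) y :=
        (hg.contDiffAt.norm ℝ hy0).inv (norm_ne_zero_iff.2 hy0)
      exact (h1.smul hg.contDiffAt).contDiffWithinAt
    · refine ⟨(frontier Ω)ᶜ, isClosed_frontier.isOpen_compl.mem_nhds hx, fun _ => 0,
        contMDiffOn_const, fun y hy hyf => absurd hyf hy⟩
  obtain ⟨g, hg⟩ := exists_contMDiffMap_forall_mem_convex_of_local (n := (⊤ : ℕ∞)) 𝓘(ℝ, R3) hconv hloc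
  exact ⟨g, g.contMDiff.contDiff, fun x hx => hg x hx⟩

theorem exists_basis_ball {Ω : Set R3} {ν : R3 → R3} (hν : IsInnerUnitNormal Ω ν)
    {p v : R3} (hp : p ∈ frontier Ω) (hv : 0 < inner ℝ (ν p) v) :
    ∃ (b : OrthonormalBasis (Fin 3) ℝ R3) (ρ : R3 → ℝ), ∃ r > 0, v = ‖v‖ • b 2 ∧
      ∀ x ∈ Metric.ball p r, IsDefiningFunctionAt Ω x ρ ∧ 0 < inner ℝ (gradient ρ x) (b 2) := by
  have hv0 : v ≠ 0 := by rintro rfl; simp at hv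
  have hvn := norm_pos_iff.2 hv0
  obtain ⟨b, hb⟩ := exists_orthonormalBasis_apply_two_eq (n := ‖v‖⁻¹ • v)
    (by rw [norm_smul, norm_inv, norm_norm, inv_mul_cancel₀ hvn.ne'])
  have hvb : v = ‖v‖ • b 2 := by rw [hb, smul_inv_smul₀ hvn.ne']
  obtain ⟨ρ, hρ, e⟩ := hν p hp
  have hg := norm_pos_iff.2 hρ.2.1
  rw [e, hvb, inner_smul_left, inner_smul_right] at hv
  simp only [map_inv₀, conj_trivial] at hv
  obtain ⟨r, hr, h⟩ := exists_ball_transversal hρ (v := b 2)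
    ((mul_pos_iff_of_pos_left hvn).1 ((mul_pos_iff_of_pos_left (inv_pos.2 hg)).1 hv))
  exact ⟨b, ρ, r, hr, hvb, h⟩

theorem surf_lt_top {Ω : Set R3} {ν : R3 → R3} (hν : IsInnerUnitNormal Ω ν) (hΩ : IsOpen Ω)
    (hb : Bornology.IsBounded Ω) : IsFiniteMeasure (surf Ω) := by
  have hc : IsCompact (frontier Ω) := Metric.isCompact_of_isClosed_isBounded isClosed_frontier
    (hb.closure.subset frontier_subset_closure)
  have : surf Ω (frontier Ω) < ⊤ := by
    refine hc.measure_lt_top_of_nhdsWithin fun p hp => ?_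
    obtain ⟨b, ρ, r, hr0, -, hr⟩ := exists_basis_ball hν hp (v := ν p)
      (by rw [real_inner_self_eq_norm_sq, hν.norm_eq hp]; norm_num)
    exact (isFiniteMeasureAt_surf hΩ hν hp hr0 hr).filter_mono nhdsWithin_le_nhds
  rw [surf, Measure.restrict_apply_self] at this
  exact ⟨by rw [surf, Measure.restrict_apply_univ]; exact this⟩

theorem ae_surf_mem (Ω : Set R3) : ∀ᵐ x ∂(surf Ω), x ∈ frontier Ω :=
  ae_restrict_mem isClosed_frontier.measurableSet

theorem ae_surf_of_forall {Ω : Set R3} {P : R3 → Prop} (h : ∀ x ∈ frontier Ω, P x) :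
    ∀ᵐ x ∂(surf Ω), P x := (ae_surf_mem Ω).mono h

theorem _root_.Continuous.memLp_surf {Ω : Set R3} [IsFiniteMeasure (surf Ω)]
    (hb : Bornology.IsBounded Ω) {F : Type*} [NormedAddCommGroup F] [SecondCountableTopology F]
    {u : R3 → F} (hu : Continuous u)
    (q : ENNReal) : MemLp u q (surf Ω) := by
  have hc : IsCompact (frontier Ω) := Metric.isCompact_of_isClosed_isBounded isClosed_frontier
    (hb.closure.subset frontier_subset_closure)
  obtain ⟨C, hC⟩ := hc.exists_bound_of_continuousOn hu.continuousOn
  exact MemLp.of_bound hu.aestronglyMeasurable C (ae_surf_of_forall hC)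

theorem isFiniteMeasure_vol {Ω : Set R3} (hb : Bornology.IsBounded Ω) :
    IsFiniteMeasure (vol Ω) :=
  ⟨by rw [vol, Measure.restrict_apply_univ]; exact hb.measure_lt_top⟩

theorem _root_.Continuous.memLp_vol {Ω : Set R3} (hΩ : IsOpen Ω) (hb : Bornology.IsBounded Ω)
    {F : Type*} [NormedAddCommGroup F] [SecondCountableTopology F]
    {u : R3 → F} (hu : Continuous u) (q : ENNReal) : MemLp u q (vol Ω) := by
  have := isFiniteMeasure_vol hb
  have hc : IsCompact (closure Ω) := hb.isCompact_closure
  obtain ⟨C, hC⟩ := hc.exists_bound_of_continuousOn hu.continuousOn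
  exact MemLp.of_bound hu.aestronglyMeasurable C
    ((ae_restrict_mem hΩ.measurableSet).mono fun x hx => hC x (subset_closure hx))

/-- The identity is linear in the direction, and any `w` is a combination of two directions that
point into `Ω` at `p`: `ν p` and `c • ν p + w`. -/
theorem integral_fderiv_near_boundary {Ω : Set R3} {ν : R3 → R3} (hν : IsInnerUnitNormal Ω ν)
    (hΩ : IsOpen Ω) (hb : Bornology.IsBounded Ω) {p : R3} (hp : p ∈ frontier Ω) (w : R3) :
    ∃ r > 0, ∀ u : R3 → ℂ, ContDiff ℝ 1 u → tsupport u ⊆ Metric.ball p r →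
      ∫ x in Ω, fderiv ℝ u x w = -∫ x, inner ℝ (ν x) w • u x ∂(surf Ω) := by
  have key : ∀ v : R3, 0 < inner ℝ (ν p) v → ∃ r > 0, ∀ u : R3 → ℂ, ContDiff ℝ 1 u →
      tsupport u ⊆ Metric.ball p r →
      ∫ x in Ω, fderiv ℝ u x v = -∫ x, inner ℝ (ν x) v • u x ∂(surf Ω) := by
    intro v hv
    obtain ⟨b, ρ, r, hr0, hvb, hr⟩ := exists_basis_ball hν hp hv
    refine ⟨r, hr0, fun u hu hs => ?_⟩
    have := integral_fderiv_transversal hΩ hν hr hu hs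
    rw [hvb]
    simp only [map_smul, inner_smul_right, mul_smul]
    rw [integral_smul, integral_smul, this, smul_neg]
  have hνp := hν.norm_eq hp
  -- With this `c` the inner product of `c • ν p + w` with `ν p` is at least 1.
  set c : ℝ := 1 + ‖w‖
  have h1 : 0 < inner ℝ (ν p) (ν p) := by rw [real_inner_self_eq_norm_sq, hνp]; norm_num
  have h2 : 0 < inner ℝ (ν p) (c • ν p + w) := by
    rw [inner_add_right, inner_smul_right, real_inner_self_eq_norm_sq, hνp]
    have := neg_le_of_abs_le (abs_real_inner_le_norm (ν p) w)
    rw [hνp] at this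
    simp only [c]; linarith
  obtain ⟨r₁, hr₁, H₁⟩ := key _ h1
  obtain ⟨r₂, hr₂, H₂⟩ := key _ h2
  refine ⟨min r₁ r₂, lt_min hr₁ hr₂, fun u hu hs => ?_⟩
  have e1 := H₁ u hu (hs.trans (Metric.ball_subset_ball (min_le_left _ _)))
  have e2 := H₂ u hu (hs.trans (Metric.ball_subset_ball (min_le_right _ _)))
  obtain ⟨N, hN, hNν⟩ := hν.exists_smooth_extension hΩ
  have := surf_lt_top hν hΩ hb
  have hint : ∀ v : R3, Integrable (fun x => inner ℝ (ν x) v • u x) (surf Ω) := fun v => by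
    have h3 : Continuous fun x => inner ℝ (N x) v • u x := by
      have := hN.continuous
      have := hu.continuous
      fun_prop
    refine (memLp_one_iff_integrable.1 (h3.memLp_surf hb 1)).congr (ae_surf_of_forall ?_)
    intro x hx; simp only [hNν x hx]
  have hintv : ∀ v : R3, Integrable (fun x => fderiv ℝ u x v) (vol Ω) := fun v => by
    have h3 : Continuous fun x => fderiv ℝ u x v :=
      (hu.continuous_fderiv (by simp)).clm_apply continuous_const
    exact memLp_one_iff_integrable.1 (h3.memLp_vol hΩ hb 1)
  simp only [map_add, map_smul, inner_add_right, inner_smul_right, add_smul, mul_smul] at e2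
  have e3 := integral_add ((hintv (ν p)).fun_smul c) (hintv w)
  rw [vol] at e3
  rw [e3, integral_add ((hint (ν p)).fun_smul c) (hint w), integral_smul, integral_smul, e1] at e2
  rw [smul_neg] at e2
  linear_combination e2

open scoped Manifold in
/-- The divergence theorem for a fixed direction. -/
theorem integral_fderiv {Ω : Set R3} {ν : R3 → R3} (hν : IsInnerUnitNormal Ω ν)
    (hΩ : IsOpen Ω) (hb : Bornology.IsBounded Ω) {u : R3 → ℂ} (hu : ContDiff ℝ 1 u) (w : R3) :
    ∫ x in Ω, fderiv ℝ u x w = -∫ x, inner ℝ (ν x) w • u x ∂(surf Ω) := by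
  have hloc : ∀ p ∈ closure Ω, ∃ r > 0, ∀ u : R3 → ℂ, ContDiff ℝ 1 u →
      tsupport u ⊆ Metric.ball p r →
      ∫ x in Ω, fderiv ℝ u x w = -∫ x, inner ℝ (ν x) w • u x ∂(surf Ω) := by
    intro p hp
    by_cases hpf : p ∈ frontier Ω
    · exact integral_fderiv_near_boundary hν hΩ hb hpf w
    have hpΩ : p ∈ Ω := by
      by_contra h
      exact hpf (by rw [hΩ.frontier_eq]; exact ⟨hp, h⟩)
    obtain ⟨r, hr, hball⟩ := Metric.isOpen_iff.1 hΩ p hpΩ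
    refine ⟨r, hr, fun u hu hs => ?_⟩
    have hcpt : HasCompactSupport u := Metric.isCompact_of_isClosed_isBounded
      (isClosed_tsupport u) (Metric.isBounded_ball.subset hs)
    have hz : ∀ x ∈ frontier Ω, u x = 0 := fun x hx => by
      by_contra h
      have hxΩ := hball (hs (subset_tsupport u h))
      rw [hΩ.frontier_eq] at hx
      exact hx.2 hxΩ
    have hR : ∫ x, inner ℝ (ν x) w • u x ∂(surf Ω) = 0 := by
      rw [integral_congr_ae (g := fun _ => 0) (ae_surf_of_forall fun x hx => by simp [hz x hx])]
      simp
    have hL : ∫ x in Ω, fderiv ℝ u x w = ∫ x, fderiv ℝ u x w := by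
      refine setIntegral_eq_integral_of_forall_compl_eq_zero fun x hx => ?_
      by_contra h
      have : x ∈ tsupport u := support_fderiv_subset ℝ (fun h0 => h (by rw [h0]; rfl))
      exact hx (hball (hs this))
    have hci : Continuous fun x => fderiv ℝ u x w :=
      (hu.continuous_fderiv (by simp)).clm_apply continuous_const
    -- Integration by parts against the constant 1: derivatives of compactly supported functions
    -- have zero integral.
    have hparts := integral_mul_fderiv_eq_neg_fderiv_mul_of_integrable (μ := volume)
      (f := fun _ : R3 => (1 : ℂ)) (g := u) (v := w) (by simp)
      (by simpa using hci.integrable_of_hasCompactSupport (hcpt.fderiv_apply ℝ w))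
      (by simpa using hu.continuous.integrable_of_hasCompactSupport hcpt)
      (fun x _ => differentiableAt_const _) (fun x _ => (hu.differentiable (by simp)) x)
    rw [hL, hR, neg_zero]
    simpa using hparts
  choose! r hr H using hloc
  have hcc : IsCompact (closure Ω) := hb.isCompact_closure
  obtain ⟨t, ht, hcov⟩ := hcc.elim_nhds_subcover (fun p => Metric.ball p (r p))
    fun p hp => Metric.ball_mem_nhds p (hr p hp)
  obtain ⟨f, hf⟩ := SmoothPartitionOfUnity.exists_isSubordinate 𝓘(ℝ, R3)
    (isClosed_closure (s := Ω)) (fun p : t => Metric.ball (p : R3) (r p))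
    (fun p => Metric.isOpen_ball) (by
      intro x hx
      obtain ⟨p, hp, hxp⟩ := Set.mem_iUnion₂.1 (hcov hx)
      exact Set.mem_iUnion.2 ⟨⟨p, hp⟩, hxp⟩)
  set ui : t → R3 → ℂ := fun i x => (f i x) • u x with hui
  have huid : ∀ i, ContDiff ℝ 1 (ui i) := fun i =>
    (((f i).contMDiff.contDiff).of_le (by simp)).smul hu
  have hsum : ∀ x ∈ closure Ω, u x = ∑ i, ui i x := fun x hx => by
    have h1 := f.sum_eq_one hx
    rw [finsum_eq_sum_of_fintype] at h1
    simp only [hui, ← Finset.sum_smul, h1, one_smul]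
  have hi : ∀ i, ∫ x in Ω, fderiv ℝ (ui i) x w
      = -∫ x, inner ℝ (ν x) w • ui i x ∂(surf Ω) := fun i =>
    H i (ht i i.2) (ui i) (huid i) ((closure_mono (Function.support_smul_subset_left _ _)).trans (hf i))
  obtain ⟨N, hN, hNν⟩ := hν.exists_smooth_extension hΩ
  have := surf_lt_top hν hΩ hb
  have hint : ∀ i, Integrable (fun x => inner ℝ (ν x) w • ui i x) (surf Ω) := fun i => by
    have h3 : Continuous fun x => inner ℝ (N x) w • ui i x := by
      have := hN.continuous
      have := (huid i).continuous
      fun_prop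
    refine (memLp_one_iff_integrable.1 (h3.memLp_surf hb 1)).congr (ae_surf_of_forall ?_)
    intro x hx; simp only [hNν x hx]
  have hintv : ∀ i, Integrable (fun x => fderiv ℝ (ui i) x w) (vol Ω) := fun i => by
    have h3 : Continuous fun x => fderiv ℝ (ui i) x w :=
      ((huid i).continuous_fderiv (by simp)).clm_apply continuous_const
    exact memLp_one_iff_integrable.1 (h3.memLp_vol hΩ hb 1)
  have hL : ∫ x in Ω, fderiv ℝ u x w = ∑ i, ∫ x in Ω, fderiv ℝ (ui i) x w := by
    have e := integral_finsetSum Finset.univ fun i _ => hintv i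
    rw [vol] at e
    rw [← e]
    refine setIntegral_congr_fun hΩ.measurableSet fun x hx => ?_
    have he : u =ᶠ[𝓝 x] fun y => ∑ i, ui i y := by
      filter_upwards [hΩ.mem_nhds hx] with y hy using hsum y (subset_closure hy)
    rw [he.fderiv_eq, fderiv_fun_sum fun i _ => ((huid i).differentiable (by simp)).differentiableAt]
    simp
  have hR : ∫ x, inner ℝ (ν x) w • u x ∂(surf Ω)
      = ∑ i, ∫ x, inner ℝ (ν x) w • ui i x ∂(surf Ω) := by
    rw [← integral_finsetSum _ fun i _ => hint i]
    refine integral_congr_ae (ae_surf_of_forall fun x hx => ?_)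
    simp only [← Finset.smul_sum, ← hsum x (frontier_subset_closure hx)]
  rw [hL, hR, ← Finset.sum_neg_distrib]
  exact Finset.sum_congr rfl fun i _ => hi i

/-! ### Algebra of complex vectors -/

/-- Componentwise complex conjugation. -/
def conj3 (a : C3) : C3 := WithLp.toLp 2 fun i => (starRingEnd ℂ) (a i)

@[simp] theorem conj3_apply (a : C3) (i : Fin 3) : conj3 a i = (starRingEnd ℂ) (a i) := rfl

@[simp] theorem cvec_apply (a : R3) (i : Fin 3) : cvec a i = (a i : ℂ) := rfl

theorem norm_conj3 (a : C3) : ‖conj3 a‖ = ‖a‖ := by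
  simp [EuclideanSpace.norm_eq]

theorem norm_cvec (a : R3) : ‖cvec a‖ = ‖a‖ := by
  simp [EuclideanSpace.norm_eq]

theorem dot_eq_inner (a b : C3) : dot a b = inner ℂ (conj3 a) b := by
  simp [dot, PiLp.inner_apply, Fin.sum_univ_three, mul_comm]

theorem norm_dot_le (a b : C3) : ‖dot a b‖ ≤ ‖a‖ * ‖b‖ := by
  rw [dot_eq_inner, ← norm_conj3 a]; exact norm_inner_le_norm _ _

theorem dot_comm (a b : C3) : dot a b = dot b a := by simp [dot, mul_comm]

theorem dot_conj3_self (a : C3) : dot a (conj3 a) = ((‖a‖ ^ 2 : ℝ) : ℂ) := by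
  have : conj3 (conj3 a) = a := by ext i; simp
  rw [dot_comm, dot_eq_inner, this, inner_self_eq_norm_sq_to_K]
  norm_cast

theorem dot_add_left (a b c : C3) : dot (a + b) c = dot a c + dot b c := by
  simp [dot, add_mul, Finset.sum_add_distrib]

theorem dot_add_right (a b c : C3) : dot a (b + c) = dot a b + dot a c := by
  simp [dot, mul_add, Finset.sum_add_distrib]

theorem dot_smul_left (k : ℂ) (a b : C3) : dot (k • a) b = k * dot a b := by
  simp [dot, Finset.mul_sum, mul_assoc]

theorem dot_smul_right (k : ℂ) (a b : C3) : dot a (k • b) = k * dot a b := by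
  simp [dot, Finset.mul_sum, mul_left_comm]

theorem dot_zero_left (b : C3) : dot 0 b = 0 := by simp [dot]

theorem dot_zero_right (b : C3) : dot b 0 = 0 := by simp [dot]

theorem dot_sub_left (a b c : C3) : dot (a - b) c = dot a c - dot b c := by
  simp [dot, sub_mul, Finset.sum_sub_distrib]

theorem dot_sub_right (a b c : C3) : dot a (b - c) = dot a b - dot a c := by
  simp [dot, mul_sub, Finset.sum_sub_distrib]

/-- `dot` as a continuous bilinear map. -/
def dotL : C3 →L[ℂ] C3 →L[ℂ] ℂ :=
  LinearMap.mkContinuous₂ (LinearMap.mk₂ ℂ dot dot_add_left dot_smul_left dot_add_right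
    dot_smul_right) 1 fun a b => by simpa using norm_dot_le a b

@[simp] theorem dotL_apply (a b : C3) : dotL a b = dot a b := rfl

theorem continuous_dot : Continuous fun q : C3 × C3 => dot q.1 q.2 :=
  dotL.continuous₂

theorem cross_apply_zero (a b : C3) : cross a b 0 = a 1 * b 2 - a 2 * b 1 := by
  simp [cross, cross_apply]

theorem cross_apply_one (a b : C3) : cross a b 1 = a 2 * b 0 - a 0 * b 2 := by
  simp [cross, cross_apply]

theorem cross_apply_two (a b : C3) : cross a b 2 = a 0 * b 1 - a 1 * b 0 := by
  simp [cross, cross_apply]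

theorem dot_eq (a b : C3) : dot a b = a 0 * b 0 + a 1 * b 1 + a 2 * b 2 := by
  simp [dot, Fin.sum_univ_three]

theorem dot_cross_comm (a b c : C3) : dot a (cross b c) = dot (cross a b) c := by
  simp only [dot_eq, cross_apply_zero, cross_apply_one, cross_apply_two]; ring

theorem dot_cross_self (a b : C3) : dot a (cross a b) = 0 := by
  simp only [dot_eq, cross_apply_zero, cross_apply_one, cross_apply_two]; ring

theorem dot_cvec_cvec (a b : R3) : dot (cvec a) (cvec b) = ((inner ℝ a b : ℝ) : ℂ) := by
  simp [dot, PiLp.inner_apply, Fin.sum_univ_three, mul_comm]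

/-- `|n × a|² + |⟨n, a⟩|² = |n|² |a|²` for a real vector `n`. -/
theorem norm_sq_cross_cvec (n : R3) (a : C3) :
    ‖cross (cvec n) a‖ ^ 2 + ‖dot (cvec n) a‖ ^ 2 = ‖n‖ ^ 2 * ‖a‖ ^ 2 := by
  have hn : ‖n‖ ^ 2 = n 0 ^ 2 + n 1 ^ 2 + n 2 ^ 2 := by
    rw [EuclideanSpace.norm_sq_eq]; simp [Fin.sum_univ_three]
  have h3 : ∀ c : C3, ‖c‖ ^ 2 = Complex.normSq (c 0) + Complex.normSq (c 1)
      + Complex.normSq (c 2) := fun c => by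
    rw [EuclideanSpace.norm_sq_eq]; simp [Fin.sum_univ_three, Complex.normSq_eq_norm_sq]
  rw [h3, h3, hn, ← Complex.normSq_eq_norm_sq]
  simp only [dot_eq, cross_apply_zero, cross_apply_one, cross_apply_two, cvec_apply,
    Complex.normSq_apply, Complex.add_re, Complex.add_im, Complex.sub_re, Complex.sub_im,
    Complex.mul_re, Complex.mul_im, Complex.ofReal_re, Complex.ofReal_im]
  ring

/-- Lagrange's identity. The conjugate appears because `dot` is bilinear, not Hermitian. -/
theorem norm_sq_cross_add (a b : C3) :
    ‖cross a b‖ ^ 2 + ‖dot (conj3 a) b‖ ^ 2 = ‖a‖ ^ 2 * ‖b‖ ^ 2 := by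
  have h3 : ∀ c : C3, ‖c‖ ^ 2 = Complex.normSq (c 0) + Complex.normSq (c 1)
      + Complex.normSq (c 2) := fun c => by
    rw [EuclideanSpace.norm_sq_eq]; simp [Fin.sum_univ_three, Complex.normSq_eq_norm_sq]
  rw [h3, h3, h3, ← Complex.normSq_eq_norm_sq]
  simp only [dot_eq, cross_apply_zero, cross_apply_one, cross_apply_two, conj3_apply,
    Complex.normSq_apply, Complex.add_re, Complex.add_im, Complex.sub_re, Complex.sub_im,
    Complex.mul_re, Complex.mul_im, Complex.conj_re, Complex.conj_im]
  ring

theorem norm_cross_le (a b : C3) : ‖cross a b‖ ≤ ‖a‖ * ‖b‖ := by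
  refine le_of_sq_le_sq ?_ (by positivity)
  have := norm_sq_cross_add a b
  rw [mul_pow]; nlinarith [sq_nonneg ‖dot (conj3 a) b‖]

/-! ### Calculus of complex fields -/

theorem pd_mul {u v : R3 → ℂ} (hu : Differentiable ℝ u) (hv : Differentiable ℝ v) (i : Fin 3)
    (x : R3) : pd i (fun y => u y * v y) x = pd i u x * v x + u x * pd i v x := by
  simp only [pd]
  rw [fderiv_fun_mul (hu x) (hv x)]
  simp; ring

theorem pd_add {u v : R3 → ℂ} (hu : Differentiable ℝ u) (hv : Differentiable ℝ v) (i : Fin 3)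
    (x : R3) : pd i (fun y => u y + v y) x = pd i u x + pd i v x := by
  simp only [pd]
  rw [fderiv_fun_add (hu x) (hv x)]; rfl

theorem pd_sub {u v : R3 → ℂ} (hu : Differentiable ℝ u) (hv : Differentiable ℝ v) (i : Fin 3)
    (x : R3) : pd i (fun y => u y - v y) x = pd i u x - pd i v x := by
  simp only [pd]
  rw [fderiv_fun_sub (hu x) (hv x)]; rfl

theorem pd_conj {u : R3 → ℂ} (hu : Differentiable ℝ u) (i : Fin 3) (x : R3) :
    pd i (fun y => (starRingEnd ℂ) (u y)) x = (starRingEnd ℂ) (pd i u x) := by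
  simp only [pd]
  have h : HasFDerivAt (fun y => (starRingEnd ℂ) (u y))
      ((Complex.conjCLE : ℂ →L[ℝ] ℂ).comp (fderiv ℝ u x)) x :=
    (Complex.conjCLE : ℂ →L[ℝ] ℂ).hasFDerivAt.comp x (hu x).hasFDerivAt
  rw [h.fderiv]; simp

theorem _root_.ContDiff.pd {u : R3 → ℂ} (hu : ContDiff ℝ ∞ u) (i : Fin 3) : ContDiff ℝ ∞ (pd i u) :=
  (hu.fderiv_right (m := ∞) (by simp)).clm_apply contDiff_const

theorem pd_comm {u : R3 → ℂ} (hu : ContDiff ℝ ∞ u) (i j : Fin 3) (x : R3) :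
    pd i (pd j u) x = pd j (pd i u) x := by
  have hs : IsSymmSndFDerivAt ℝ u x := hu.contDiffAt.isSymmSndFDerivAt
    (by rw [minSmoothness_of_isRCLikeNormedField]; exact WithTop.coe_le_coe.2 le_top)
  have h : ∀ i j, pd i (pd j u) x = fderiv ℝ (fderiv ℝ u) x (EuclideanSpace.single i 1)
      (EuclideanSpace.single j 1) := by
    intro i j
    have hd : DifferentiableAt ℝ (fderiv ℝ u) x :=
      ((hu.fderiv_right (m := ∞) (by simp)).differentiable (by simp)) x
    have : pd j u = fun y => fderiv ℝ u y (EuclideanSpace.single j 1) := rfl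
    rw [pd, this, fderiv_clm_apply hd (differentiableAt_const _)]
    simp
  rw [h, h, hs]

section Fields

variable {S R : R3 → C3} {φ : R3 → ℂ}

theorem _root_.ContDiff.component (hS : ContDiff ℝ ∞ S) (i : Fin 3) :
    ContDiff ℝ ∞ fun x => S x i := (contDiff_piLp 2).1 hS i

theorem _root_.ContDiff.diff_component (hS : ContDiff ℝ ∞ S) (i : Fin 3) :
    Differentiable ℝ fun x => S x i := (hS.component i).differentiable (by simp)

theorem _root_.ContDiff.curl (hS : ContDiff ℝ ∞ S) : ContDiff ℝ ∞ (curl S) := by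
  refine (contDiff_piLp 2).2 fun i => ?_
  fin_cases i <;> exact ((hS.component _).pd _).sub ((hS.component _).pd _)

theorem _root_.ContDiff.dvg (hS : ContDiff ℝ ∞ S) : ContDiff ℝ ∞ (dvg S) :=
  ContDiff.sum fun i _ => (hS.component i).pd i

theorem _root_.ContDiff.grad (hφ : ContDiff ℝ ∞ φ) : ContDiff ℝ ∞ (grad φ) :=
  (contDiff_piLp 2).2 fun i => hφ.pd i

theorem _root_.ContDiff.conj3 (hS : ContDiff ℝ ∞ S) : ContDiff ℝ ∞ fun x => conj3 (S x) :=
  (contDiff_piLp 2).2 fun i => (Complex.conjCLE : ℂ →L[ℝ] ℂ).contDiff.comp (hS.component i)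

theorem _root_.ContDiff.cvec {N : R3 → R3} (hN : ContDiff ℝ ∞ N) :
    ContDiff ℝ ∞ fun x => cvec (N x) :=
  (contDiff_piLp 2).2 fun i => Complex.ofRealCLM.contDiff.comp ((contDiff_piLp 2).1 hN i)

theorem _root_.ContDiff.dot (hS : ContDiff ℝ ∞ S) (hR : ContDiff ℝ ∞ R) :
    ContDiff ℝ ∞ fun x => dot (S x) (R x) :=
  ContDiff.sum fun i _ => (hS.component i).mul (hR.component i)

theorem _root_.ContDiff.cross (hS : ContDiff ℝ ∞ S) (hR : ContDiff ℝ ∞ R) :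
    ContDiff ℝ ∞ fun x => cross (S x) (R x) := by
  refine (contDiff_piLp 2).2 fun i => ?_
  fin_cases i
  · simp only [Fin.zero_eta, cross_apply_zero]
    exact ((hS.component 1).mul (hR.component 2)).sub ((hS.component 2).mul (hR.component 1))
  · simp only [Fin.mk_one, cross_apply_one]
    exact ((hS.component 2).mul (hR.component 0)).sub ((hS.component 0).mul (hR.component 2))
  · simp only [Fin.reduceFinMk, cross_apply_two]
    exact ((hS.component 0).mul (hR.component 1)).sub ((hS.component 1).mul (hR.component 0))

theorem curl_apply_zero (S : R3 → C3) (x : R3) :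
    curl S x 0 = pd 1 (fun y => S y 2) x - pd 2 (fun y => S y 1) x := rfl

theorem curl_apply_one (S : R3 → C3) (x : R3) :
    curl S x 1 = pd 2 (fun y => S y 0) x - pd 0 (fun y => S y 2) x := rfl

theorem curl_apply_two (S : R3 → C3) (x : R3) :
    curl S x 2 = pd 0 (fun y => S y 1) x - pd 1 (fun y => S y 0) x := rfl

theorem dvg_eq (S : R3 → C3) (x : R3) : dvg S x = pd 0 (fun y => S y 0) x
    + pd 1 (fun y => S y 1) x + pd 2 (fun y => S y 2) x := by
  simp [dvg, Fin.sum_univ_three]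

theorem curl_grad (hφ : ContDiff ℝ ∞ φ) (x : R3) : curl (grad φ) x = 0 := by
  ext i
  fin_cases i
  · exact sub_eq_zero.2 (pd_comm hφ 1 2 x)
  · exact sub_eq_zero.2 (pd_comm hφ 2 0 x)
  · exact sub_eq_zero.2 (pd_comm hφ 0 1 x)

theorem curl_conj3 (hS : ContDiff ℝ ∞ S) (x : R3) :
    curl (fun y => conj3 (S y)) x = conj3 (curl S x) := by
  have h := fun i => hS.diff_component i
  ext i
  fin_cases i <;>
  simp only [Fin.zero_eta, Fin.mk_one, Fin.reduceFinMk, curl_apply_zero, curl_apply_one,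
    curl_apply_two, conj3_apply, map_sub, pd_conj (h _)]

theorem dvg_conj3 (hS : ContDiff ℝ ∞ S) (x : R3) :
    dvg (fun y => conj3 (S y)) x = (starRingEnd ℂ) (dvg S x) := by
  have h := fun i => hS.diff_component i
  simp only [dvg_eq, conj3_apply, map_add, pd_conj (h _)]

theorem dvg_smul (hφ : ContDiff ℝ ∞ φ) (hS : ContDiff ℝ ∞ S) (x : R3) :
    dvg (fun y => φ y • S y) x = dot (S x) (grad φ x) + dvg S x * φ x := by
  have h := fun i => hS.diff_component i
  have hf : Differentiable ℝ φ := hφ.differentiable (by simp)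
  simp only [dvg_eq, PiLp.smul_apply, smul_eq_mul, pd_mul hf (h _), dot_eq, grad]
  ring

theorem dvg_cross (hS : ContDiff ℝ ∞ S) (hR : ContDiff ℝ ∞ R) (x : R3) :
    dvg (fun y => cross (S y) (R y)) x = dot (curl S x) (R x) - dot (S x) (curl R x) := by
  have hs := fun i => hS.diff_component i
  have hr := fun i => hR.diff_component i
  have hm : ∀ i j, Differentiable ℝ fun y => S y i * R y j := fun i j => (hs i).mul (hr j)
  simp only [dvg_eq, cross_apply_zero, cross_apply_one, cross_apply_two, pd_sub (hm _ _) (hm _ _),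
    pd_mul (hs _) (hr _), dot_eq, curl_apply_zero, curl_apply_one, curl_apply_two]
  ring

/-- The Rellich identity. -/
theorem dvg_rellich {N : R3 → C3} (hN : ContDiff ℝ ∞ N) (hS : ContDiff ℝ ∞ S)
    (hR : ContDiff ℝ ∞ R) (x : R3) :
    dvg (fun y => dot (S y) (R y) • N y - dot (N y) (R y) • S y - dot (N y) (S y) • R y) x =
      dot (S x) (R x) * dvg N x
      - ∑ i, ∑ j, (S x i * R x j + R x i * S x j) * pd i (fun y => N y j) x
      - dot (N x) (R x) * dvg S x - dot (N x) (S x) * dvg R x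
      + dot (curl S x) (cross (N x) (R x)) + dot (curl R x) (cross (N x) (S x)) := by
  have hn := fun i => hN.diff_component i
  have hs := fun i => hS.diff_component i
  have hr := fun i => hR.diff_component i
  have hdot : ∀ {A B : R3 → C3}, (∀ i, Differentiable ℝ fun y => A y i) →
      (∀ i, Differentiable ℝ fun y => B y i) → ∀ i,
      pd i (fun y => dot (A y) (B y)) x = (pd i (fun y => A y 0) x * B x 0 +
        A x 0 * pd i (fun y => B y 0) x) + (pd i (fun y => A y 1) x * B x 1 +
        A x 1 * pd i (fun y => B y 1) x) + (pd i (fun y => A y 2) x * B x 2 +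
        A x 2 * pd i (fun y => B y 2) x) := by
    intro A B hA hB i
    simp only [dot_eq]
    rw [pd_add (((hA 0).fun_mul (hB 0)).fun_add ((hA 1).fun_mul (hB 1))) ((hA 2).fun_mul (hB 2)),
      pd_add ((hA 0).fun_mul (hB 0)) ((hA 1).fun_mul (hB 1)), pd_mul (hA 0) (hB 0), pd_mul (hA 1) (hB 1),
      pd_mul (hA 2) (hB 2)]
  have dSR : Differentiable ℝ fun y => dot (S y) (R y) := (hS.dot hR).differentiable (by simp)
  have dNR : Differentiable ℝ fun y => dot (N y) (R y) := (hN.dot hR).differentiable (by simp)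
  have dNS : Differentiable ℝ fun y => dot (N y) (S y) := (hN.dot hS).differentiable (by simp)
  have hcomp : ∀ i j, pd i (fun y => (dot (S y) (R y) • N y - dot (N y) (R y) • S y
      - dot (N y) (S y) • R y) j) x
      = (pd i (fun y => dot (S y) (R y)) x * N x j + dot (S x) (R x) * pd i (fun y => N y j) x)
      - (pd i (fun y => dot (N y) (R y)) x * S x j + dot (N x) (R x) * pd i (fun y => S y j) x)
      - (pd i (fun y => dot (N y) (S y)) x * R x j + dot (N x) (S x) * pd i (fun y => R y j) x) := by
    intro i j
    simp only [PiLp.sub_apply, PiLp.smul_apply, smul_eq_mul]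
    rw [pd_sub ((dSR.fun_mul (hn j)).fun_sub (dNR.fun_mul (hs j))) (dNS.fun_mul (hr j)),
      pd_sub (dSR.fun_mul (hn j)) (dNR.fun_mul (hs j)), pd_mul dSR (hn j), pd_mul dNR (hs j),
      pd_mul dNS (hr j)]
  -- Expanded in components, both sides are polynomials in the values and first partial derivatives
  -- of the three fields, so the identity is purely algebraic.
  rw [dvg_eq, hcomp, hcomp, hcomp]
  simp only [hdot hs hr, hdot hn hr, hdot hn hs]
  simp only [dvg_eq, Fin.sum_univ_three, dot_eq,
    cross_apply_zero, cross_apply_one, cross_apply_two, curl_apply_zero, curl_apply_one,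
    curl_apply_two]
  ring

end Fields

/-! ### `L²` norms -/

section L2

variable {F G : Type*} [NormedAddCommGroup F] [NormedAddCommGroup G] {m : Measure R3}

theorem L2norm_nonneg (m : Measure R3) (u : R3 → F) : 0 ≤ L2norm m u := ENNReal.toReal_nonneg

theorem L2norm_sq {u : R3 → F} (hu : MemLp u 2 m) : L2norm m u ^ 2 = ∫ x, ‖u x‖ ^ 2 ∂m := by
  have h0 : 0 ≤ ∫ x, ‖u x‖ ^ 2 ∂m := integral_nonneg fun x => by positivity
  rw [L2norm, hu.eLpNorm_eq_integral_rpow_norm (by simp) (by simp), ENNReal.toReal_ofReal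
    (by positivity)]
  simp only [ENNReal.toReal_ofNat, Real.rpow_ofNat]
  rw [← Real.rpow_natCast, ← Real.rpow_mul h0]
  norm_num

theorem rpow_integral_norm {u : R3 → F} (hu : MemLp u 2 m) :
    (∫ x, ‖u x‖ ^ (2 : ℝ) ∂m) ^ (1 / (2 : ℝ)) = L2norm m u := by
  simp only [Real.rpow_ofNat]
  rw [← L2norm_sq hu, ← Real.sqrt_eq_rpow, Real.sqrt_sq (L2norm_nonneg _ _)]

theorem integrable_norm_mul {u : R3 → F} {v : R3 → G} (hu : MemLp u 2 m) (hv : MemLp v 2 m) :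
    Integrable (fun x => ‖u x‖ * ‖v x‖) m := hu.norm.integrable_mul hv.norm

theorem integral_norm_mul_le {u : R3 → F} {v : R3 → G} (hu : MemLp u 2 m) (hv : MemLp v 2 m) :
    ∫ x, ‖u x‖ * ‖v x‖ ∂m ≤ L2norm m u * L2norm m v := by
  have h := integral_mul_norm_le_Lp_mul_Lq (μ := m) (f := fun x => ‖u x‖) (g := fun x => ‖v x‖)
    (p := 2) (q := 2) Real.HolderConjugate.two_two (by simpa using hu.norm) (by simpa using hv.norm)
  simp only [norm_norm] at h
  refine h.trans (le_of_eq ?_)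
  rw [rpow_integral_norm hu, rpow_integral_norm hv]

theorem L2norm_le_of_ae_le {u : R3 → F} {v : R3 → G} (hv : MemLp v 2 m) {c : ℝ} (hc : 0 ≤ c)
    (h : ∀ᵐ x ∂m, ‖u x‖ ≤ c * ‖v x‖) : L2norm m u ≤ c * L2norm m v := by
  have := eLpNorm_le_mul_eLpNorm_of_ae_le_mul h 2
  rw [L2norm, L2norm, ← ENNReal.toReal_ofReal hc, ← ENNReal.toReal_mul]
  exact ENNReal.toReal_mono (ENNReal.mul_ne_top (by simp) hv.eLpNorm_ne_top)
    (by simpa [ENNReal.toReal_ofReal hc] using this)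

theorem L2norm_congr {u v : R3 → F} (h : ∀ᵐ x ∂m, u x = v x) : L2norm m u = L2norm m v := by
  rw [L2norm, L2norm, eLpNorm_congr_ae h]

theorem L2norm_add_le {u v : R3 → F} (hu : MemLp u 2 m) (hv : MemLp v 2 m) :
    L2norm m (fun x => u x + v x) ≤ L2norm m u + L2norm m v := by
  rw [L2norm, L2norm, L2norm, ← ENNReal.toReal_add hu.eLpNorm_ne_top hv.eLpNorm_ne_top]
  exact ENNReal.toReal_mono (ENNReal.add_ne_top.2 ⟨hu.eLpNorm_ne_top, hv.eLpNorm_ne_top⟩)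
    (eLpNorm_add_le hu.1 hv.1 (by norm_num))

theorem tendsto_toLp {u : ℕ → R3 → F} {v : R3 → F} (hu : ∀ n, MemLp (u n) 2 m)
    (hv : MemLp v 2 m) (h : Tendsto (fun n => eLpNorm (u n - v) 2 m) atTop (𝓝 0)) :
    Tendsto (fun n => (hu n).toLp (u n)) atTop (𝓝 (hv.toLp v)) :=
  (Lp.tendsto_Lp_iff_tendsto_eLpNorm'' u hu v hv).2 h

theorem tendsto_L2norm {u : ℕ → R3 → F} {v : R3 → F} (hu : ∀ n, MemLp (u n) 2 m)
    (hv : MemLp v 2 m) (h : Tendsto (fun n => eLpNorm (u n - v) 2 m) atTop (𝓝 0)) :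
    Tendsto (fun n => L2norm m (u n)) atTop (𝓝 (L2norm m v)) := by
  simpa only [Lp.norm_toLp] using! (tendsto_toLp hu hv h).norm

theorem tendsto_integral_bilin {F G H : Type*} [NormedAddCommGroup F] [NormedSpace ℂ F]
    [NormedAddCommGroup G] [NormedSpace ℂ G] [NormedAddCommGroup H] [NormedSpace ℂ H]
    [CompleteSpace H] (B : F →L[ℂ] G →L[ℂ] H)
    {u : ℕ → R3 → F} {u' : R3 → F} {v : ℕ → R3 → G} {v' : R3 → G}
    (hu : ∀ n, MemLp (u n) 2 m) (hu' : MemLp u' 2 m)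
    (h : Tendsto (fun n => eLpNorm (u n - u') 2 m) atTop (𝓝 0))
    (hv : ∀ n, MemLp (v n) 2 m) (hv' : MemLp v' 2 m)
    (k : Tendsto (fun n => eLpNorm (v n - v') 2 m) atTop (𝓝 0)) :
    Tendsto (fun n => ∫ x, B (u n x) (v n x) ∂m) atTop (𝓝 (∫ x, B (u' x) (v' x) ∂m)) := by
  have e : ∀ {a : R3 → F} {b : R3 → G} (ha : MemLp a 2 m) (hb : MemLp b 2 m),
      ∫ x, B (a x) (b x) ∂m = B.lpPairing m 2 2 (ha.toLp a) (hb.toLp b) := by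
    intro a b ha hb
    rw [ContinuousLinearMap.lpPairing_eq_integral]
    refine integral_congr_ae ?_
    filter_upwards [ha.coeFn_toLp, hb.coeFn_toLp] with x h1 h2
    rw [h1, h2]
  have h1 := tendsto_toLp hu hu' h
  have h2 := tendsto_toLp hv hv' k
  have h3 := ((B.lpPairing m 2 2).continuous₂.tendsto
    (hu'.toLp u', hv'.toLp v')).comp (h1.prodMk_nhds h2)
  rw [e hu' hv']
  refine h3.congr fun n => ?_
  simp only [Function.comp]
  exact (e (hu n) (hv n)).symm

theorem tendsto_integral_dot {u : ℕ → R3 → C3} {u' : R3 → C3} {v : ℕ → R3 → C3} {v' : R3 → C3}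
    (hu : ∀ n, MemLp (u n) 2 m) (hu' : MemLp u' 2 m)
    (h : Tendsto (fun n => eLpNorm (u n - u') 2 m) atTop (𝓝 0))
    (hv : ∀ n, MemLp (v n) 2 m) (hv' : MemLp v' 2 m)
    (k : Tendsto (fun n => eLpNorm (v n - v') 2 m) atTop (𝓝 0)) :
    Tendsto (fun n => ∫ x, dot (u n x) (v n x) ∂m) atTop (𝓝 (∫ x, dot (u' x) (v' x) ∂m)) :=
  tendsto_integral_bilin dotL hu hu' h hv hv' k

theorem tendsto_integral_dot_const {u : ℕ → R3 → C3} {u' : R3 → C3} {v : R3 → C3}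
    (hu : ∀ n, MemLp (u n) 2 m) (hu' : MemLp u' 2 m)
    (h : Tendsto (fun n => eLpNorm (u n - u') 2 m) atTop (𝓝 0)) (hv : MemLp v 2 m) :
    Tendsto (fun n => ∫ x, dot (u n x) (v x) ∂m) atTop (𝓝 (∫ x, dot (u' x) (v x) ∂m)) :=
  tendsto_integral_dot hu hu' h (fun _ => hv) hv (by simp)

theorem continuous_conj3 : Continuous conj3 :=
  (PiLp.continuous_toLp 2 _).comp
    (continuous_pi fun i => Complex.continuous_conj.comp (EuclideanSpace.proj i).continuous)

theorem memLp_conj3 {u : R3 → C3} (hu : MemLp u 2 m) : MemLp (fun x => conj3 (u x)) 2 m := by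
  have h : AEStronglyMeasurable (fun x => conj3 (u x)) m :=
    continuous_conj3.comp_aestronglyMeasurable hu.1
  exact hu.of_le h (ae_of_all _ fun x => (norm_conj3 _).le)

theorem integrable_dot {u v : R3 → C3} (hu : MemLp u 2 m) (hv : MemLp v 2 m) :
    Integrable (fun x => dot (u x) (v x)) m := by
  have h : AEStronglyMeasurable (fun x => (fun q : C3 × C3 => dot q.1 q.2) (u x, v x)) m :=
    continuous_dot.comp_aestronglyMeasurable (hu.1.prodMk hv.1)
  exact (integrable_norm_mul hu hv).mono' h (ae_of_all _ fun x => norm_dot_le _ _)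

theorem eLpNorm_conj3_sub (u v : R3 → C3) :
    eLpNorm ((fun x => conj3 (u x)) - fun x => conj3 (v x)) 2 m = eLpNorm (u - v) 2 m := by
  refine eLpNorm_congr_norm_ae (ae_of_all _ fun x => ?_)
  rw [Pi.sub_apply, Pi.sub_apply, ← norm_conj3 (u x - v x)]
  congr 1
  ext i; simp

end L2

/-! ### Integral identities for smooth fields -/

section Smooth

variable {Ω : Set R3} {ν : R3 → R3}

theorem integral_dvg (hν : IsInnerUnitNormal Ω ν) (hΩ : IsOpen Ω) (hb : Bornology.IsBounded Ω)
    {F : R3 → C3} (hF : ContDiff ℝ ∞ F) :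
    ∫ x in Ω, dvg F x = -∫ x, dot (cvec (ν x)) (F x) ∂(surf Ω) := by
  have := surf_lt_top hν hΩ hb
  obtain ⟨N, hN, hNν⟩ := hν.exists_smooth_extension hΩ
  have h1 : ∀ i : Fin 3, Integrable (fun x => pd i (fun y => F y i) x) (vol Ω) := fun i =>
    memLp_one_iff_integrable.1 (((hF.component i).pd i).continuous.memLp_vol hΩ hb 1)
  have h2 : ∀ i : Fin 3, Integrable (fun x => cvec (ν x) i * F x i) (surf Ω) := fun i => by
    have h3 : Continuous fun x => cvec (N x) i * F x i :=
      (hN.cvec.component i).continuous.mul (hF.component i).continuous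
    refine (memLp_one_iff_integrable.1 (h3.memLp_surf hb 1)).congr (ae_surf_of_forall ?_)
    intro x hx; simp only [hNν x hx]
  have e1 := integral_finsetSum Finset.univ fun i _ => h1 i
  have e2 := integral_finsetSum Finset.univ fun i _ => h2 i
  rw [vol] at e1
  unfold dvg dot
  rw [e1, e2, ← Finset.sum_neg_distrib]
  refine Finset.sum_congr rfl fun i _ => ?_
  have := integral_fderiv hν hΩ hb (u := fun y => F y i) ((hF.component i).of_le (by simp))
    (EuclideanSpace.single i 1)
  simp only [pd]
  rw [this]
  simp [EuclideanSpace.inner_single_right]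

theorem integral_curl (hν : IsInnerUnitNormal Ω ν) (hΩ : IsOpen Ω) (hb : Bornology.IsBounded Ω)
    {S R : R3 → C3} (hS : ContDiff ℝ ∞ S) (hR : ContDiff ℝ ∞ R) :
    ∫ x in Ω, (dot (curl S x) (R x) - dot (S x) (curl R x)) =
      -∫ x, dot (cross (cvec (ν x)) (S x)) (R x) ∂(surf Ω) := by
  have := integral_dvg hν hΩ hb (hS.cross hR)
  simp only [dvg_cross hS hR, dot_cross_comm] at this
  exact this

theorem integral_green (hν : IsInnerUnitNormal Ω ν) (hΩ : IsOpen Ω) (hb : Bornology.IsBounded Ω)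
    {S : R3 → C3} {φ : R3 → ℂ} (hS : ContDiff ℝ ∞ S) (hφ : ContDiff ℝ ∞ φ) :
    ∫ x in Ω, (dot (S x) (grad φ x) + dvg S x * φ x) =
      -∫ x, dot (cvec (ν x)) (S x) * φ x ∂(surf Ω) := by
  have := integral_dvg hν hΩ hb (F := fun y => φ y • S y) (hφ.smul hS)
  simp only [dvg_smul hφ hS, dot_smul_right] at this
  rw [this, neg_inj]
  exact integral_congr_ae (ae_of_all _ fun x => mul_comm _ _)

/-- The Rellich identity is applied with `R` the conjugate of `S`. The constant 21 comes from the
terms without derivatives of `S`: 3 from `div N` and 18 from nine products with two summands each.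
The divergence and curl terms need only 2. -/
theorem rellich_pointwise {N : R3 → C3} (hN : ContDiff ℝ ∞ N) {S : R3 → C3}
    (hS : ContDiff ℝ ∞ S) {M : ℝ} {x : R3} (hM : ‖N x‖ ≤ M)
    (hM' : ∀ i j, ‖pd i (fun y => N y j) x‖ ≤ M) :
    ‖dvg (fun y => dot (S y) (conj3 (S y)) • N y - dot (N y) (conj3 (S y)) • S y
      - dot (N y) (S y) • conj3 (S y)) x‖ ≤
      21 * M * (‖S x‖ * ‖S x‖ + ‖S x‖ * ‖dvg S x‖ + ‖S x‖ * ‖curl S x‖) := by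
  have hM0 : 0 ≤ M := (norm_nonneg _).trans hM
  rw [dvg_rellich hN hS hS.conj3, dvg_conj3 hS, curl_conj3 hS]
  set s := ‖S x‖
  set d := ‖dvg S x‖
  set c := ‖curl S x‖
  have hs : 0 ≤ s := norm_nonneg _
  have hd : 0 ≤ d := norm_nonneg _
  have hc : 0 ≤ c := norm_nonneg _
  have hconj : ‖conj3 (S x)‖ = s := norm_conj3 _
  have hconj' : ‖conj3 (curl S x)‖ = c := norm_conj3 _
  have hsi : ∀ i, ‖S x i‖ ≤ s := fun i => PiLp.norm_apply_le _ _
  have hsi' : ∀ i, ‖conj3 (S x) i‖ ≤ s := fun i => hconj ▸ PiLp.norm_apply_le _ _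
  have t1 : ‖dot (S x) (conj3 (S x)) * dvg N x‖ ≤ (s * s) * (3 * M) := by
    rw [norm_mul]
    refine mul_le_mul ((norm_dot_le _ _).trans (by rw [hconj])) ?_ (norm_nonneg _) (by positivity)
    rw [dvg_eq]
    refine (norm_add₃_le).trans ?_
    linarith [hM' 0 0, hM' 1 1, hM' 2 2]
  have t2 : ‖∑ i, ∑ j, (S x i * conj3 (S x) j + conj3 (S x) i * S x j) *
      pd i (fun y => N y j) x‖ ≤ 18 * M * (s * s) := by
    have : ∀ i j : Fin 3, ‖(S x i * conj3 (S x) j + conj3 (S x) i * S x j) *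
        pd i (fun y => N y j) x‖ ≤ (s * s + s * s) * M := by
      intro i j
      rw [norm_mul]
      refine mul_le_mul ((norm_add_le _ _).trans ?_) (hM' i j) (norm_nonneg _) (by positivity)
      rw [norm_mul, norm_mul]
      exact add_le_add (mul_le_mul (hsi i) (hsi' j) (norm_nonneg _) hs)
        (mul_le_mul (hsi' i) (hsi j) (norm_nonneg _) hs)
    refine (norm_sum_le_of_le _ fun i _ => norm_sum_le_of_le _ fun j _ => this i j).trans ?_
    simp only [Finset.sum_const, Finset.card_univ, Fintype.card_fin, nsmul_eq_mul]
    push_cast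
    linarith
  have t3 : ‖dot (N x) (conj3 (S x)) * dvg S x‖ ≤ M * s * d := by
    rw [norm_mul]
    refine mul_le_mul_of_nonneg_right ((norm_dot_le _ _).trans ?_) hd
    rw [hconj]; gcongr
  have t4 : ‖dot (N x) (S x) * (starRingEnd ℂ) (dvg S x)‖ ≤ M * s * d := by
    rw [norm_mul, RCLike.norm_conj]
    refine mul_le_mul_of_nonneg_right ((norm_dot_le _ _).trans ?_) hd
    gcongr
  have t5 : ‖dot (curl S x) (cross (N x) (conj3 (S x)))‖ ≤ c * (M * s) := by
    refine (norm_dot_le _ _).trans ?_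
    refine mul_le_mul_of_nonneg_left ((norm_cross_le _ _).trans ?_) hc
    rw [hconj]; gcongr
  have t6 : ‖dot (conj3 (curl S x)) (cross (N x) (S x))‖ ≤ c * (M * s) := by
    refine (norm_dot_le _ _).trans ?_
    rw [hconj']
    refine mul_le_mul_of_nonneg_left ((norm_cross_le _ _).trans ?_) hc
    gcongr
  refine (norm_add_le _ _).trans ?_
  refine (add_le_add_left ((norm_add_le _ _).trans (add_le_add_left ((norm_sub_le _ _).trans
    (add_le_add_left ((norm_sub_le _ _).trans (add_le_add_left (norm_sub_le _ _) _)) _)) _)) _).trans ?_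
  have p1 : 0 ≤ M * s * d := by positivity
  have p2 : 0 ≤ M * s * c := by positivity
  nlinarith

theorem rellich_smooth (hν : IsInnerUnitNormal Ω ν) (hΩ : IsOpen Ω) (hb : Bornology.IsBounded Ω) :
    ∃ K : ℝ, 0 ≤ K ∧ ∀ S : R3 → C3, ContDiff ℝ ∞ S →
      |L2norm (surf Ω) S ^ 2 - 2 * L2norm (surf Ω) (fun x => dot (cvec (ν x)) (S x)) ^ 2| ≤
      K * (L2norm (vol Ω) S * (L2norm (vol Ω) S + L2norm (vol Ω) (dvg S)
        + L2norm (vol Ω) (curl S))) := by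
  have := surf_lt_top hν hΩ hb
  obtain ⟨N₀, hN₀, hNν⟩ := hν.exists_smooth_extension hΩ
  set N : R3 → C3 := fun x => cvec (N₀ x) with hNdef
  have hN : ContDiff ℝ ∞ N := hN₀.cvec
  have hcc : IsCompact (closure Ω) := hb.isCompact_closure
  have hM : ∃ M : ℝ, 0 ≤ M ∧ ∀ x ∈ closure Ω, ‖N x‖ ≤ M ∧ ∀ i j, ‖pd i (fun y => N y j) x‖ ≤ M := by
    have hcont : Continuous fun x => ‖N x‖ + ∑ i, ∑ j, ‖pd i (fun y => N y j) x‖ :=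
      hN.continuous.norm.add (continuous_finsetSum _ fun i _ => continuous_finsetSum _
        fun j _ => ((hN.component j).pd i).continuous.norm)
    obtain ⟨M, hM⟩ := hcc.exists_bound_of_continuousOn hcont.continuousOn
    refine ⟨max M 0, le_max_right _ _, fun x hx => ?_⟩
    have h1 := (le_abs_self _).trans ((hM x hx).trans (le_max_left M 0))
    have hnn : 0 ≤ ∑ i, ∑ j, ‖pd i (fun y => N y j) x‖ := by positivity
    refine ⟨by linarith, fun i j => ?_⟩
    have h2 : ‖pd i (fun y => N y j) x‖ ≤ ∑ j, ‖pd i (fun y => N y j) x‖ :=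
      Finset.single_le_sum (f := fun j => ‖pd i (fun y => N y j) x‖) (fun _ _ => norm_nonneg _)
        (Finset.mem_univ j)
    have h3 : ∑ j, ‖pd i (fun y => N y j) x‖ ≤ ∑ i, ∑ j, ‖pd i (fun y => N y j) x‖ :=
      Finset.single_le_sum (f := fun i => ∑ j, ‖pd i (fun y => N y j) x‖)
        (fun _ _ => by positivity) (Finset.mem_univ i)
    linarith [norm_nonneg (N x)]
  obtain ⟨M, hM0, hM⟩ := hM
  refine ⟨21 * M, by positivity, fun S hS => ?_⟩
  set V : R3 → C3 := fun y => dot (S y) (conj3 (S y)) • N y - dot (N y) (conj3 (S y)) • S y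
      - dot (N y) (S y) • conj3 (S y) with hV
  have hVd : ContDiff ℝ ∞ V := (((hS.dot hS.conj3).smul hN).sub
    ((hN.dot hS.conj3).smul hS)).sub ((hN.dot hS).smul hS.conj3)
  have hdiv := integral_dvg hν hΩ hb hVd
  have mS : MemLp S 2 (vol Ω) := hS.continuous.memLp_vol hΩ hb 2
  have mD : MemLp (dvg S) 2 (vol Ω) := hS.dvg.continuous.memLp_vol hΩ hb 2
  have mC : MemLp (curl S) 2 (vol Ω) := hS.curl.continuous.memLp_vol hΩ hb 2
  have mSΓ : MemLp S 2 (surf Ω) := hS.continuous.memLp_surf hb 2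
  have mnΓ : MemLp (fun x => dot (cvec (ν x)) (S x)) 2 (surf Ω) := by
    refine ((hN.dot hS).continuous.memLp_surf hb 2).ae_eq (ae_surf_of_forall fun x hx => ?_)
    simp only [hNdef, hNν x hx]
  -- On Γ the multiplier is the unit normal, so the normal component of `V` is the real quantity
  -- `|S|² - 2|⟨ν, S⟩|²`.
  have hbd : ∫ x, dot (cvec (ν x)) (V x) ∂(surf Ω) =
      ((L2norm (surf Ω) S ^ 2 - 2 * L2norm (surf Ω) (fun x => dot (cvec (ν x)) (S x)) ^ 2 : ℝ) : ℂ)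
      := by
    rw [L2norm_sq mSΓ, L2norm_sq mnΓ, ← integral_const_mul, ← integral_sub, ← integral_complex_ofReal]
    · refine integral_congr_ae (ae_surf_of_forall fun x hx => ?_)
      have hνν : dot (cvec (ν x)) (cvec (ν x)) = 1 := by
        rw [dot_cvec_cvec, real_inner_self_eq_norm_sq, hν.norm_eq hx]; norm_num
      have hcj : dot (cvec (ν x)) (conj3 (S x)) = (starRingEnd ℂ) (dot (cvec (ν x)) (S x)) := by
        simp [dot]
      simp only [hV, hNdef, hNν x hx, dot_sub_right, dot_smul_right, dot_conj3_self, hνν, hcj]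
      have h := Complex.mul_conj (dot (cvec (ν x)) (S x))
      rw [Complex.normSq_eq_norm_sq] at h
      push_cast at h ⊢
      linear_combination (-2) * h
    · exact mSΓ.integrable_norm_pow (by norm_num)
    · exact (mnΓ.integrable_norm_pow (by norm_num)).const_mul 2
  rw [hbd] at hdiv
  have e : |L2norm (surf Ω) S ^ 2 - 2 * L2norm (surf Ω) (fun x => dot (cvec (ν x)) (S x)) ^ 2|
      = ‖∫ x in Ω, dvg V x‖ := by
    rw [hdiv, norm_neg, Complex.norm_real, Real.norm_eq_abs]
  rw [e]
  have i1 := integrable_norm_mul mS mS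
  have i2 := integrable_norm_mul mS mD
  have i3 := integrable_norm_mul mS mC
  calc ‖∫ x in Ω, dvg V x‖ ≤ ∫ x in Ω, 21 * M * (‖S x‖ * ‖S x‖ + ‖S x‖ * ‖dvg S x‖
        + ‖S x‖ * ‖curl S x‖) := by
        refine norm_integral_le_of_norm_le (((i1.add i2).add i3).const_mul (21 * M)) ?_
        refine (ae_restrict_mem hΩ.measurableSet).mono fun x hx => ?_
        have := hM x (subset_closure hx)
        exact rellich_pointwise hN hS this.1 this.2
    _ = 21 * M * ((∫ x, ‖S x‖ * ‖S x‖ ∂(vol Ω)) + (∫ x, ‖S x‖ * ‖dvg S x‖ ∂(vol Ω))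
        + ∫ x, ‖S x‖ * ‖curl S x‖ ∂(vol Ω)) := by
        rw [integral_const_mul, ← integral_add i1 i2, ← integral_add (i1.fun_add i2) i3]; rfl
    _ ≤ 21 * M * (L2norm (vol Ω) S * L2norm (vol Ω) S + L2norm (vol Ω) S * L2norm (vol Ω) (dvg S)
        + L2norm (vol Ω) S * L2norm (vol Ω) (curl S)) := by
        gcongr
        · exact integral_norm_mul_le mS mS
        · exact integral_norm_mul_le mS mD
        · exact integral_norm_mul_le mS mC
    _ = _ := by ring

end Smooth

/-! ### Fields with a trace -/

/-- `F` has the trace `f`, the curl `C` and the divergence `D`. -/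
def HasTraceWith (Ω : Set R3) (F f C : R3 → C3) (D : R3 → ℂ) : Prop :=
  MemLp F 2 (vol Ω) ∧ MemLp f 2 (surf Ω) ∧ MemLp C 2 (vol Ω) ∧ MemLp D 2 (vol Ω) ∧
    ∃ S : ℕ → R3 → C3, (∀ n, ContDiff ℝ ∞ (S n)) ∧
      Tendsto (fun n => eLpNorm (S n - F) 2 (vol Ω)) atTop (𝓝 0) ∧
      Tendsto (fun n => eLpNorm (curl (S n) - C) 2 (vol Ω)) atTop (𝓝 0) ∧
      Tendsto (fun n => eLpNorm (dvg (S n) - D) 2 (vol Ω)) atTop (𝓝 0) ∧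
      Tendsto (fun n => eLpNorm (S n - f) 2 (surf Ω)) atTop (𝓝 0)

theorem HasTrace.exists_with {Ω : Set R3} {F f : R3 → C3} (h : HasTrace Ω F f) :
    ∃ C D, HasTraceWith Ω F f C D := by
  obtain ⟨hF, hf, C, D, hC, hD, h⟩ := h
  exact ⟨C, D, hF, hf, hC, hD, h⟩

theorem continuous_cross : Continuous fun q : C3 × C3 => cross q.1 q.2 := by
  refine (PiLp.continuous_toLp 2 _).comp (continuous_pi fun i => ?_)
  fin_cases i <;> simp [cross_apply] <;> fun_prop

theorem cross_sub_right (a b c : C3) : cross a (b - c) = cross a b - cross a c := by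
  ext i
  fin_cases i <;> simp [cross, cross_apply] <;> ring

section

variable {Ω : Set R3} {ν : R3 → R3}

theorem ae_norm_normal (hν : IsInnerUnitNormal Ω ν) : ∀ᵐ x ∂(surf Ω), ‖cvec (ν x)‖ = 1 :=
  ae_surf_of_forall fun x hx => by rw [norm_cvec, hν.norm_eq hx]

theorem aestronglyMeasurable_normal (hν : IsInnerUnitNormal Ω ν) (hΩ : IsOpen Ω) :
    AEStronglyMeasurable (fun x => cvec (ν x)) (surf Ω) := by
  obtain ⟨N, hN, hNν⟩ := hν.exists_smooth_extension hΩ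
  exact hN.cvec.continuous.aestronglyMeasurable.congr
    (ae_surf_of_forall fun x hx => by simp only [hNν x hx])

theorem memLp_cross_normal (hν : IsInnerUnitNormal Ω ν) (hΩ : IsOpen Ω) {f : R3 → C3}
    (hf : MemLp f 2 (surf Ω)) : MemLp (fun x => cross (cvec (ν x)) (f x)) 2 (surf Ω) := by
  have h : AEStronglyMeasurable
      (fun x => (fun q : C3 × C3 => cross q.1 q.2) (cvec (ν x), f x)) (surf Ω) :=
    continuous_cross.comp_aestronglyMeasurable ((aestronglyMeasurable_normal hν hΩ).prodMk hf.1)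
  refine hf.of_le h ((ae_norm_normal hν).mono fun x hx => ?_)
  simpa [hx] using norm_cross_le (cvec (ν x)) (f x)

theorem memLp_dot_normal (hν : IsInnerUnitNormal Ω ν) (hΩ : IsOpen Ω) {f : R3 → C3}
    (hf : MemLp f 2 (surf Ω)) : MemLp (fun x => dot (cvec (ν x)) (f x)) 2 (surf Ω) := by
  have h : AEStronglyMeasurable
      (fun x => (fun q : C3 × C3 => dot q.1 q.2) (cvec (ν x), f x)) (surf Ω) :=
    continuous_dot.comp_aestronglyMeasurable ((aestronglyMeasurable_normal hν hΩ).prodMk hf.1)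
  refine hf.of_le h ((ae_norm_normal hν).mono fun x hx => ?_)
  simpa [hx] using norm_dot_le (cvec (ν x)) (f x)

theorem tendsto_cross_normal (hν : IsInnerUnitNormal Ω ν) {S : ℕ → R3 → C3} {f : R3 → C3}
    (h : Tendsto (fun n => eLpNorm (S n - f) 2 (surf Ω)) atTop (𝓝 0)) :
    Tendsto (fun n => eLpNorm ((fun x => cross (cvec (ν x)) (S n x))
      - fun x => cross (cvec (ν x)) (f x)) 2 (surf Ω)) atTop (𝓝 0) := by
  refine tendsto_of_tendsto_of_tendsto_of_le_of_le tendsto_const_nhds h (fun n => zero_le)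
    fun n => eLpNorm_mono_ae ((ae_norm_normal hν).mono fun x hx => ?_)
  have := norm_cross_le (cvec (ν x)) ((S n - f) x)
  rw [hx, one_mul, Pi.sub_apply, cross_sub_right] at this
  exact this

theorem tendsto_dot_normal (hν : IsInnerUnitNormal Ω ν) {S : ℕ → R3 → C3} {f : R3 → C3}
    (h : Tendsto (fun n => eLpNorm (S n - f) 2 (surf Ω)) atTop (𝓝 0)) :
    Tendsto (fun n => eLpNorm ((fun x => dot (cvec (ν x)) (S n x))
      - fun x => dot (cvec (ν x)) (f x)) 2 (surf Ω)) atTop (𝓝 0) := by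
  refine tendsto_of_tendsto_of_tendsto_of_le_of_le tendsto_const_nhds h (fun n => zero_le)
    fun n => eLpNorm_mono_ae ((ae_norm_normal hν).mono fun x hx => ?_)
  have := norm_dot_le (cvec (ν x)) ((S n - f) x)
  rw [hx, one_mul, Pi.sub_apply, dot_sub_right] at this
  exact this

theorem integrable_mul_of_memLp {m : Measure R3} {u v : R3 → ℂ} (hu : MemLp u 2 m)
    (hv : MemLp v 2 m) : Integrable (fun x => u x * v x) m := hu.integrable_mul hv

/-- Every norm involved is continuous for the convergence that defines the trace, so the inequality
for smooth fields passes to the limit with the same constant. -/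
theorem rellich (hν : IsInnerUnitNormal Ω ν) (hΩ : IsOpen Ω) (hb : Bornology.IsBounded Ω) :
    ∃ K : ℝ, 0 ≤ K ∧ ∀ F f C D, HasTraceWith Ω F f C D →
      |L2norm (surf Ω) f ^ 2 - 2 * L2norm (surf Ω) (fun x => dot (cvec (ν x)) (f x)) ^ 2| ≤
      K * (L2norm (vol Ω) F * (L2norm (vol Ω) F + L2norm (vol Ω) D + L2norm (vol Ω) C)) := by
  have := surf_lt_top hν hΩ hb
  obtain ⟨K, hK, H⟩ := rellich_smooth hν hΩ hb
  refine ⟨K, hK, ?_⟩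
  rintro F f C D ⟨hF, hf, hC, hD, S, hS, h1, h2, h3, h4⟩
  have mS : ∀ n, MemLp (S n) 2 (vol Ω) := fun n => (hS n).continuous.memLp_vol hΩ hb 2
  have mD : ∀ n, MemLp (dvg (S n)) 2 (vol Ω) := fun n => (hS n).dvg.continuous.memLp_vol hΩ hb 2
  have mC : ∀ n, MemLp (curl (S n)) 2 (vol Ω) := fun n => (hS n).curl.continuous.memLp_vol hΩ hb 2
  have mΓ : ∀ n, MemLp (S n) 2 (surf Ω) := fun n => (hS n).continuous.memLp_surf hb 2
  have t1 := tendsto_L2norm mS hF h1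
  have t2 := tendsto_L2norm mC hC h2
  have t3 := tendsto_L2norm mD hD h3
  have t4 := tendsto_L2norm mΓ hf h4
  have t5 := tendsto_L2norm (fun n => memLp_dot_normal hν hΩ (mΓ n)) (memLp_dot_normal hν hΩ hf)
    (tendsto_dot_normal hν h4)
  exact le_of_tendsto_of_tendsto' ((t4.pow 2).sub ((t5.pow 2).const_mul 2)).abs
    ((t1.mul ((t1.add t3).add t2)).const_mul K) fun n => H (S n) (hS n)

theorem HasTraceWith.integral_curl (hν : IsInnerUnitNormal Ω ν) (hΩ : IsOpen Ω)
    (hb : Bornology.IsBounded Ω) {F f C : R3 → C3} {D : R3 → ℂ} (h : HasTraceWith Ω F f C D)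
    {R : R3 → C3} (hR : ContDiff ℝ ∞ R) :
    ∫ x, dot (C x) (R x) ∂(vol Ω) - ∫ x, dot (F x) (curl R x) ∂(vol Ω) =
      -∫ x, dot (cross (cvec (ν x)) (f x)) (R x) ∂(surf Ω) := by
  have := surf_lt_top hν hΩ hb
  obtain ⟨hF, hf, hC, hD, S, hS, h1, h2, h3, h4⟩ := h
  have mS : ∀ n, MemLp (S n) 2 (vol Ω) := fun n => (hS n).continuous.memLp_vol hΩ hb 2
  have mC : ∀ n, MemLp (curl (S n)) 2 (vol Ω) := fun n => (hS n).curl.continuous.memLp_vol hΩ hb 2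
  have mΓ : ∀ n, MemLp (S n) 2 (surf Ω) := fun n => (hS n).continuous.memLp_surf hb 2
  have mR := hR.continuous.memLp_vol hΩ hb 2
  have mcR := hR.curl.continuous.memLp_vol hΩ hb 2
  have t1 := tendsto_integral_dot_const mC hC h2 mR
  have t2 := tendsto_integral_dot_const mS hF h1 mcR
  have t3 := tendsto_integral_dot_const (fun n => memLp_cross_normal hν hΩ (mΓ n))
    (memLp_cross_normal hν hΩ hf) (tendsto_cross_normal hν h4) (hR.continuous.memLp_surf hb 2)
  refine tendsto_nhds_unique_of_eventuallyEq (t1.sub t2) t3.neg (Eventually.of_forall fun n => ?_)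
  simp only
  rw [← Maxwell.integral_curl hν hΩ hb (hS n) hR,
    ← integral_sub (integrable_dot (mC n) mR) (integrable_dot (mS n) mcR)]
  rfl

theorem HasTraceWith.integral_green (hν : IsInnerUnitNormal Ω ν) (hΩ : IsOpen Ω)
    (hb : Bornology.IsBounded Ω) {F f C : R3 → C3} {D : R3 → ℂ} (h : HasTraceWith Ω F f C D)
    {φ : R3 → ℂ} (hφ : ContDiff ℝ ∞ φ) :
    ∫ x, dot (F x) (grad φ x) ∂(vol Ω) + ∫ x, D x * φ x ∂(vol Ω) =
      -∫ x, dot (cvec (ν x)) (f x) * φ x ∂(surf Ω) := by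
  have := surf_lt_top hν hΩ hb
  obtain ⟨hF, hf, hC, hD, S, hS, h1, h2, h3, h4⟩ := h
  have mS : ∀ n, MemLp (S n) 2 (vol Ω) := fun n => (hS n).continuous.memLp_vol hΩ hb 2
  have mD : ∀ n, MemLp (dvg (S n)) 2 (vol Ω) := fun n => (hS n).dvg.continuous.memLp_vol hΩ hb 2
  have mΓ : ∀ n, MemLp (S n) 2 (surf Ω) := fun n => (hS n).continuous.memLp_surf hb 2
  have mφ := hφ.continuous.memLp_vol hΩ hb 2
  have mg := hφ.grad.continuous.memLp_vol hΩ hb 2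
  have t1 := tendsto_integral_dot_const mS hF h1 mg
  have t2 := tendsto_integral_bilin (ContinuousLinearMap.mul ℂ ℂ) mD hD h3 (fun _ => mφ) mφ
    (by simp)
  have t3 := tendsto_integral_bilin (ContinuousLinearMap.mul ℂ ℂ)
    (fun n => memLp_dot_normal hν hΩ (mΓ n)) (memLp_dot_normal hν hΩ hf)
    (tendsto_dot_normal hν h4) (fun _ => hφ.continuous.memLp_surf hb 2)
    (hφ.continuous.memLp_surf hb 2) (by simp)
  simp only [ContinuousLinearMap.mul_apply'] at t2 t3
  refine tendsto_nhds_unique_of_eventuallyEq (t1.add t2) t3.neg (Eventually.of_forall fun n => ?_)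
  simp only
  rw [← Maxwell.integral_green hν hΩ hb (hS n) hφ,
    ← integral_add (integrable_dot (mS n) mg) (integrable_mul_of_memLp (mD n) mφ)]
  rfl

/-- Both fields are replaced by their smooth approximations at once; the pairing of `E` with the
conjugate of `H` is what the energy identity uses. -/
theorem HasTraceWith.integral_pair (hν : IsInnerUnitNormal Ω ν) (hΩ : IsOpen Ω)
    (hb : Bornology.IsBounded Ω) {F f C F' f' C' : R3 → C3} {D D' : R3 → ℂ}
    (h : HasTraceWith Ω F f C D) (h' : HasTraceWith Ω F' f' C' D') :
    ∫ x, dot (C x) (conj3 (F' x)) ∂(vol Ω) - ∫ x, dot (F x) (conj3 (C' x)) ∂(vol Ω) =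
      -∫ x, dot (cross (cvec (ν x)) (f x)) (conj3 (f' x)) ∂(surf Ω) := by
  have := surf_lt_top hν hΩ hb
  obtain ⟨hF, hf, hC, hD, S, hS, h1, h2, h3, h4⟩ := h
  obtain ⟨hF', hf', hC', hD', S', hS', h1', h2', h3', h4'⟩ := h'
  have mS : ∀ n, MemLp (S n) 2 (vol Ω) := fun n => (hS n).continuous.memLp_vol hΩ hb 2
  have mC : ∀ n, MemLp (curl (S n)) 2 (vol Ω) := fun n => (hS n).curl.continuous.memLp_vol hΩ hb 2
  have mΓ : ∀ n, MemLp (S n) 2 (surf Ω) := fun n => (hS n).continuous.memLp_surf hb 2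
  have mS' : ∀ n, MemLp (S' n) 2 (vol Ω) := fun n => (hS' n).continuous.memLp_vol hΩ hb 2
  have mC' : ∀ n, MemLp (curl (S' n)) 2 (vol Ω) :=
    fun n => (hS' n).curl.continuous.memLp_vol hΩ hb 2
  have mΓ' : ∀ n, MemLp (S' n) 2 (surf Ω) := fun n => (hS' n).continuous.memLp_surf hb 2
  have t1 := tendsto_integral_dot mC hC h2 (fun n => memLp_conj3 (mS' n)) (memLp_conj3 hF')
    (by simpa only [eLpNorm_conj3_sub] using h1')
  have t2 := tendsto_integral_dot mS hF h1 (fun n => memLp_conj3 (mC' n)) (memLp_conj3 hC')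
    (by simpa only [eLpNorm_conj3_sub] using h2')
  have t3 := tendsto_integral_dot (fun n => memLp_cross_normal hν hΩ (mΓ n))
    (memLp_cross_normal hν hΩ hf) (tendsto_cross_normal hν h4) (fun n => memLp_conj3 (mΓ' n))
    (memLp_conj3 hf') (by simpa only [eLpNorm_conj3_sub] using h4')
  refine tendsto_nhds_unique_of_eventuallyEq (t1.sub t2) t3.neg (Eventually.of_forall fun n => ?_)
  simp only
  have e := Maxwell.integral_curl hν hΩ hb (hS n) (hS' n).conj3
  simp only [curl_conj3 (hS' n)] at e
  rw [← e, ← integral_sub (integrable_dot (mC n) (memLp_conj3 (mS' n)))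
    (integrable_dot (mS n) (memLp_conj3 (mC' n)))]
  rfl

/-! ### Almost everywhere identities from test functions -/

theorem ae_vol_eq_zero_of_test (hΩ : IsOpen Ω) (hb : Bornology.IsBounded Ω) {f : R3 → ℂ}
    (hf : MemLp f 2 (vol Ω))
    (h : ∀ g : R3 → ℝ, ContDiff ℝ ∞ g → HasCompactSupport g → tsupport g ⊆ Ω →
      ∫ x, f x * (g x : ℂ) ∂(vol Ω) = 0) : ∀ᵐ x ∂(vol Ω), f x = 0 := by
  have := isFiniteMeasure_vol hb
  have hi : Integrable f (vol Ω) := hf.integrable (by norm_num)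
  have hl : LocallyIntegrableOn f Ω volume := IntegrableOn.locallyIntegrableOn hi
  have := hΩ.ae_eq_zero_of_integral_contDiff_smul_eq_zero hl fun g hg hc hs => by
    have e := h g hg hc hs
    rw [vol, setIntegral_eq_integral_of_forall_compl_eq_zero] at e
    · rw [← e]
      exact integral_congr_ae (ae_of_all _ fun x => by simp [mul_comm])
    · intro x hx
      rw [image_eq_zero_of_notMem_tsupport fun hx' => hx (hs hx')]; simp
  exact (ae_restrict_iff' hΩ.measurableSet).2 this

theorem ae_surf_eq_zero_of_test [IsFiniteMeasure (surf Ω)] {f : R3 → ℂ} (hf : MemLp f 2 (surf Ω))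
    (h : ∀ g : R3 → ℝ, ContDiff ℝ ∞ g → HasCompactSupport g →
      ∫ x, f x * (g x : ℂ) ∂(surf Ω) = 0) : ∀ᵐ x ∂(surf Ω), f x = 0 := by
  have hi : Integrable f (surf Ω) := hf.integrable (by norm_num)
  refine ae_eq_zero_of_integral_contDiff_smul_eq_zero hi.locallyIntegrable fun g hg hc => ?_
  rw [← h g hg hc]
  exact integral_congr_ae (ae_of_all _ fun x => by simp [mul_comm])

theorem _root_.ContDiff.ofReal' {g : R3 → ℝ} (hg : ContDiff ℝ ∞ g) :
    ContDiff ℝ ∞ fun x => (g x : ℂ) := Complex.ofRealCLM.contDiff.comp hg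

theorem _root_.HasCompactSupport.ofReal' {g : R3 → ℝ} (hg : HasCompactSupport g) :
    HasCompactSupport fun x => (g x : ℂ) := hg.comp_left (g := fun r : ℝ => (r : ℂ)) (by simp)

theorem tsupport_ofReal_subset (g : R3 → ℝ) : tsupport (fun x => (g x : ℂ)) ⊆ tsupport g :=
  closure_mono (Function.support_comp_subset (g := fun r : ℝ => (r : ℂ)) (by simp) g)

theorem notMem_of_mem_frontier (hΩ : IsOpen Ω) {x : R3} (hx : x ∈ frontier Ω) : x ∉ Ω := by
  rw [hΩ.frontier_eq] at hx; exact hx.2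

theorem grad_eq_zero_of_notMem {φ : R3 → ℂ} {x : R3} (hx : x ∉ tsupport φ) : grad φ x = 0 := by
  have : fderiv ℝ φ x = 0 := by
    by_contra h; exact hx (support_fderiv_subset ℝ h)
  ext i
  simp [grad, pd, this]

/-- The limit curl `C` and the distributional curl agree because test fields supported in `Ω`
produce no boundary term. This turns the weak Maxwell equations into pointwise relations for `C`. -/
theorem HasTraceWith.ae_curl (hν : IsInnerUnitNormal Ω ν) (hΩ : IsOpen Ω)
    (hb : Bornology.IsBounded Ω) {F f C : R3 → C3} {D : R3 → ℂ} (h : HasTraceWith Ω F f C D)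
    {k : ℂ} {G : R3 → C3} (hG : MemLp G 2 (vol Ω)) (hw : IsWeakCurl Ω (fun x => k • F x) G) :
    ∀ᵐ x ∂(vol Ω), k • C x = G x := by
  have key : ∀ i : Fin 3, ∀ᵐ x ∂(vol Ω), (k • C x - G x) i = 0 := by
    intro i
    have mdiff : MemLp (fun x => k • C x - G x) 2 (vol Ω) := (h.2.2.1.const_smul k).sub hG
    refine ae_vol_eq_zero_of_test hΩ hb (mdiff.eval_piLp i) fun g hg hc hs => ?_
    set Φ : R3 → C3 := fun x => EuclideanSpace.single i (g x : ℂ) with hΦ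
    have hΦd : ContDiff ℝ ∞ Φ := by
      refine (contDiff_piLp 2).2 fun j => ?_
      by_cases hj : j = i
      · simpa [hΦ, hj] using hg.ofReal'
      · simpa [hΦ, hj] using contDiff_const
    have hΦs : Function.support Φ ⊆ Function.support g := fun x hx hx0 => hx (by simp [hΦ, hx0])
    have hΦc : HasCompactSupport Φ := hc.mono hΦs
    have hΦt : tsupport Φ ⊆ Ω := (closure_mono hΦs).trans hs
    have e1 := hw Φ hΦd hΦc hΦt
    have e2 := h.integral_curl hν hΩ hb hΦd
    have e3 : ∫ x, dot (cross (cvec (ν x)) (f x)) (Φ x) ∂(surf Ω) = 0 := by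
      rw [integral_congr_ae (g := fun _ => 0) (ae_surf_of_forall fun x hx => ?_)]
      · simp
      · have : Φ x = 0 := image_eq_zero_of_notMem_tsupport
          fun hx' => notMem_of_mem_frontier hΩ hx (hΦt hx')
        simp [this, dot_zero_right]
    have mΦ := hΦd.continuous.memLp_vol hΩ hb 2
    have mk : MemLp (fun x => k • C x) 2 (vol Ω) := h.2.2.1.const_smul k
    have e4 : ∀ x, (k • C x - G x) i * (g x : ℂ) = dot (k • C x) (Φ x) - dot (G x) (Φ x) := by
      intro x
      rw [← dot_sub_left]
      simp [dot, hΦ]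
    simp only [dot_smul_left, integral_const_mul] at e1
    simp_rw [e4]
    rw [integral_sub (integrable_dot mk mΦ) (integrable_dot hG mΦ)]
    simp only [dot_smul_left, integral_const_mul]
    rw [e3, neg_zero, sub_eq_zero] at e2
    rw [e2, sub_eq_zero]
    exact e1
  filter_upwards [ae_all_iff.2 key] with x hx
  exact sub_eq_zero.1 (by ext i; exact hx i)

end

section

variable {Ω : Set R3} {ν : R3 → R3}

/-! ### Divergence and normal component of the solution -/

theorem memLp_vol_mul (hΩ : IsOpen Ω) (hb : Bornology.IsBounded Ω) {c u : R3 → ℂ}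
    (hc : Continuous c) (hu : MemLp u 2 (vol Ω)) : MemLp (fun x => c x * u x) 2 (vol Ω) := by
  obtain ⟨M, hM⟩ := hb.isCompact_closure.exists_bound_of_continuousOn hc.continuousOn
  refine hu.of_le_mul (c := M) (hc.aestronglyMeasurable.mul hu.1) ?_
  refine (ae_restrict_mem hΩ.measurableSet).mono fun x hx => ?_
  rw [norm_mul]
  exact mul_le_mul_of_nonneg_right (hM x (subset_closure hx)) (norm_nonneg _)

theorem memLp_surf_mul (hb : Bornology.IsBounded Ω) {c u : R3 → ℂ}
    (hc : Continuous c) (hu : MemLp u 2 (surf Ω)) : MemLp (fun x => c x * u x) 2 (surf Ω) := by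
  obtain ⟨M, hM⟩ := hb.isCompact_closure.exists_bound_of_continuousOn hc.continuousOn
  refine hu.of_le_mul (c := M) (hc.aestronglyMeasurable.mul hu.1) (ae_surf_of_forall fun x hx => ?_)
  rw [norm_mul]
  exact mul_le_mul_of_nonneg_right (hM x (frontier_subset_closure hx)) (norm_nonneg _)

theorem memLp_vol_dot (hΩ : IsOpen Ω) (hb : Bornology.IsBounded Ω) {c u : R3 → C3}
    (hc : Continuous c) (hu : MemLp u 2 (vol Ω)) : MemLp (fun x => dot (u x) (c x)) 2 (vol Ω) := by
  obtain ⟨M, hM⟩ := hb.isCompact_closure.exists_bound_of_continuousOn hc.continuousOn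
  have h : AEStronglyMeasurable (fun x => (fun q : C3 × C3 => dot q.1 q.2) (u x, c x)) (vol Ω) :=
    continuous_dot.comp_aestronglyMeasurable (hu.1.prodMk hc.aestronglyMeasurable)
  refine hu.of_le_mul (c := M) h ((ae_restrict_mem hΩ.measurableSet).mono fun x hx => ?_)
  refine (norm_dot_le _ _).trans ?_
  rw [mul_comm]
  exact mul_le_mul_of_nonneg_right (hM x (subset_closure hx)) (norm_nonneg _)

theorem memLp_surf_dot (hb : Bornology.IsBounded Ω) {c u : R3 → C3}
    (hc : Continuous c) (hu : MemLp u 2 (surf Ω)) :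
    MemLp (fun x => dot (u x) (c x)) 2 (surf Ω) := by
  obtain ⟨M, hM⟩ := hb.isCompact_closure.exists_bound_of_continuousOn hc.continuousOn
  have h : AEStronglyMeasurable (fun x => (fun q : C3 × C3 => dot q.1 q.2) (u x, c x)) (surf Ω) :=
    continuous_dot.comp_aestronglyMeasurable (hu.1.prodMk hc.aestronglyMeasurable)
  refine hu.of_le_mul (c := M) h (ae_surf_of_forall fun x hx => ?_)
  refine (norm_dot_le _ _).trans ?_
  rw [mul_comm]
  exact mul_le_mul_of_nonneg_right (hM x (frontier_subset_closure hx)) (norm_nonneg _)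

theorem grad_mul {u v : R3 → ℂ} (hu : Differentiable ℝ u) (hv : Differentiable ℝ v) (x : R3) :
    grad (fun y => u y * v y) x = u x • grad v x + v x • grad u x := by
  ext i
  simp only [grad, pd_mul hu hv, PiLp.add_apply, PiLp.smul_apply, smul_eq_mul]
  ring

/-- The equation is tested with `∇g`. Since `curl ∇g = 0`, only a boundary integral survives from
the curl, while Green's formula with the test function `m g` moves the gradient off `F`. Test
functions supported in `Ω` then yield the divergence of `F`, and general ones its normal trace. -/
theorem integral_normal_aux (hν : IsInnerUnitNormal Ω ν) (hΩ : IsOpen Ω)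
    (hb : Bornology.IsBounded Ω) {E fE CE F f C U : R3 → C3} {DE D : R3 → ℂ}
    (hE : HasTraceWith Ω E fE CE DE) (hF : HasTraceWith Ω F f C D) (hU : MemLp U 2 (vol Ω))
    {k a : ℂ} {m : R3 → ℝ} (hm : ContDiff ℝ ∞ m)
    (hrel : ∀ᵐ x ∂(vol Ω), k • CE x = (a * (m x : ℂ)) • F x + U x)
    {g : R3 → ℝ} (hg : ContDiff ℝ ∞ g) :
    -(k * ∫ x, dot (cross (cvec (ν x)) (fE x)) (grad (fun y => (g y : ℂ)) x) ∂(surf Ω)) =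
      ∫ x, dot (U x) (grad (fun y => (g y : ℂ)) x) ∂(vol Ω)
      - ∫ x, a * ((m x : ℂ) * D x + dot (F x) (grad (fun y => (m y : ℂ)) x)) * (g x : ℂ) ∂(vol Ω)
      - a * ∫ x, (m x : ℂ) * dot (cvec (ν x)) (f x) * (g x : ℂ) ∂(surf Ω) := by
  have hmc := hm.ofReal'
  have hgc := hg.ofReal'
  have hmd : Differentiable ℝ fun y => (m y : ℂ) := hmc.differentiable (by simp)
  have hgd : Differentiable ℝ fun y => (g y : ℂ) := hgc.differentiable (by simp)
  have e1 := hE.integral_curl hν hΩ hb hgc.grad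
  simp only [curl_grad hgc, dot_zero_right, integral_zero, sub_zero] at e1
  have e2 := hF.integral_green hν hΩ hb (hmc.mul hgc)
  have mgg := hgc.grad.continuous.memLp_vol hΩ hb 2
  have mg := hgc.continuous.memLp_vol hΩ hb 2
  have mF1 := memLp_vol_dot hΩ hb hgc.grad.continuous hF.1
  have mF2 := memLp_vol_dot hΩ hb hmc.grad.continuous hF.1
  have mmF1 := memLp_vol_mul hΩ hb hmc.continuous mF1
  have mgF2 := memLp_vol_mul hΩ hb hgc.continuous mF2
  have mmD := memLp_vol_mul hΩ hb hmc.continuous hF.2.2.2.1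
  have := isFiniteMeasure_vol hb
  have e3 : ∫ x, dot (F x) (grad (fun x => (m x : ℂ) * (g x : ℂ)) x) ∂(vol Ω)
      = ∫ x, (m x : ℂ) * dot (F x) (grad (fun y => (g y : ℂ)) x) ∂(vol Ω)
      + ∫ x, (g x : ℂ) * dot (F x) (grad (fun y => (m y : ℂ)) x) ∂(vol Ω) := by
    rw [← integral_add (mmF1.integrable (by norm_num)) (mgF2.integrable (by norm_num))]
    refine integral_congr_ae (ae_of_all _ fun x => ?_)
    have : grad (fun x => (m x : ℂ) * (g x : ℂ)) x = (m x : ℂ) • grad (fun y => (g y : ℂ)) x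
        + (g x : ℂ) • grad (fun y => (m y : ℂ)) x := grad_mul hmd hgd x
    simp only [this, dot_add_right, dot_smul_right]
  have e4 : k * ∫ x, dot (CE x) (grad (fun y => (g y : ℂ)) x) ∂(vol Ω)
      = a * ∫ x, (m x : ℂ) * dot (F x) (grad (fun y => (g y : ℂ)) x) ∂(vol Ω)
      + ∫ x, dot (U x) (grad (fun y => (g y : ℂ)) x) ∂(vol Ω) := by
    rw [← integral_const_mul, ← integral_const_mul,
      ← integral_add ((mmF1.integrable (by norm_num)).const_mul a) (integrable_dot hU mgg)]
    refine integral_congr_ae (hrel.mono fun x hx => ?_)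
    simp only
    rw [← dot_smul_left, hx, dot_add_left, dot_smul_left, mul_assoc]
  have e5 : ∫ x, a * ((m x : ℂ) * D x + dot (F x) (grad (fun y => (m y : ℂ)) x)) * (g x : ℂ) ∂(vol Ω)
      = a * (∫ x, (m x : ℂ) * D x * (g x : ℂ) ∂(vol Ω)
      + ∫ x, (g x : ℂ) * dot (F x) (grad (fun y => (m y : ℂ)) x) ∂(vol Ω)) := by
    rw [← integral_add (integrable_mul_of_memLp mmD mg) (mgF2.integrable (by norm_num)),
      ← integral_const_mul]
    exact integral_congr_ae (ae_of_all _ fun x => by ring)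
  have e6 : ∫ x, D x * ((m x : ℂ) * (g x : ℂ)) ∂(vol Ω)
      = ∫ x, (m x : ℂ) * D x * (g x : ℂ) ∂(vol Ω) :=
    integral_congr_ae (ae_of_all _ fun x => by ring)
  have e7 : ∫ x, dot (cvec (ν x)) (f x) * ((m x : ℂ) * (g x : ℂ)) ∂(surf Ω)
      = ∫ x, (m x : ℂ) * dot (cvec (ν x)) (f x) * (g x : ℂ) ∂(surf Ω) :=
    integral_congr_ae (ae_of_all _ fun x => by ring)
  rw [e3, e6, e7] at e2
  rw [e5]
  rw [e1] at e4
  linear_combination e4 + a * e2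

theorem ae_divergence (hν : IsInnerUnitNormal Ω ν) (hΩ : IsOpen Ω)
    (hb : Bornology.IsBounded Ω) {E fE CE F f C U : R3 → C3} {DE D DU : R3 → ℂ}
    (hE : HasTraceWith Ω E fE CE DE) (hF : HasTraceWith Ω F f C D) (hU : MemLp U 2 (vol Ω))
    (hDU : MemLp DU 2 (vol Ω)) (hdiv : IsWeakDiv Ω U DU)
    {k a : ℂ} {m : R3 → ℝ} (hm : ContDiff ℝ ∞ m)
    (hrel : ∀ᵐ x ∂(vol Ω), k • CE x = (a * (m x : ℂ)) • F x + U x) :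
    ∀ᵐ x ∂(vol Ω), a * ((m x : ℂ) * D x + dot (F x) (grad (fun y => (m y : ℂ)) x)) = -DU x := by
  have hmc := hm.ofReal'
  have mW : MemLp (fun x => a * ((m x : ℂ) * D x + dot (F x) (grad (fun y => (m y : ℂ)) x))) 2
      (vol Ω) := ((memLp_vol_mul hΩ hb hmc.continuous hF.2.2.2.1).add
        (memLp_vol_dot hΩ hb hmc.grad.continuous hF.1)).const_mul a
  have key : ∀ᵐ x ∂(vol Ω),
      a * ((m x : ℂ) * D x + dot (F x) (grad (fun y => (m y : ℂ)) x)) + DU x = 0 := by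
    refine ae_vol_eq_zero_of_test hΩ hb (mW.add hDU) fun g hg hc hs => ?_
    have e := integral_normal_aux hν hΩ hb hE hF hU hm hrel hg
    have hts := (tsupport_ofReal_subset g).trans hs
    have e1 : ∫ x, dot (cross (cvec (ν x)) (fE x)) (grad (fun y => (g y : ℂ)) x) ∂(surf Ω) = 0 := by
      rw [integral_congr_ae (g := fun _ => 0) (ae_surf_of_forall fun x hx => ?_)]
      · simp
      · simp only
        rw [grad_eq_zero_of_notMem fun h => notMem_of_mem_frontier hΩ hx (hts h), dot_zero_right]
    have e2 : ∫ x, (m x : ℂ) * dot (cvec (ν x)) (f x) * (g x : ℂ) ∂(surf Ω) = 0 := by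
      rw [integral_congr_ae (g := fun _ => 0) (ae_surf_of_forall fun x hx => ?_)]
      · simp
      · simp only
        rw [image_eq_zero_of_notMem_tsupport fun h => notMem_of_mem_frontier hΩ hx (hs h)]; simp
    have e3 := hdiv (fun y => (g y : ℂ)) hg.ofReal' hc.ofReal' hts
    rw [vol] at e
    rw [e1, e2, e3, ← vol] at e
    have mg := hg.ofReal'.continuous.memLp_vol hΩ hb 2
    simp only [add_mul]
    rw [integral_add (integrable_mul_of_memLp mW mg) (integrable_mul_of_memLp hDU mg)]
    linear_combination e
  exact key.mono fun x hx => eq_neg_of_add_eq_zero_left hx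

/-- Once the divergence equation is inserted, the volume terms are exactly those of the weak normal
trace of `U`. -/
theorem integral_normal (hν : IsInnerUnitNormal Ω ν) (hΩ : IsOpen Ω)
    (hb : Bornology.IsBounded Ω) {E fE CE F f C U : R3 → C3} {DE D DU : R3 → ℂ}
    (hE : HasTraceWith Ω E fE CE DE) (hF : HasTraceWith Ω F f C D) (hU : MemLp U 2 (vol Ω))
    (hDU : MemLp DU 2 (vol Ω)) (hdiv : IsWeakDiv Ω U DU)
    {k a : ℂ} {m : R3 → ℝ} (hm : ContDiff ℝ ∞ m)
    (hrel : ∀ᵐ x ∂(vol Ω), k • CE x = (a * (m x : ℂ)) • F x + U x)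
    {g : R3 → ℝ} (hg : ContDiff ℝ ∞ g) :
    -(k * ∫ x, dot (cross (cvec (ν x)) (fE x)) (grad (fun y => (g y : ℂ)) x) ∂(surf Ω)) =
      ∫ x, (dot (U x) (grad (fun y => (g y : ℂ)) x) + DU x * (g x : ℂ)) ∂(vol Ω)
      - a * ∫ x, (m x : ℂ) * dot (cvec (ν x)) (f x) * (g x : ℂ) ∂(surf Ω) := by
  rw [integral_normal_aux hν hΩ hb hE hF hU hm hrel hg,
    integral_add (integrable_dot hU (hg.ofReal'.grad.continuous.memLp_vol hΩ hb 2))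
      (integrable_mul_of_memLp hDU (hg.ofReal'.continuous.memLp_vol hΩ hb 2))]
  have : ∫ x, a * ((m x : ℂ) * D x + dot (F x) (grad (fun y => (m y : ℂ)) x)) * (g x : ℂ) ∂(vol Ω)
      = -∫ x, DU x * (g x : ℂ) ∂(vol Ω) := by
    rw [← integral_neg]
    refine integral_congr_ae ((ae_divergence hν hΩ hb hE hF hU hDU hdiv hm hrel).mono fun x hx => ?_)
    simp only
    rw [hx, neg_mul]
  rw [this]; ring

/-! ### Surface divergence of a tangential field in `H¹(Γ)` -/

theorem clm_apply_eq_sum (L : R3 →L[ℝ] ℝ) (v : R3) :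
    L v = ∑ i, v i * L (EuclideanSpace.single i 1) := by
  conv_lhs => rw [← (EuclideanSpace.basisFun (Fin 3) ℝ).sum_repr v, map_sum]
  simp

/-- The tangential part of the `j`-th basis vector. -/
def tangentialBasis (N : R3 → R3) (j : Fin 3) (x : R3) : R3 :=
  EuclideanSpace.single j 1 - N x j • N x

theorem contDiff_tangentialBasis {N : R3 → R3} (hN : ContDiff ℝ ∞ N) (j : Fin 3) :
    ContDiff ℝ ∞ (tangentialBasis N j) :=
  contDiff_const.sub (((contDiff_piLp 2).1 hN j).smul hN)

/-- In the Leibniz rule the normal derivative of `g` is multiplied by `⟨n, T⟩`, which vanishes by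
tangency. -/
theorem surfDiv_smul (n : R3 → R3) {g : R3 → ℝ} {T : R3 → R3} (hg : ContDiff ℝ ∞ g)
    (hT : ContDiff ℝ ∞ T) {x : R3} (hx : inner ℝ (n x) (T x) = 0) :
    surfDiv n (fun y => g y • T y) x = fderiv ℝ g x (T x) + g x * surfDiv n T x := by
  have hd : ∀ v, fderiv ℝ (fun y => g y • T y) x v = g x • fderiv ℝ T x v + fderiv ℝ g x v • T x := by
    intro v
    rw [fderiv_fun_smul (hg.differentiable (by simp) x) (hT.differentiable (by simp) x)]
    simp
  simp only [surfDiv, hd, PiLp.add_apply, PiLp.smul_apply, smul_eq_mul, Finset.sum_add_distrib,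
    inner_add_right, inner_smul_right, hx, clm_apply_eq_sum (fderiv ℝ g x) (T x), ← Finset.mul_sum]
  simp only [mul_comm (T x _)]
  ring

theorem continuous_surfDiv {N T : R3 → R3} (hN : ContDiff ℝ ∞ N) (hT : ContDiff ℝ ∞ T) :
    Continuous (surfDiv N T) := by
  have hD : Continuous (fderiv ℝ T) := hT.continuous_fderiv (by simp)
  have hNc := hN.continuous
  unfold surfDiv
  refine Continuous.sub (continuous_finsetSum _ fun i _ => ?_) ?_
  · exact (EuclideanSpace.proj i).continuous.comp (hD.clm_apply continuous_const)
  · exact hNc.inner (hD.clm_apply hNc)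

theorem pd_ofReal {g : R3 → ℝ} (hg : ContDiff ℝ ∞ g) (i : Fin 3) (x : R3) :
    pd i (fun y => (g y : ℂ)) x = (fderiv ℝ g x (EuclideanSpace.single i 1) : ℂ) := by
  have h : HasFDerivAt (fun y => (g y : ℂ)) (Complex.ofRealCLM.comp (fderiv ℝ g x)) x :=
    Complex.ofRealCLM.hasFDerivAt.comp x (hg.differentiable (by simp) x).hasFDerivAt
  rw [pd, h.fderiv]; simp

theorem L2norm_norm {F : Type*} [NormedAddCommGroup F] (m : Measure R3) (u : R3 → F) :
    L2norm m (fun x => ‖u x‖) = L2norm m u := by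
  rw [L2norm, L2norm, eLpNorm_norm]

/-- The function `w` is the surface divergence of `f`. Weak tangential gradients accept only
tangential test fields, so the `j`-th component is tested with `g T_j`, where `T_j` is the
tangential part of the `j`-th basis vector. After summation over `j` the terms `f_j ⟨T_j, ∇g⟩` add
up to `⟨f, ∇g⟩`, because `f` is tangential. -/
theorem exists_surface_divergence (hν : IsInnerUnitNormal Ω ν) (hΩ : IsOpen Ω)
    (hb : Bornology.IsBounded Ω) : ∃ K : ℝ, 0 ≤ K ∧
    ∀ (f : R3 → C3) (G : Fin 3 → R3 → C3), MemLp f 2 (surf Ω) →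
      (∀ j, IsTangentialGradient Ω ν (fun x => f x j) (G j)) →
      (∀ᵐ x ∂(surf Ω), dot (cvec (ν x)) (f x) = 0) →
      ∃ w : R3 → ℂ, MemLp w 2 (surf Ω) ∧
        L2norm (surf Ω) w ≤ K * (L2norm (surf Ω) f + ∑ j, L2norm (surf Ω) (G j)) ∧
        ∀ g : R3 → ℝ, ContDiff ℝ ∞ g →
          ∫ x, dot (f x) (grad (fun y => (g y : ℂ)) x) ∂(surf Ω)
            = -∫ x, w x * (g x : ℂ) ∂(surf Ω) := by
  have hfin := surf_lt_top hν hΩ hb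
  obtain ⟨N, hN, hNν⟩ := hν.exists_smooth_extension hΩ
  set T := tangentialBasis N with hTdef
  have hT : ∀ j, ContDiff ℝ ∞ (T j) := contDiff_tangentialBasis hN
  have hTt : ∀ j, ∀ x ∈ frontier Ω, inner ℝ (ν x) (T j x) = 0 := by
    intro j x hx
    rw [hTdef, tangentialBasis, inner_sub_right, inner_smul_right, hNν x hx,
      real_inner_self_eq_norm_sq, hν.norm_eq hx]
    simp [EuclideanSpace.inner_single_right]
  set c : Fin 3 → R3 → ℝ := fun j => surfDiv N (T j) with hc
  have hcc : ∀ j, Continuous (c j) := fun j => continuous_surfDiv hN (hT j)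
  have hcν : ∀ j, ∀ x ∈ frontier Ω, surfDiv ν (T j) x = c j x := by
    intro j x hx
    simp only [hc, surfDiv, hNν x hx]
  obtain ⟨M, hM0, hM⟩ : ∃ M : ℝ, 0 ≤ M ∧ ∀ x ∈ frontier Ω, ∀ j, ‖T j x‖ ≤ M ∧ |c j x| ≤ M := by
    have hcont : Continuous fun x => ∑ j, (‖T j x‖ + |c j x|) :=
      continuous_finsetSum _ fun j _ => (hT j).continuous.norm.add (hcc j).abs
    obtain ⟨M, hM⟩ := hb.isCompact_closure.exists_bound_of_continuousOn hcont.continuousOn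
    refine ⟨max M 0, le_max_right _ _, fun x hx j => ?_⟩
    have h1 := (le_abs_self _).trans ((hM x (frontier_subset_closure hx)).trans (le_max_left M 0))
    have h2 : ‖T j x‖ + |c j x| ≤ ∑ j, (‖T j x‖ + |c j x|) :=
      Finset.single_le_sum (f := fun j => ‖T j x‖ + |c j x|) (fun _ _ => by positivity)
        (Finset.mem_univ j)
    constructor <;> linarith [norm_nonneg (T j x), abs_nonneg (c j x)]
  -- Each of the three summands of `w` is at most `M (|G_j| + |f|)`, so `|f|` is counted three
  -- times.
  refine ⟨3 * M, by positivity, fun f G hf hG htan => ?_⟩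
  have mG : ∀ j, MemLp (G j) 2 (surf Ω) := fun j => (hG j).2.1
  have mfj : ∀ j, MemLp (fun x => f x j) 2 (surf Ω) := fun j => (hG j).1
  set w : R3 → ℂ := fun x => ∑ j, (dot (G j x) (cvec (T j x)) + (c j x : ℂ) * f x j) with hw
  have mw : MemLp w 2 (surf Ω) := memLp_finsetSum _ fun j _ =>
    (memLp_surf_dot hb (hT j).cvec.continuous (mG j)).add
      (memLp_surf_mul hb (Complex.continuous_ofReal.comp (hcc j)) (mfj j))
  refine ⟨w, mw, ?_, fun g hg => ?_⟩
  · set v : R3 → ℝ := fun x => ‖f x‖ + ∑ j, ‖G j x‖ with hv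
    have ms : MemLp (fun x => ∑ j, ‖G j x‖) 2 (surf Ω) :=
      memLp_finsetSum _ fun j _ => (mG j).norm
    have mv : MemLp v 2 (surf Ω) := hf.norm.add ms
    have h1 : L2norm (surf Ω) w ≤ 3 * M * L2norm (surf Ω) v := by
      refine L2norm_le_of_ae_le mv (by positivity) (ae_surf_of_forall fun x hx => ?_)
      have hterm : ∀ j, ‖dot (G j x) (cvec (T j x)) + (c j x : ℂ) * f x j‖
          ≤ M * ‖G j x‖ + M * ‖f x‖ := by
        intro j
        refine (norm_add_le _ _).trans (add_le_add ((norm_dot_le _ _).trans ?_) ?_)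
        · rw [norm_cvec, mul_comm]
          exact mul_le_mul_of_nonneg_right (hM x hx j).1 (norm_nonneg _)
        · rw [norm_mul, Complex.norm_real, Real.norm_eq_abs]
          exact mul_le_mul (hM x hx j).2 (PiLp.norm_apply_le _ _) (norm_nonneg _) hM0
      refine (norm_sum_le_of_le _ fun j _ => hterm j).trans ?_
      have hvn : 0 ≤ v x := by positivity
      rw [Real.norm_eq_abs, abs_of_nonneg hvn]
      simp only [hv, Fin.sum_univ_three]
      nlinarith [mul_nonneg hM0 (norm_nonneg (G 0 x)), mul_nonneg hM0 (norm_nonneg (G 1 x)),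
        mul_nonneg hM0 (norm_nonneg (G 2 x))]
    refine h1.trans (mul_le_mul_of_nonneg_left ?_ (by positivity))
    refine (L2norm_add_le hf.norm ms).trans ?_
    rw [L2norm_norm]
    gcongr
    simp only [Fin.sum_univ_three]
    refine (L2norm_add_le ((mG 0).norm.add (mG 1).norm) (mG 2).norm).trans ?_
    rw [L2norm_norm]
    gcongr
    refine (L2norm_add_le (mG 0).norm (mG 1).norm).trans ?_
    rw [L2norm_norm, L2norm_norm]
  · set Φ : Fin 3 → R3 → R3 := fun j x => g x • T j x with hΦ
    have hΦd : ∀ j, ContDiff ℝ ∞ (Φ j) := fun j => hg.smul (hT j)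
    have hΦt : ∀ j, ∀ x ∈ frontier Ω, inner ℝ (ν x) (Φ j x) = 0 := fun j x hx => by
      rw [hΦ, inner_smul_right, hTt j x hx, mul_zero]
    have hΦdiv : ∀ j, ∀ x ∈ frontier Ω,
        surfDiv ν (Φ j) x = fderiv ℝ g x (T j x) + g x * c j x := fun j x hx => by
      rw [hΦ, surfDiv_smul ν hg (hT j) (hTt j x hx), hcν j x hx]
    have i1 : ∀ j, Integrable (fun x => f x j * (surfDiv ν (Φ j) x : ℂ)) (surf Ω) := by
      intro j
      have hcont : Continuous fun x => ((surfDiv N (Φ j) x : ℝ) : ℂ) :=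
        Complex.continuous_ofReal.comp (continuous_surfDiv hN (hΦd j))
      refine (integrable_mul_of_memLp (mfj j) (hcont.memLp_surf hb 2)).congr
        (ae_surf_of_forall fun x hx => ?_)
      simp only [surfDiv, hNν x hx]
    have i2 : ∀ j, Integrable (fun x => dot (G j x) (cvec (Φ j x))) (surf Ω) := fun j =>
      integrable_dot (mG j) ((hΦd j).cvec.continuous.memLp_surf hb 2)
    have hsum : ∫ x, ∑ j, (f x j * (surfDiv ν (Φ j) x : ℂ) + dot (G j x) (cvec (Φ j x))) ∂(surf Ω)
        = 0 := by
      rw [integral_finsetSum _ fun j _ => (i1 j).fun_add (i2 j)]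
      refine Finset.sum_eq_zero fun j _ => ?_
      rw [integral_add (i1 j) (i2 j), (hG j).2.2.2 (Φ j) (hΦd j) (hΦt j)]
      ring
    have hpt : ∀ᵐ x ∂(surf Ω),
        ∑ j, (f x j * (surfDiv ν (Φ j) x : ℂ) + dot (G j x) (cvec (Φ j x)))
        = dot (f x) (grad (fun y => (g y : ℂ)) x) + w x * (g x : ℂ) := by
      filter_upwards [htan, ae_surf_mem Ω] with x hx hxΓ
      have hcv : ∀ j, dot (G j x) (cvec (Φ j x)) = (g x : ℂ) * dot (G j x) (cvec (T j x)) := by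
        intro j
        rw [← dot_smul_right]
        congr 1
        ext i; simp [hΦ]
      have hTj : ∀ j, fderiv ℝ g x (T j x) = fderiv ℝ g x (EuclideanSpace.single j 1)
          - ν x j * fderiv ℝ g x (ν x) := by
        intro j
        rw [hTdef, tangentialBasis, map_sub, map_smul, hNν x hxΓ, smul_eq_mul]
      have hgr : dot (f x) (grad (fun y => (g y : ℂ)) x)
          = ∑ j, f x j * (fderiv ℝ g x (EuclideanSpace.single j 1) : ℂ) := by
        simp only [dot, grad, pd_ofReal hg]
      rw [hgr, hw, Finset.sum_mul, ← Finset.sum_add_distrib]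
      have hx' : ∑ j, (ν x j : ℂ) * f x j = 0 := hx
      -- The normal derivative of `g`, which the fields `T_j` do not see, drops out of `⟨f, ∇g⟩` as
      -- well.
      have hzero : ∑ j, f x j * ((ν x j : ℂ) * (fderiv ℝ g x (ν x) : ℂ)) = 0 := by
        have : ∑ j, f x j * ((ν x j : ℂ) * (fderiv ℝ g x (ν x) : ℂ))
            = (∑ j, (ν x j : ℂ) * f x j) * (fderiv ℝ g x (ν x) : ℂ) := by
          rw [Finset.sum_mul]; exact Finset.sum_congr rfl fun j _ => by ring
        rw [this, hx', zero_mul]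
      rw [← sub_eq_zero, ← Finset.sum_sub_distrib, ← neg_eq_zero, ← Finset.sum_neg_distrib, ← hzero]
      refine Finset.sum_congr rfl fun j _ => ?_
      rw [hΦdiv j x hxΓ, hTj, hcv]
      push_cast
      ring
    have mgr := hg.ofReal'.grad.continuous.memLp_surf (Ω := Ω) hb 2
    have mg := hg.ofReal'.continuous.memLp_surf (Ω := Ω) hb 2
    rw [integral_congr_ae hpt, integral_add (integrable_dot hf mgr)
      (integrable_mul_of_memLp mw mg)] at hsum
    exact eq_neg_of_add_eq_zero_left hsum

end

section

variable {Ω : Set R3} {ν : R3 → R3} {m : Measure R3}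

/-! ### Estimates for solutions -/

theorem L2norm_le_add_of_ae_le {F G K : Type*} [NormedAddCommGroup F] [NormedAddCommGroup G]
    [NormedAddCommGroup K] {u : R3 → F} {v : R3 → G} {w : R3 → K} (hv : MemLp v 2 m)
    (hw : MemLp w 2 m) {α β : ℝ} (hα : 0 ≤ α) (hβ : 0 ≤ β)
    (h : ∀ᵐ x ∂m, ‖u x‖ ≤ α * ‖v x‖ + β * ‖w x‖) :
    L2norm m u ≤ α * L2norm m v + β * L2norm m w := by
  have mv : MemLp (fun x => α * ‖v x‖) 2 m := hv.norm.const_mul α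
  have mw : MemLp (fun x => β * ‖w x‖) 2 m := hw.norm.const_mul β
  have h1 : L2norm m u ≤ 1 * L2norm m ((fun x => α * ‖v x‖) + fun x => β * ‖w x‖) := by
    refine L2norm_le_of_ae_le (mv.add mw) zero_le_one (h.mono fun x hx => ?_)
    rw [one_mul, Pi.add_apply, Real.norm_eq_abs]
    exact hx.trans (le_abs_self _)
  rw [one_mul] at h1
  refine h1.trans ((L2norm_add_le mv mw).trans (add_le_add ?_ ?_))
  · exact L2norm_le_of_ae_le hv hα (ae_of_all _ fun x => by simp [abs_of_nonneg hα])
  · exact L2norm_le_of_ae_le hw hβ (ae_of_all _ fun x => by simp [abs_of_nonneg hβ])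

theorem norm_integral_dot_conj3_le {u v : R3 → C3} (hu : MemLp u 2 m) (hv : MemLp v 2 m) :
    ‖∫ x, dot (u x) (conj3 (v x)) ∂m‖ ≤ L2norm m u * L2norm m v := by
  refine (norm_integral_le_integral_norm _).trans (le_trans ?_ (integral_norm_mul_le hu hv))
  refine integral_mono_ae (integrable_dot hu (memLp_conj3 hv)).norm (integrable_norm_mul hu hv)
    (ae_of_all _ fun x => ?_)
  simpa only [norm_conj3] using norm_dot_le (u x) (conj3 (v x))

theorem dot_conj3_swap (a b : C3) : dot a (conj3 b) = (starRingEnd ℂ) (dot b (conj3 a)) := by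
  simp [dot, mul_comm]

/-- A coefficient that is bounded above and below, with bounded gradient, on the closure of the
domain. -/
structure IsBoundedCoeff (Ω : Set R3) (a : R3 → ℝ) (d M : ℝ) : Prop where
  contDiff : ContDiff ℝ ∞ a
  one_le : ∀ x ∈ closure Ω, 1 ≤ d * a x
  le : ∀ x ∈ closure Ω, a x ≤ M
  norm_grad_le : ∀ x ∈ closure Ω, ‖grad (fun y => (a y : ℂ)) x‖ ≤ M

/-- The constants are left free above a threshold so that one pair can serve both `eps` and `mu`. -/
theorem exists_isBoundedCoeff (hb : Bornology.IsBounded Ω) {a : R3 → ℝ} (ha : ContDiff ℝ ∞ a)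
    (hpos : ∀ x ∈ closure Ω, 0 < a x) :
    ∃ B : ℝ, ∀ d M, B ≤ d → B ≤ M → IsBoundedCoeff Ω a d M := by
  have hK := hb.isCompact_closure
  obtain ⟨B₁, h1⟩ := hK.exists_bound_of_continuousOn
    (f := fun x => (a x)⁻¹) (ha.continuous.continuousOn.inv₀ fun x hx => (hpos x hx).ne')
  obtain ⟨B₂, h2⟩ := hK.exists_bound_of_continuousOn ha.continuous.continuousOn
  obtain ⟨B₃, h3⟩ := hK.exists_bound_of_continuousOn ha.ofReal'.grad.continuous.continuousOn
  refine ⟨max B₁ (max B₂ B₃), fun d M hd hM => ⟨ha, fun x hx => ?_, fun x hx => ?_, fun x hx => ?_⟩⟩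
  · have h := (le_abs_self _).trans ((h1 x hx).trans ((le_max_left _ _).trans hd))
    have hp := hpos x hx
    calc (1 : ℝ) = (a x)⁻¹ * a x := (inv_mul_cancel₀ hp.ne').symm
      _ ≤ d * a x := by gcongr
  · exact (le_abs_self _).trans ((h2 x hx).trans
      ((le_max_left _ _).trans ((le_max_right _ _).trans hM)))
  · exact (h3 x hx).trans ((le_max_right _ _).trans ((le_max_right _ _).trans hM))

section

variable {a : R3 → ℝ} {d M h : ℝ} {k : ℂ} {C F U : R3 → C3} {D DU : R3 → ℂ}

theorem L2norm_curl_le (hΩ : IsOpen Ω) (ha : IsBoundedCoeff Ω a d M) (hd : 0 ≤ d) (hM : 0 ≤ M)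
    (hh : 0 < h) (hk : ‖k‖ ≤ 2) (hF : MemLp F 2 (vol Ω)) (hU : MemLp U 2 (vol Ω))
    (hrel : ∀ᵐ x ∂(vol Ω), (h : ℂ) • C x = (k * (a x : ℂ)) • F x + U x) :
    h * L2norm (vol Ω) C ≤ 2 * M * L2norm (vol Ω) F + L2norm (vol Ω) U := by
  have key := L2norm_le_add_of_ae_le (u := C) hF hU (α := h⁻¹ * (2 * M)) (β := h⁻¹)
    (by positivity) (by positivity) (by
      filter_upwards [hrel, ae_restrict_mem hΩ.measurableSet] with x hx hxΩ
      have hxc := subset_closure hxΩ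
      have hax : 0 ≤ a x := by
        by_contra hneg
        nlinarith [ha.one_le x hxc, not_le.1 hneg]
      have h1 : h * ‖C x‖ ≤ 2 * M * ‖F x‖ + ‖U x‖ := by
        calc h * ‖C x‖ = ‖(h : ℂ) • C x‖ := by rw [norm_smul]; simp [abs_of_pos hh]
          _ ≤ ‖k‖ * a x * ‖F x‖ + ‖U x‖ := by
            rw [hx]
            refine (norm_add_le _ _).trans_eq ?_
            rw [norm_smul, norm_mul, Complex.norm_real, Real.norm_eq_abs, abs_of_nonneg hax]
          _ ≤ _ := by gcongr; exact ha.le x hxc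
      rw [mul_assoc, ← mul_add]
      exact (le_inv_mul_iff₀ hh).2 h1)
  rw [mul_assoc, ← mul_add] at key
  exact (le_inv_mul_iff₀ hh).1 key

theorem L2norm_div_le (hΩ : IsOpen Ω) (ha : IsBoundedCoeff Ω a d M) (hd : 0 ≤ d) (hM : 0 ≤ M)
    (hk : 1 ≤ ‖k‖) (hF : MemLp F 2 (vol Ω)) (hDU : MemLp DU 2 (vol Ω))
    (hrel : ∀ᵐ x ∂(vol Ω),
      k * ((a x : ℂ) * D x + dot (F x) (grad (fun y => (a y : ℂ)) x)) = -DU x) :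
    L2norm (vol Ω) D ≤ d * M * L2norm (vol Ω) F + d * L2norm (vol Ω) DU := by
  refine L2norm_le_add_of_ae_le hF hDU (by positivity) hd ?_
  filter_upwards [hrel, ae_restrict_mem hΩ.measurableSet] with x hx hxΩ
  have hxc := subset_closure hxΩ
  set S := (a x : ℂ) * D x + dot (F x) (grad (fun y => (a y : ℂ)) x) with hS
  have hSn : ‖S‖ ≤ ‖DU x‖ := by
    rw [← norm_neg (DU x), ← hx, norm_mul]
    exact le_mul_of_one_le_left (norm_nonneg _) hk
  have h1 : ‖(a x : ℂ) * D x‖ ≤ ‖DU x‖ + ‖F x‖ * M := by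
    have : (a x : ℂ) * D x = S - dot (F x) (grad (fun y => (a y : ℂ)) x) := by rw [hS]; ring
    rw [this]
    refine (norm_sub_le _ _).trans (add_le_add hSn ((norm_dot_le _ _).trans ?_))
    gcongr
    exact ha.norm_grad_le x hxc
  have h2 : a x * ‖D x‖ ≤ ‖(a x : ℂ) * D x‖ := by
    rw [norm_mul, Complex.norm_real]
    gcongr
    exact le_abs_self _
  calc ‖D x‖ ≤ d * a x * ‖D x‖ := le_mul_of_one_le_left (norm_nonneg _) (ha.one_le x hxc)
    _ = d * (a x * ‖D x‖) := by ring
    _ ≤ d * (‖DU x‖ + ‖F x‖ * M) := by gcongr; exact h2.trans h1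
    _ = _ := by ring

theorem L2norm_normal_le (ha : IsBoundedCoeff Ω a d M) (hd : 0 ≤ d) (hk : 1 ≤ ‖k‖)
    {u v : R3 → ℂ} {c : ℝ} (hc : 0 ≤ c) (hv : MemLp v 2 (surf Ω))
    (hrel : ∀ᵐ x ∂(surf Ω), ‖k * ((a x : ℂ) * u x)‖ ≤ c * ‖v x‖) :
    L2norm (surf Ω) u ≤ d * c * L2norm (surf Ω) v := by
  refine L2norm_le_of_ae_le hv (by positivity) ?_
  filter_upwards [hrel, ae_surf_mem Ω] with x hx hxΓ
  have hxc := frontier_subset_closure hxΓ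
  have h2 : a x * ‖u x‖ ≤ ‖k * ((a x : ℂ) * u x)‖ := by
    rw [norm_mul, norm_mul, Complex.norm_real]
    calc a x * ‖u x‖ ≤ ‖a x‖ * ‖u x‖ := by gcongr; exact le_abs_self _
      _ ≤ _ := le_mul_of_one_le_left (by positivity) hk
  calc ‖u x‖ ≤ d * a x * ‖u x‖ := le_mul_of_one_le_left (norm_nonneg _) (ha.one_le x hxc)
    _ = d * (a x * ‖u x‖) := by ring
    _ ≤ d * (c * ‖v x‖) := by exact mul_le_mul_of_nonneg_left (h2.trans hx) hd
    _ = _ := by ring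

theorem memLp_vol_smul (hΩ : IsOpen Ω) (hb : Bornology.IsBounded Ω) {c : R3 → ℂ} {F : R3 → C3}
    (hc : Continuous c) (hF : MemLp F 2 (vol Ω)) : MemLp (fun x => c x • F x) 2 (vol Ω) := by
  obtain ⟨B, hB⟩ := hb.isCompact_closure.exists_bound_of_continuousOn hc.continuousOn
  refine hF.of_le_mul (c := B) (hc.aestronglyMeasurable.smul hF.1) ?_
  refine (ae_restrict_mem hΩ.measurableSet).mono fun x hx => ?_
  rw [norm_smul]
  exact mul_le_mul_of_nonneg_right (hB x (subset_closure hx)) (norm_nonneg _)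

theorem integral_curl_dot_conj3 (hΩ : IsOpen Ω) (hb : Bornology.IsBounded Ω)
    (ha : Continuous a) (hF : MemLp F 2 (vol Ω)) (hU : MemLp U 2 (vol Ω))
    (hrel : ∀ᵐ x ∂(vol Ω), (h : ℂ) • C x = (k * (a x : ℂ)) • F x + U x) :
    (h : ℂ) * ∫ x, dot (C x) (conj3 (F x)) ∂(vol Ω) =
      k * ((∫ x, a x * ‖F x‖ ^ 2 ∂(vol Ω) : ℝ) : ℂ) + ∫ x, dot (U x) (conj3 (F x)) ∂(vol Ω) := by
  have hac : Continuous fun x => (a x : ℂ) := Complex.continuous_ofReal.comp ha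
  have maF := memLp_vol_smul hΩ hb hac hF
  rw [← integral_complex_ofReal, ← integral_const_mul, ← integral_const_mul, ← integral_add _
    (integrable_dot hU (memLp_conj3 hF))]
  · refine integral_congr_ae (hrel.mono fun x hx => ?_)
    simp only
    rw [← dot_smul_left, hx, dot_add_left, dot_smul_left, dot_conj3_self]
    push_cast
    ring
  · refine ((integrable_dot maF (memLp_conj3 hF)).const_mul k).congr (ae_of_all _ fun x => ?_)
    simp only [dot_smul_left, dot_conj3_self]
    push_cast
    ring

theorem le_integral_coeff (hΩ : IsOpen Ω) (hb : Bornology.IsBounded Ω)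
    (ha : IsBoundedCoeff Ω a d M) (hF : MemLp F 2 (vol Ω)) :
    L2norm (vol Ω) F ^ 2 ≤ d * ∫ x, a x * ‖F x‖ ^ 2 ∂(vol Ω) := by
  have hi : Integrable (fun x => ‖F x‖ ^ 2) (vol Ω) := by
    simpa only [sq] using integrable_norm_mul hF hF
  have hac := ha.contDiff.continuous
  rw [L2norm_sq hF, ← integral_const_mul]
  refine integral_mono_ae hi (Integrable.const_mul ?_ d) ?_
  · obtain ⟨B, hB⟩ := hb.isCompact_closure.exists_bound_of_continuousOn hac.continuousOn
    refine hi.bdd_mul (c := B) hac.aestronglyMeasurable ?_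
    exact (ae_restrict_mem hΩ.measurableSet).mono fun x hx => hB x (subset_closure hx)
  · refine (ae_restrict_mem hΩ.measurableSet).mono fun x hx => ?_
    simp only
    rw [← mul_assoc]
    exact le_mul_of_one_le_left (by positivity) (ha.one_le x (subset_closure hx))

end

/-- The first equation is paired with the conjugate of `H`, the second with the conjugate of `E`,
and the two are linked by integration by parts. In the real part, `Re z` disappears and `Im z`
multiplies the positive quantity `∫ μ|H|² + ε|E|²`. -/
theorem energy_estimate (hν : IsInnerUnitNormal Ω ν) (hΩ : IsOpen Ω) (hb : Bornology.IsBounded Ω)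
    {eps mu : R3 → ℝ} {d M h : ℝ} (hε : IsBoundedCoeff Ω eps d M) (hμ : IsBoundedCoeff Ω mu d M)
    (hd : 0 ≤ d) (hh : 0 < h) {z : ℂ} {U₁ U₂ E H f g CE CH : R3 → C3} {DE DH : R3 → ℂ}
    (hE : HasTraceWith Ω E f CE DE) (hH : HasTraceWith Ω H g CH DH)
    (hU₁ : MemLp U₁ 2 (vol Ω)) (hU₂ : MemLp U₂ 2 (vol Ω))
    (hrE : ∀ᵐ x ∂(vol Ω), (h : ℂ) • CE x = (Complex.I * z * (mu x : ℂ)) • H x + U₁ x)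
    (hrH : ∀ᵐ x ∂(vol Ω), (h : ℂ) • CH x = (-(Complex.I * z) * (eps x : ℂ)) • E x + U₂ x) :
    |z.im| * (L2norm (vol Ω) E ^ 2 + L2norm (vol Ω) H ^ 2) ≤
      d * (L2norm (vol Ω) U₁ * L2norm (vol Ω) H + L2norm (vol Ω) U₂ * L2norm (vol Ω) E
        + h * L2norm (surf Ω) (fun x => cross (cvec (ν x)) (f x)) * L2norm (surf Ω) g) := by
  have hp := hE.integral_pair hν hΩ hb hH
  have m1 : MemLp (fun x => cross (cvec (ν x)) (f x)) 2 (surf Ω) := memLp_cross_normal hν hΩ hE.2.1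
  -- the two energy identities
  have i1 : (h : ℂ) * ∫ x, dot (CE x) (conj3 (H x)) ∂(vol Ω) =
      Complex.I * z * ((∫ x, mu x * ‖H x‖ ^ 2 ∂(vol Ω) : ℝ) : ℂ)
        + ∫ x, dot (U₁ x) (conj3 (H x)) ∂(vol Ω) := by
    exact integral_curl_dot_conj3 hΩ hb hμ.contDiff.continuous hH.1 hU₁ hrE
  have i2 := integral_curl_dot_conj3 hΩ hb hε.contDiff.continuous hE.1 hU₂ hrH
  have i3 : ∫ x, dot (E x) (conj3 (CH x)) ∂(vol Ω)
      = (starRingEnd ℂ) (∫ x, dot (CH x) (conj3 (E x)) ∂(vol Ω)) := by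
    rw [← integral_conj]
    exact integral_congr_ae (ae_of_all _ fun x => dot_conj3_swap _ _)
  have b1 := norm_integral_dot_conj3_le hU₁ hH.1
  have b2 := norm_integral_dot_conj3_le hU₂ hE.1
  have b3 := norm_integral_dot_conj3_le m1 hH.2.1
  have l1 := le_integral_coeff hΩ hb hμ hH.1
  have l2 := le_integral_coeff hΩ hb hε hE.1
  rw [i3] at hp
  have r1 := congrArg Complex.re i1
  have r2 := congrArg Complex.re i2
  have r3 := congrArg Complex.re hp
  simp only [Complex.mul_re, Complex.add_re, Complex.sub_re, Complex.neg_re, Complex.neg_im,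
    Complex.ofReal_re, Complex.ofReal_im, Complex.I_re, Complex.I_im, Complex.mul_im,
    Complex.conj_re] at r1 r2 r3
  set X := ∫ x, mu x * ‖H x‖ ^ 2 ∂(vol Ω)
  set Y := ∫ x, eps x * ‖E x‖ ^ 2 ∂(vol Ω)
  set P := ∫ x, dot (U₁ x) (conj3 (H x)) ∂(vol Ω)
  set Q := ∫ x, dot (U₂ x) (conj3 (E x)) ∂(vol Ω)
  set T := ∫ x, dot (cross (cvec (ν x)) (f x)) (conj3 (g x)) ∂(surf Ω)
  -- The real parts of `i z X` and `-i z Y` are `-Im z · X` and `Im z · Y`; their difference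
  -- collects both weighted energies with the same sign.
  have e : z.im * (X + Y) = P.re - Q.re + h * T.re := by
    linear_combination r1 - r2 - h * r3
  have b1' := abs_le.1 ((Complex.abs_re_le_norm P).trans b1)
  have b2' := abs_le.1 ((Complex.abs_re_le_norm Q).trans b2)
  have b3' := abs_le.1 ((Complex.abs_re_le_norm T).trans b3)
  set t := L2norm (surf Ω) (fun x => cross (cvec (ν x)) (f x))
  have b4 : |h * T.re| ≤ h * t * L2norm (surf Ω) g := by
    rw [abs_mul, abs_of_pos hh, mul_assoc]
    gcongr
    exact (Complex.abs_re_le_norm T).trans b3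
  have e' : |z.im * (X + Y)| ≤ L2norm (vol Ω) U₁ * L2norm (vol Ω) H
      + L2norm (vol Ω) U₂ * L2norm (vol Ω) E + h * t * L2norm (surf Ω) g := by
    have b4' := abs_le.1 b4
    rw [e, abs_le]
    constructor <;> linarith
  calc |z.im| * (L2norm (vol Ω) E ^ 2 + L2norm (vol Ω) H ^ 2)
      ≤ |z.im| * (d * |X + Y|) := by
        gcongr
        have := mul_le_mul_of_nonneg_left (le_abs_self (X + Y)) hd
        linarith
    _ = d * |z.im * (X + Y)| := by rw [abs_mul]; ring
    _ ≤ _ := by gcongr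

/-- Young's inequality absorbs `e` and `k` into the left side. The boundary product `t g` is kept,
to be absorbed later by the trace of `H`. -/
theorem energy_absorb {d h θ τ e k u₁ u₂ t g : ℝ} (hθ : θ * τ = 1) (hτ : 0 ≤ τ)
    (h1 : θ * (e ^ 2 + k ^ 2) ≤ d * (u₁ * k + u₂ * e + h * t * g)) :
    e ^ 2 + k ^ 2 ≤ d ^ 2 * τ ^ 2 * (u₁ ^ 2 + u₂ ^ 2) + 2 * d * τ * h * t * g := by
  have h2 : e ^ 2 + k ^ 2 ≤ τ * d * (u₁ * k + u₂ * e + h * t * g) := by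
    have := mul_le_mul_of_nonneg_left h1 hτ
    calc e ^ 2 + k ^ 2 = τ * (θ * (e ^ 2 + k ^ 2)) := by linear_combination (-(e ^ 2 + k ^ 2)) * hθ
      _ ≤ _ := by linarith
  nlinarith [sq_nonneg (k - τ * d * u₁), sq_nonneg (e - τ * d * u₂)]

/-- Rellich remainder in terms of the field and the sources. -/
theorem remainder_le {d M K h e k u D δ c R : ℝ} (hd : 0 ≤ d) (hM : 0 ≤ M) (hK : 0 ≤ K)
    (hh : 0 < h) (hh1 : h ≤ 1) (he : 0 ≤ e) (hR : R ≤ K * (e * (e + δ + c)))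
    (hc : h * c ≤ 2 * M * k + u) (hδ : δ ≤ d * M * e + d * D) :
    h * R ≤ K * (2 + 2 * M + d * M + d) * (e ^ 2 + k ^ 2 + u ^ 2 + h ^ 2 * D ^ 2) := by
  have h1 : e * (h * c) ≤ e * (2 * M * k + u) := by gcongr
  have h2 : h * (e * δ) ≤ h * (e * (d * M * e + d * D)) := by gcongr
  have h3 : h * e ^ 2 ≤ e ^ 2 := mul_le_of_le_one_left (sq_nonneg _) hh1
  have h4 : d * M * (h * e ^ 2) ≤ d * M * e ^ 2 := by gcongr
  have h5 : M * (2 * (e * k)) ≤ M * (e ^ 2 + k ^ 2) := by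
    gcongr; nlinarith [sq_nonneg (e - k)]
  have h6 : d * (e * (h * D)) ≤ d * (e ^ 2 + h ^ 2 * D ^ 2) := by
    gcongr; nlinarith [sq_nonneg (e - h * D), sq_nonneg (h * D), sq_nonneg e]
  have h7 : e * u ≤ e ^ 2 + u ^ 2 := by nlinarith [sq_nonneg (e - u), sq_nonneg e, sq_nonneg u]
  have key : h * (e * (e + δ + c)) ≤
      (2 + 2 * M + d * M + d) * (e ^ 2 + k ^ 2 + u ^ 2 + h ^ 2 * D ^ 2) := by
    have p1 : 0 ≤ (1 + d * M + d) * (k ^ 2 + u ^ 2) := by positivity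
    have p2 : 0 ≤ M * (e ^ 2 + k ^ 2 + 2 * u ^ 2) := by positivity
    have p3 : 0 ≤ (2 + 2 * M + d * M) * (h ^ 2 * D ^ 2) := by positivity
    have p4 : 0 ≤ k ^ 2 := by positivity
    nlinarith
  calc h * R ≤ h * (K * (e * (e + δ + c))) := by gcongr
    _ = K * (h * (e * (e + δ + c))) := by ring
    _ ≤ K * _ := mul_le_mul_of_nonneg_left key hK
    _ = _ := by ring

/-- Dividing the remainder by `h` costs `η = h⁻¹`, which the factor `h` of the boundary product `t
g` compensates. That product is then split as `g² / 2` plus a multiple of `τ² t²`; moving `g² / 2`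
to the left and doubling gives the constant. Here `u` and `D` stand for squared norms. -/
theorem trace_absorb {L d h η τ f g t n RE RH S u D : ℝ} (hL : 0 ≤ L)
    (hh : 0 < h) (hη : h * η = 1) (hτ : 1 ≤ τ) (hu : 0 ≤ u) (hD : 0 ≤ D)
    (hf : f ^ 2 ≤ 2 * t ^ 2 + RE) (hg : g ^ 2 ≤ 2 * n ^ 2 + RH)
    (hR : h * (RE + RH) ≤ L * (S + u + h ^ 2 * D))
    (hS : S ≤ d ^ 2 * τ ^ 2 * u + 2 * d * τ * h * t * g) :
    f ^ 2 + g ^ 2 ≤ (4 + 4 * L ^ 2 * d ^ 2 + 2 * L * (1 + d ^ 2)) * (τ ^ 2 * t ^ 2 + n ^ 2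
      + η * τ ^ 2 * u + h * D) := by
  have hη0 : 0 < η := by by_contra hneg; nlinarith [not_lt.1 hneg]
  have hτ2 : 1 ≤ τ ^ 2 := one_le_pow₀ hτ
  have h1 : RE + RH ≤ L * (d ^ 2 * (η * τ ^ 2 * u) + 2 * d * τ * t * g + η * u + h * D) := by
    calc RE + RH = η * (h * (RE + RH)) := by linear_combination (-(RE + RH)) * hη
      _ ≤ η * (L * (d ^ 2 * τ ^ 2 * u + 2 * d * τ * h * t * g + u + h ^ 2 * D)) :=
        mul_le_mul_of_nonneg_left (hR.trans (by gcongr)) hη0.le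
      _ = _ := by linear_combination (L * (2 * d * τ * t * g + h * D)) * hη
  have h2 : η * u ≤ η * τ ^ 2 * u := by
    have := mul_le_mul_of_nonneg_left hτ2 (mul_nonneg hη0.le hu)
    nlinarith
  have h3 : L * (2 * d * τ * t * g) ≤ g ^ 2 / 2 + 2 * L ^ 2 * d ^ 2 * (τ ^ 2 * t ^ 2) := by
    nlinarith [sq_nonneg (g - 2 * L * d * τ * t)]
  have h4 : t ^ 2 ≤ τ ^ 2 * t ^ 2 := le_mul_of_one_le_left (sq_nonneg _) hτ2
  have h5 : L * (η * u) ≤ L * (η * τ ^ 2 * u) := by gcongr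
  set V := η * τ ^ 2 * u
  have hV : 0 ≤ V := by positivity
  have hhD : 0 ≤ h * D := by positivity
  set W := τ ^ 2 * t ^ 2
  have hW : 0 ≤ W := by positivity
  have q1 : 0 ≤ (4 * L ^ 2 * d ^ 2 + 2 * L * (1 + d ^ 2)) * n ^ 2 := by positivity
  have q2 : 0 ≤ (4 + 4 * L ^ 2 * d ^ 2) * V := by positivity
  have q3 : 0 ≤ (4 + 4 * L ^ 2 * d ^ 2 + 2 * L * d ^ 2) * (h * D) := by positivity
  have q4 : 0 ≤ (2 * L * (1 + d ^ 2)) * W := by positivity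
  linarith [sq_nonneg f]

theorem IsSolution.exists_with (hν : IsInnerUnitNormal Ω ν) (hΩ : IsOpen Ω)
    (hb : Bornology.IsBounded Ω) {eps mu : R3 → ℝ} (hε : Continuous eps) (hμ : Continuous mu)
    {h : ℝ} {z : ℂ} {U₁ U₂ ft E H f g : R3 → C3}
    (hs : IsSolution Ω ν eps mu h z U₁ U₂ ft E H f g)
    (hU₁ : MemLp U₁ 2 (vol Ω)) (hU₂ : MemLp U₂ 2 (vol Ω)) :
    ∃ CE DE CH DH, HasTraceWith Ω E f CE DE ∧ HasTraceWith Ω H g CH DH ∧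
      (∀ᵐ x ∂(vol Ω), (h : ℂ) • CE x = (Complex.I * z * (mu x : ℂ)) • H x + U₁ x) ∧
      ∀ᵐ x ∂(vol Ω), (h : ℂ) • CH x = (-(Complex.I * z) * (eps x : ℂ)) • E x + U₂ x := by
  obtain ⟨CE, DE, hE⟩ := hs.trace_E.exists_with
  obtain ⟨CH, DH, hH⟩ := hs.trace_H.exists_with
  have cμ : Continuous fun x => Complex.I * z * (mu x : ℂ) :=
    continuous_const.mul (Complex.continuous_ofReal.comp hμ)
  have cε : Continuous fun x => Complex.I * z * (eps x : ℂ) :=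
    continuous_const.mul (Complex.continuous_ofReal.comp hε)
  have m1 : MemLp (fun x => (Complex.I * z * (mu x : ℂ)) • H x + U₁ x) 2 (vol Ω) :=
    (memLp_vol_smul hΩ hb cμ hH.1).add hU₁
  have m2 : MemLp (fun x => -((Complex.I * z * (eps x : ℂ)) • E x) + U₂ x) 2 (vol Ω) :=
    (memLp_vol_smul hΩ hb cε hE.1).neg.add hU₂
  refine ⟨CE, DE, CH, DH, hE, hH, hE.ae_curl hν hΩ hb m1 hs.curl_E, ?_⟩
  filter_upwards [hH.ae_curl hν hΩ hb m2 hs.curl_H] with x hx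
  rw [hx, neg_mul, neg_smul]

theorem one_le_norm_of_max {z : ℂ} (hz : max |z.re| |z.im| = 1) : 1 ≤ ‖z‖ := by
  rw [← hz]
  exact max_le (Complex.abs_re_le_norm z) (Complex.abs_im_le_norm z)

theorem norm_le_two_of_max {z : ℂ} (hz : max |z.re| |z.im| = 1) : ‖z‖ ≤ 2 := by
  have h1 := le_max_left |z.re| |z.im|
  have h2 := le_max_right |z.re| |z.im|
  linarith [Complex.norm_le_abs_re_add_abs_im z]

/-- Both traces are controlled by the tangential trace of `E`, the normal trace of `H`, and the
sources. -/
theorem exists_trace_estimate (hν : IsInnerUnitNormal Ω ν) (hΩ : IsOpen Ω)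
    (hb : Bornology.IsBounded Ω) {eps mu : R3 → ℝ} {d M : ℝ} (hε : IsBoundedCoeff Ω eps d M)
    (hμ : IsBoundedCoeff Ω mu d M) (hd : 0 ≤ d) (hM : 0 ≤ M) :
    ∃ B : ℝ, 0 ≤ B ∧ ∀ (h : ℝ) (z : ℂ), 0 < h → h ≤ 1 → max |z.re| |z.im| = 1 → 0 < |z.im| →
      ∀ (U₁ U₂ E H f g CE CH : R3 → C3) (D₁ D₂ DE DH : R3 → ℂ),
        MemLp U₁ 2 (vol Ω) → MemLp U₂ 2 (vol Ω) → MemLp D₁ 2 (vol Ω) → MemLp D₂ 2 (vol Ω) →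
        IsWeakDiv Ω U₁ D₁ → IsWeakDiv Ω U₂ D₂ →
        HasTraceWith Ω E f CE DE → HasTraceWith Ω H g CH DH →
        (∀ᵐ x ∂(vol Ω), (h : ℂ) • CE x = (Complex.I * z * (mu x : ℂ)) • H x + U₁ x) →
        (∀ᵐ x ∂(vol Ω), (h : ℂ) • CH x = (-(Complex.I * z) * (eps x : ℂ)) • E x + U₂ x) →
        L2norm (surf Ω) f ^ 2 + L2norm (surf Ω) g ^ 2 ≤
          B * ((|z.im|⁻¹) ^ 2 * L2norm (surf Ω) (fun x => cross (cvec (ν x)) (f x)) ^ 2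
            + L2norm (surf Ω) (fun x => dot (cvec (ν x)) (g x)) ^ 2
            + h⁻¹ * (|z.im|⁻¹) ^ 2 * (L2norm (vol Ω) U₁ ^ 2 + L2norm (vol Ω) U₂ ^ 2)
            + h * (L2norm (vol Ω) D₁ ^ 2 + L2norm (vol Ω) D₂ ^ 2)) := by
  obtain ⟨K, hK, hrell⟩ := rellich hν hΩ hb
  -- The factor 2 is needed because the remainders of `E` and of `H` each contain the full energy
  -- `‖E‖² + ‖H‖²`.
  set L := K * (2 + 2 * M + d * M + d) * 2 with hL
  refine ⟨4 + 4 * L ^ 2 * d ^ 2 + 2 * L * (1 + d ^ 2), by positivity, ?_⟩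
  intro h z hh hh1 hz hθ U₁ U₂ E H f g CE CH D₁ D₂ DE DH mU₁ mU₂ mD₁ mD₂ hd₁ hd₂ hE hH hrE hrH
  have hz1 : 1 ≤ ‖Complex.I * z‖ := by simpa using one_le_norm_of_max hz
  have hz2 : ‖Complex.I * z‖ ≤ 2 := by simpa using norm_le_two_of_max hz
  have hz1' : 1 ≤ ‖-(Complex.I * z)‖ := by rwa [norm_neg]
  have hz2' : ‖-(Complex.I * z)‖ ≤ 2 := by rwa [norm_neg]
  have c1 := L2norm_curl_le hΩ hμ hd hM hh hz2 hH.1 mU₁ hrE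
  have c2 := L2norm_curl_le hΩ hε hd hM hh hz2' hE.1 mU₂ hrH
  have d1 := L2norm_div_le hΩ hμ hd hM hz1 hH.1 mD₁
    (ae_divergence hν hΩ hb hE hH mU₁ mD₁ hd₁ hμ.contDiff hrE)
  have d2 := L2norm_div_le hΩ hε hd hM hz1' hE.1 mD₂
    (ae_divergence hν hΩ hb hH hE mU₂ mD₂ hd₂ hε.contDiff hrH)
  have en := energy_estimate hν hΩ hb hε hμ hd hh hE hH mU₁ mU₂ hrE hrH
  have split : L2norm (surf Ω) f ^ 2 = L2norm (surf Ω) (fun x => cross (cvec (ν x)) (f x)) ^ 2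
      + L2norm (surf Ω) (fun x => dot (cvec (ν x)) (f x)) ^ 2 := by
    have m1 := memLp_cross_normal hν hΩ hE.2.1
    have m2 := memLp_dot_normal hν hΩ hE.2.1
    rw [L2norm_sq hE.2.1, L2norm_sq m1, L2norm_sq m2, ← integral_add]
    · refine integral_congr_ae ((ae_norm_normal hν).mono fun x hx => ?_)
      simp only
      rw [norm_sq_cross_cvec, ← norm_cvec, hx, one_pow, one_mul]
    · simpa only [sq] using integrable_norm_mul m1 m1
    · simpa only [sq] using integrable_norm_mul m2 m2
  have rE := abs_le.1 (hrell E f CE DE hE)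
  have rH := abs_le.1 (hrell H g CH DH hH)
  -- The curl of `E` comes from the equation with source `U₁`, but its divergence from the one with
  -- `U₂`; for `H` the roles are exchanged.
  have remE := remainder_le hd hM hK hh hh1 (L2norm_nonneg _ E) le_rfl c1 d2
  have remH := remainder_le hd hM hK hh hh1 (L2norm_nonneg _ H) le_rfl c2 d1
  have hθ1 : |z.im| ≤ 1 := hz ▸ le_max_right _ _
  refine trace_absorb (S := L2norm (vol Ω) E ^ 2 + L2norm (vol Ω) H ^ 2) (by positivity) hh
    (mul_inv_cancel₀ hh.ne') ((one_le_inv₀ hθ).2 hθ1) (by positivity) (by positivity)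
    (RE := K * (L2norm (vol Ω) E * (L2norm (vol Ω) E + L2norm (vol Ω) DE + L2norm (vol Ω) CE)))
    (RH := K * (L2norm (vol Ω) H * (L2norm (vol Ω) H + L2norm (vol Ω) DH + L2norm (vol Ω) CH)))
    ?_ ?_ ?_ ?_
  -- For `E` the bound `2‖⟨ν, f⟩‖² ≤ ‖f‖² + R_E` is used, and `split` eliminates the normal trace in
  -- favour of the tangential one.
  · linarith [rE.1]
  -- For `H` the opposite sign is used, which keeps only the normal trace.
  · linarith [rH.2]
  · have q : 0 ≤ K * (2 + 2 * M + d * M + d) := by positivity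
    have q1 : 0 ≤ K * (2 + 2 * M + d * M + d) * (L2norm (vol Ω) U₁ ^ 2 + L2norm (vol Ω) U₂ ^ 2
      + h ^ 2 * (L2norm (vol Ω) D₁ ^ 2 + L2norm (vol Ω) D₂ ^ 2)) := by positivity
    rw [hL, mul_add]
    refine (add_le_add remE remH).trans ?_
    linarith
  · exact energy_absorb (mul_inv_cancel₀ hθ.ne') (by positivity) en

/-- Passage from squares to norms. The factor `2 * B + 1` is a convenient upper bound for the square
root of `2 * B`. -/
theorem add_le_of_sq_add_sq_le {f g B Q X c : ℝ} (hB : 0 ≤ B) (hc : 0 ≤ c) (hX : 0 ≤ X)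
    (h1 : f ^ 2 + g ^ 2 ≤ B * Q) (h2 : Q ≤ (c * X) ^ 2) : f + g ≤ (2 * B + 1) * c * X := by
  refine le_of_sq_le_sq ?_ (by positivity)
  have h3 : (f + g) ^ 2 ≤ 2 * (B * Q) := by nlinarith [sq_nonneg (f - g)]
  have h4 : B * Q ≤ B * (c * X) ^ 2 := by gcongr
  have h5 : 0 ≤ (4 * B ^ 2 + 2 * B + 1) * (c * X) ^ 2 := by positivity
  calc (f + g) ^ 2 ≤ 2 * (B * (c * X) ^ 2) := by linarith
    _ ≤ ((2 * B + 1) * c * X) ^ 2 := by linarith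

end

/-! ### The normal trace of `H` and the two estimates of the theorem -/

section

variable {Ω : Set R3} {ν : R3 → R3} {eps mu : R3 → ℝ} {d M B h : ℝ} {z : ℂ}

/-- The hypothesis `hint` says that `v` represents weakly the normal component of `U - k curl E`.
Comparison with `integral_normal` gives `a μ ⟨ν, g⟩ = -v` almost everywhere on Γ. In part (a) `v` is
`h` times the surface divergence of the data, in part (b) it is `u₁`. -/
theorem L2norm_normal_trace_le (hν : IsInnerUnitNormal Ω ν) (hΩ : IsOpen Ω)
    (hb : Bornology.IsBounded Ω) (hμ : IsBoundedCoeff Ω mu d M) (hd : 0 ≤ d)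
    {E H f g CE CH U : R3 → C3} {DE DH D : R3 → ℂ} {k a : ℂ} (ha : 1 ≤ ‖a‖)
    (hE : HasTraceWith Ω E f CE DE) (hH : HasTraceWith Ω H g CH DH)
    (hU : MemLp U 2 (vol Ω)) (hD : MemLp D 2 (vol Ω)) (hdiv : IsWeakDiv Ω U D)
    (hrel : ∀ᵐ x ∂(vol Ω), k • CE x = (a * (mu x : ℂ)) • H x + U x)
    {v : R3 → ℂ} (hv : MemLp v 2 (surf Ω))
    (hint : ∀ φ : R3 → ℝ, ContDiff ℝ ∞ φ → HasCompactSupport φ →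
      ∫ x, (dot (U x) (grad (fun y => (φ y : ℂ)) x) + D x * (φ x : ℂ)) ∂(vol Ω)
        + k * ∫ x, dot (cross (cvec (ν x)) (f x)) (grad (fun y => (φ y : ℂ)) x) ∂(surf Ω)
        = -∫ x, v x * (φ x : ℂ) ∂(surf Ω)) :
    L2norm (surf Ω) (fun x => dot (cvec (ν x)) (g x)) ≤ d * L2norm (surf Ω) v := by
  have := surf_lt_top hν hΩ hb
  have mw : MemLp (fun x => (mu x : ℂ) * dot (cvec (ν x)) (g x)) 2 (surf Ω) :=
    memLp_surf_mul hb (Complex.continuous_ofReal.comp hμ.contDiff.continuous)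
      (memLp_dot_normal hν hΩ hH.2.1)
  have key : ∀ᵐ x ∂(surf Ω), a * ((mu x : ℂ) * dot (cvec (ν x)) (g x)) + v x = 0 := by
    refine ae_surf_eq_zero_of_test ((mw.const_mul a).add hv) fun φ hφ hc => ?_
    have e := integral_normal hν hΩ hb hE hH hU hD hdiv hμ.contDiff hrel hφ
    have mφ := hφ.ofReal'.continuous.memLp_surf (Ω := Ω) hb 2
    simp only [add_mul, mul_assoc a]
    rw [integral_add ((integrable_mul_of_memLp mw mφ).const_mul a) (integrable_mul_of_memLp hv mφ),
      integral_const_mul]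
    linear_combination e + hint φ hφ hc
  have h1 := L2norm_normal_le (u := fun x => dot (cvec (ν x)) (g x)) hμ hd ha zero_le_one hv
    (key.mono fun x hx => by rw [eq_neg_of_add_eq_zero_left hx, norm_neg, one_mul])
  rwa [mul_one] at h1

theorem L2norm_le_H1norm (Ω : Set R3) (h : ℝ) (F : R3 → C3) (G : Fin 3 → R3 → C3) :
    L2norm (surf Ω) F ≤ H1norm Ω h F G := by
  rw [H1norm]
  exact Real.le_sqrt_of_sq_le (le_add_of_nonneg_right (by positivity))

theorem mul_L2norm_le_H1norm (Ω : Set R3) (h : ℝ) (F : R3 → C3) (G : Fin 3 → R3 → C3)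
    (j : Fin 3) : h * L2norm (surf Ω) (G j) ≤ H1norm Ω h F G := by
  rw [H1norm]
  refine Real.le_sqrt_of_sq_le ?_
  rw [mul_pow]
  have h1 : L2norm (surf Ω) (G j) ^ 2 ≤ ∑ j, L2norm (surf Ω) (G j) ^ 2 :=
    Finset.single_le_sum (f := fun j => L2norm (surf Ω) (G j) ^ 2) (fun _ _ => by positivity)
      (Finset.mem_univ j)
  have h2 : h ^ 2 * L2norm (surf Ω) (G j) ^ 2 ≤ h ^ 2 * ∑ j, L2norm (surf Ω) (G j) ^ 2 := by
    gcongr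
  linarith [sq_nonneg (L2norm (surf Ω) F)]

/-- Without sources only two boundary terms remain: the prescribed tangential trace of `E`, and the
normal trace of `H`, bounded by `h` times the surface divergence of the data. The weight `h` is what
makes the semiclassical norm appear. -/
theorem exists_estimate_sourceFree (hν : IsInnerUnitNormal Ω ν) (hΩ : IsOpen Ω)
    (hb : Bornology.IsBounded Ω) (hε : IsBoundedCoeff Ω eps d M)
    (hμ : IsBoundedCoeff Ω mu d M) (hd : 0 ≤ d) (hM : 0 ≤ M) :
    ∃ C : ℝ, 0 ≤ C ∧ ∀ (h : ℝ) (z : ℂ), 0 < h → h ≤ 1 → max |z.re| |z.im| = 1 → 0 < |z.im| →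
      ∀ (ft E H f g : R3 → C3) (G : Fin 3 → R3 → C3),
        (∀ j, IsTangentialGradient Ω ν (fun x => ft x j) (G j)) →
        IsSolution Ω ν eps mu h z 0 0 ft E H f g →
        L2norm (surf Ω) f + L2norm (surf Ω) g ≤ C * (|z.im|⁻¹ * H1norm Ω h ft G) := by
  obtain ⟨B, hB, hest⟩ := exists_trace_estimate hν hΩ hb hε hμ hd hM
  obtain ⟨K, hK, hdivΓ⟩ := exists_surface_divergence hν hΩ hb
  refine ⟨(2 * B + 1) * (1 + 4 * d * K), by positivity, ?_⟩
  intro h z hh hh1 hz hθ ft E H f g G hG hs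
  have m0 : MemLp (0 : R3 → C3) 2 (vol Ω) := MemLp.zero
  have m0' : MemLp (0 : R3 → ℂ) 2 (vol Ω) := MemLp.zero
  have hdiv0 : IsWeakDiv Ω 0 0 := fun φ _ _ _ => by simp [dot_zero_left]
  obtain ⟨CE, DE, CH, DH, hE, hH, hrE, hrH⟩ := hs.exists_with hν hΩ hb
    hε.contDiff.continuous hμ.contDiff.continuous m0 m0
  have key := hest h z hh hh1 hz hθ 0 0 E H f g CE CH 0 0 DE DH m0 m0 m0' m0' hdiv0 hdiv0 hE hH
    hrE hrH
  have hft := hs.boundary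
  have mc := memLp_cross_normal hν hΩ hE.2.1
  have mft : MemLp ft 2 (surf Ω) := mc.ae_eq hft
  -- Tangency of the data need not be assumed: the boundary condition makes it a vector product with
  -- `ν`.
  have htan : ∀ᵐ x ∂(surf Ω), dot (cvec (ν x)) (ft x) = 0 :=
    hft.mono fun x hx => by rw [← hx, dot_cross_self]
  obtain ⟨w, mw, hw, hwint⟩ := hdivΓ ft G mft hG htan
  have hz1 : 1 ≤ ‖Complex.I * z‖ := by simpa using one_le_norm_of_max hz
  have mhw : MemLp (fun x => (h : ℂ) * w x) 2 (surf Ω) := mw.const_mul _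
  have hn := L2norm_normal_trace_le (k := (h : ℂ)) (v := fun x => (h : ℂ) * w x) hν hΩ hb hμ hd hz1
    hE hH m0 m0' hdiv0 hrE mhw (by
      intro φ hφ _
      have e1 : ∫ x, dot (cross (cvec (ν x)) (f x)) (grad (fun y => (φ y : ℂ)) x) ∂(surf Ω)
          = ∫ x, dot (ft x) (grad (fun y => (φ y : ℂ)) x) ∂(surf Ω) :=
        integral_congr_ae (hft.mono fun x hx => by simp only; rw [hx])
      rw [e1, hwint φ hφ]
      simp only [Pi.zero_apply, dot_zero_left, zero_mul, add_zero, integral_zero, zero_add,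
        mul_assoc, integral_const_mul, mul_neg])
  have hhw : L2norm (surf Ω) (fun x => (h : ℂ) * w x) ≤ h * L2norm (surf Ω) w :=
    L2norm_le_of_ae_le mw hh.le (ae_of_all _ fun x => by simp [abs_of_pos hh])
  have ht : L2norm (surf Ω) (fun x => cross (cvec (ν x)) (f x)) = L2norm (surf Ω) ft :=
    L2norm_congr hft
  set N := H1norm Ω h ft G with hN
  have hN0 : 0 ≤ N := Real.sqrt_nonneg _
  have hft_le : L2norm (surf Ω) ft ≤ N := L2norm_le_H1norm Ω h ft G
  have hG_le : ∀ j, h * L2norm (surf Ω) (G j) ≤ N := mul_L2norm_le_H1norm Ω h ft G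
  have hn_le : L2norm (surf Ω) (fun x => dot (cvec (ν x)) (g x)) ≤ 4 * d * K * N := by
    have h3 : h * (L2norm (surf Ω) ft + ∑ j, L2norm (surf Ω) (G j)) ≤ 4 * N := by
      have h4 : h * L2norm (surf Ω) ft ≤ L2norm (surf Ω) ft :=
        mul_le_of_le_one_left (L2norm_nonneg _ _) hh1
      rw [Fin.sum_univ_three]
      linarith [hG_le 0, hG_le 1, hG_le 2]
    calc _ ≤ d * (h * L2norm (surf Ω) w) := hn.trans (by gcongr)
      _ ≤ d * (h * (K * (L2norm (surf Ω) ft + ∑ j, L2norm (surf Ω) (G j)))) := by gcongr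
      _ = d * K * (h * (L2norm (surf Ω) ft + ∑ j, L2norm (surf Ω) (G j))) := by ring
      _ ≤ d * K * (4 * N) := by gcongr
      _ = _ := by ring
  -- The normal trace is bounded without loss in `θ`; since `θ ≤ 1`, the factor `θ⁻¹` may be
  -- inserted.
  have hτ : 1 ≤ |z.im|⁻¹ := (one_le_inv₀ hθ).2 (hz ▸ le_max_right _ _)
  refine add_le_of_sq_add_sq_le hB (by positivity) (by positivity) key ?_
  have z1 : L2norm (vol Ω) (0 : R3 → C3) = 0 := by simp [L2norm]
  have z2 : L2norm (vol Ω) (0 : R3 → ℂ) = 0 := by simp [L2norm]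
  rw [z1, z2, ht]
  set τ := |z.im|⁻¹
  have q1 : τ ^ 2 * L2norm (surf Ω) ft ^ 2 ≤ (τ * N) ^ 2 := by
    rw [mul_pow]
    have := L2norm_nonneg (surf Ω) ft
    gcongr
  have q2 : L2norm (surf Ω) (fun x => dot (cvec (ν x)) (g x)) ^ 2 ≤ (4 * d * K) ^ 2 * (τ * N) ^ 2 := by
    rw [← mul_pow]
    refine pow_le_pow_left₀ (L2norm_nonneg _ _) (hn_le.trans ?_) 2
    gcongr
    exact le_mul_of_one_le_left hN0 hτ
  have q3 : 0 ≤ 8 * d * K * (τ * N) ^ 2 := by positivity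
  calc _ ≤ (τ * N) ^ 2 + (4 * d * K) ^ 2 * (τ * N) ^ 2 := by linarith
    _ ≤ ((1 + 4 * d * K) * (τ * N)) ^ 2 := by linarith

/-- With `ν × E = 0` the tangential term of the trace estimate vanishes, and the normal trace of `H`
is determined by `u₁` alone. Taking square roots of the source terms produces the powers `h^(-1/2)`
and `h^(1/2)`. -/
theorem exists_estimate_zeroTangential (hν : IsInnerUnitNormal Ω ν) (hΩ : IsOpen Ω)
    (hb : Bornology.IsBounded Ω) (hε : IsBoundedCoeff Ω eps d M)
    (hμ : IsBoundedCoeff Ω mu d M) (hd : 0 ≤ d) (hM : 0 ≤ M) :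
    ∃ C : ℝ, 0 ≤ C ∧ ∀ (h : ℝ) (z : ℂ), 0 < h → h ≤ 1 → max |z.re| |z.im| = 1 → 0 < |z.im| →
      ∀ (U₁ U₂ E H f g : R3 → C3) (D₁ D₂ u₁ : R3 → ℂ),
        MemLp U₁ 2 (vol Ω) → MemLp U₂ 2 (vol Ω) → MemLp D₁ 2 (vol Ω) → MemLp D₂ 2 (vol Ω) →
        IsWeakDiv Ω U₁ D₁ → IsWeakDiv Ω U₂ D₂ →
        MemLp u₁ 2 (surf Ω) → IsNormalTrace Ω U₁ D₁ u₁ →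
        IsSolution Ω ν eps mu h z U₁ U₂ 0 E H f g →
        L2norm (surf Ω) f + L2norm (surf Ω) g ≤ C * (L2norm (surf Ω) u₁
          + h ^ (-(1 / 2) : ℝ) * |z.im|⁻¹
            * √(L2norm (vol Ω) U₁ ^ 2 + L2norm (vol Ω) U₂ ^ 2)
          + h ^ (1 / 2 : ℝ) * √(L2norm (vol Ω) D₁ ^ 2 + L2norm (vol Ω) D₂ ^ 2)) := by
  obtain ⟨B, hB, hest⟩ := exists_trace_estimate hν hΩ hb hε hμ hd hM
  refine ⟨(2 * B + 1) * (1 + d), by positivity, ?_⟩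
  intro h z hh hh1 hz hθ U₁ U₂ E H f g D₁ D₂ u₁ mU₁ mU₂ mD₁ mD₂ hd₁ hd₂ mu₁ hu₁ hs
  obtain ⟨CE, DE, CH, DH, hE, hH, hrE, hrH⟩ := hs.exists_with hν hΩ hb
    hε.contDiff.continuous hμ.contDiff.continuous mU₁ mU₂
  have key := hest h z hh hh1 hz hθ U₁ U₂ E H f g CE CH D₁ D₂ DE DH mU₁ mU₂ mD₁ mD₂ hd₁ hd₂ hE hH
    hrE hrH
  have hft : ∀ᵐ x ∂(surf Ω), cross (cvec (ν x)) (f x) = 0 := hs.boundary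
  have ht : L2norm (surf Ω) (fun x => cross (cvec (ν x)) (f x)) = 0 := by
    rw [L2norm_congr (v := fun _ => (0 : C3)) hft]
    simp [L2norm]
  have hz1 : 1 ≤ ‖Complex.I * z‖ := by simpa using one_le_norm_of_max hz
  have hn := L2norm_normal_trace_le (k := (h : ℂ)) hν hΩ hb hμ hd hz1 hE hH mU₁ mD₁ hd₁ hrE mu₁ (by
    intro φ hφ hc
    have e1 : ∫ x, dot (cross (cvec (ν x)) (f x)) (grad (fun y => (φ y : ℂ)) x) ∂(surf Ω) = 0 := by
      rw [integral_congr_ae (g := fun _ => (0 : ℂ))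
        (hft.mono fun x hx => by simp only; rw [hx, dot_zero_left])]
      simp
    rw [e1, mul_zero, add_zero]
    exact hu₁ _ hφ.ofReal' hc.ofReal')
  have hr1 : (h ^ (-(1 / 2) : ℝ)) ^ 2 = h⁻¹ := by
    rw [← Real.rpow_natCast, ← Real.rpow_mul hh.le]
    norm_num [Real.rpow_neg_one]
  have hr2 : (h ^ (1 / 2 : ℝ)) ^ 2 = h := by
    rw [← Real.rpow_natCast, ← Real.rpow_mul hh.le]
    norm_num
  have p1 : 0 ≤ L2norm (surf Ω) u₁ := L2norm_nonneg _ _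
  have p2 : 0 ≤ h ^ (-(1 / 2) : ℝ) * |z.im|⁻¹
      * √(L2norm (vol Ω) U₁ ^ 2 + L2norm (vol Ω) U₂ ^ 2) := by positivity
  have p3 : 0 ≤ h ^ (1 / 2 : ℝ) * √(L2norm (vol Ω) D₁ ^ 2 + L2norm (vol Ω) D₂ ^ 2) := by positivity
  have s2 : (h ^ (-(1 / 2) : ℝ) * |z.im|⁻¹
      * √(L2norm (vol Ω) U₁ ^ 2 + L2norm (vol Ω) U₂ ^ 2)) ^ 2
      = h⁻¹ * (|z.im|⁻¹) ^ 2 * (L2norm (vol Ω) U₁ ^ 2 + L2norm (vol Ω) U₂ ^ 2) := by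
    rw [mul_pow, mul_pow, hr1, Real.sq_sqrt (by positivity)]
  have s3 : (h ^ (1 / 2 : ℝ) * √(L2norm (vol Ω) D₁ ^ 2 + L2norm (vol Ω) D₂ ^ 2)) ^ 2
      = h * (L2norm (vol Ω) D₁ ^ 2 + L2norm (vol Ω) D₂ ^ 2) := by
    rw [mul_pow, hr2, Real.sq_sqrt (by positivity)]
  refine add_le_of_sq_add_sq_le hB (by positivity) (by positivity) key ?_
  have hn2 := pow_le_pow_left₀ (L2norm_nonneg _ _) hn 2
  rw [ht, ← s2, ← s3]
  set P := h ^ (-(1 / 2) : ℝ) * |z.im|⁻¹ * √(L2norm (vol Ω) U₁ ^ 2 + L2norm (vol Ω) U₂ ^ 2)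
  set Q := h ^ (1 / 2 : ℝ) * √(L2norm (vol Ω) D₁ ^ 2 + L2norm (vol Ω) D₂ ^ 2)
  set u := L2norm (surf Ω) u₁
  calc _ ≤ (d * u) ^ 2 + P ^ 2 + Q ^ 2 := by linarith
    _ ≤ (d * u + P + Q) ^ 2 := by
      have : 0 ≤ d * u * P + d * u * Q + P * Q := by positivity
      linarith
    _ ≤ _ := by
      refine pow_le_pow_left₀ (by positivity) ?_ 2
      have : 0 ≤ u + d * (P + Q) := by positivity
      linarith

end

end Maxwell

end

theorem theorem3p1
    (Ω : Set Maxwell.R3) (hΩ_open : IsOpen Ω) (hΩ_bdd : Bornology.IsBounded Ω)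
    (hΩ_conn : IsConnected Ω) (hΩ_smooth : Maxwell.HasSmoothBoundary Ω)
    (ν : Maxwell.R3 → Maxwell.R3) (hν : Maxwell.IsInnerUnitNormal Ω ν)
    (eps mu : Maxwell.R3 → ℝ)
    (heps : ContDiff ℝ ∞ eps) (hmu : ContDiff ℝ ∞ mu)
    (heps_pos : ∀ x ∈ closure Ω, 0 < eps x) (hmu_pos : ∀ x ∈ closure Ω, 0 < mu x) :
    ∃ C h₀ : ℝ, 0 < C ∧ 0 < h₀ ∧
      ∀ (h θ : ℝ) (z : ℂ), 0 < h → h ≤ h₀ → max |z.re| |z.im| = 1 → θ = |z.im| → 0 < θ →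
      -- the source-free system
      (∀ (ftilde E H f g : Maxwell.R3 → Maxwell.C3)
          (G : Fin 3 → Maxwell.R3 → Maxwell.C3),
        (∀ j, Maxwell.IsTangentialGradient Ω ν (fun x => ftilde x j) (G j)) →
        Maxwell.IsSolution Ω ν eps mu h z 0 0 ftilde E H f g →
        Maxwell.L2norm (Maxwell.surf Ω) f + Maxwell.L2norm (Maxwell.surf Ω) g
          ≤ C * (θ⁻¹ * Maxwell.H1norm Ω h ftilde G)) ∧
      -- zero tangential boundary data
      (∀ (U₁ U₂ E H f g : Maxwell.R3 → Maxwell.C3) (D₁ D₂ u₁ : Maxwell.R3 → ℂ),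
        MemLp U₁ 2 (Maxwell.vol Ω) → MemLp U₂ 2 (Maxwell.vol Ω) →
        MemLp D₁ 2 (Maxwell.vol Ω) → MemLp D₂ 2 (Maxwell.vol Ω) →
        Maxwell.IsWeakDiv Ω U₁ D₁ → Maxwell.IsWeakDiv Ω U₂ D₂ →
        MemLp u₁ 2 (Maxwell.surf Ω) → Maxwell.IsNormalTrace Ω U₁ D₁ u₁ →
        Maxwell.IsSolution Ω ν eps mu h z U₁ U₂ 0 E H f g →
        Maxwell.L2norm (Maxwell.surf Ω) f + Maxwell.L2norm (Maxwell.surf Ω) g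
          ≤ C * (Maxwell.L2norm (Maxwell.surf Ω) u₁
            + h ^ (-(1 / 2) : ℝ) * θ⁻¹
              * √(Maxwell.L2norm (Maxwell.vol Ω) U₁ ^ 2 + Maxwell.L2norm (Maxwell.vol Ω) U₂ ^ 2)
            + h ^ (1 / 2 : ℝ)
              * √(Maxwell.L2norm (Maxwell.vol Ω) D₁ ^ 2
                + Maxwell.L2norm (Maxwell.vol Ω) D₂ ^ 2))) := by
  obtain ⟨B₁, hB₁⟩ := Maxwell.exists_isBoundedCoeff hΩ_bdd heps heps_pos
  obtain ⟨B₂, hB₂⟩ := Maxwell.exists_isBoundedCoeff hΩ_bdd hmu hmu_pos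
  -- One number plays both roles, bounding the inverses of the coefficients and the coefficients
  -- with their gradients.
  set d := max 0 (max B₁ B₂)
  have hd : 0 ≤ d := le_max_left _ _
  have hd1 : B₁ ≤ d := (le_max_left _ _).trans (le_max_right _ _)
  have hd2 : B₂ ≤ d := (le_max_right _ _).trans (le_max_right _ _)
  have hε := hB₁ d d hd1 hd1
  have hμ := hB₂ d d hd2 hd2
  obtain ⟨C₁, hC₁, ha⟩ := Maxwell.exists_estimate_sourceFree hν hΩ_open hΩ_bdd hε hμ hd hd
  obtain ⟨C₂, hC₂, hb⟩ := Maxwell.exists_estimate_zeroTangential hν hΩ_open hΩ_bdd hε hμ hd hd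
  -- No smallness of `h` beyond `h ≤ 1` is used, hence `h₀ = 1`; the summand 1 makes the constant
  -- strictly positive.
  refine ⟨C₁ + C₂ + 1, 1, by positivity, one_pos, ?_⟩
  rintro h θ z hh hh1 hz rfl hθ
  refine ⟨fun ftilde E H f g G hG hs => ?_, fun U₁ U₂ E H f g D₁ D₂ u₁ m1 m2 m3 m4 hd₁ hd₂ m5 hn hs => ?_⟩
  · refine (ha h z hh hh1 hz hθ ftilde E H f g G hG hs).trans ?_
    refine mul_le_mul_of_nonneg_right (by linarith) (mul_nonneg (by positivity) (Real.sqrt_nonneg _))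
  · refine (hb h z hh hh1 hz hθ U₁ U₂ E H f g D₁ D₂ u₁ m1 m2 m3 m4 hd₁ hd₂ m5 hn hs).trans ?_
    have := Maxwell.L2norm_nonneg (Maxwell.surf Ω) u₁
    refine mul_le_mul_of_nonneg_right (by linarith) (by positivity)
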